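/- Let $\mathcal R(s)=\displaystyle\int_{0\swarrow 1}\frac{x^{-s}e^{\pi i x^2}}{e^{\pi i x}-e^{-\pi i x}}\,dx$ be Riemann's auxiliary function, where $x^{-s}$ is the principal branch and the path is the line of slope $1$ through $1/2$, run from the upper right to the lower left. Then $\mathcal R$ is an entire function. For $\frac12<\alpha\le 1$ and $T>0$ let $N(\alpha,T)$ be the number of zeros $\rho=\beta+i\gamma$ of $\mathcal R(s)$ with $\alpha\le\beta\le1$ and $0<\gamma\le T$, counted with multiplicity. There is an absolute constant $C$ such that for all $\frac12<\alpha\le1$ and all $T\ge2$ the number $N(\alpha,T)$ is finite and \[N(\alpha,T)\le C\,T^{\frac32-\alpha}(\log T)^3 .\] -/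

import Mathlib

open Complex MeasureTheory

/-- The integrand `x^{-s} e^{π i x²} / (e^{π i x} - e^{-π i x})` of Riemann's auxiliary function,
with the principal branch of `x^{-s}`. -/
noncomputable def riemannAuxIntegrand (s x : ℂ) : ℂ :=
  x ^ (-s) * exp (Real.pi * I * x ^ 2) / (exp (Real.pi * I * x) - exp (-(Real.pi * I * x)))

/-- The unit direction `e^{π i / 4}`, pointing up and to the right with slope one. -/
noncomputable def diagDir : ℂ := exp (Real.pi / 4 * I)

/-- Riemann's auxiliary function
`R(s) = ∫_{0 ↙ 1} x^{-s} e^{π i x²} / (e^{π i x} - e^{-π i x}) dx`.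
The path `0 ↙ 1` is the straight line of slope one through the point `1/2`, run from the upper right
to the lower left (whence the minus sign below); it avoids the cut `(-∞, 0]` of the principal
branch and the poles of the integrand. -/
noncomputable def riemannAux (s : ℂ) : ℂ :=
  -∫ r : ℝ, riemannAuxIntegrand s (1 / 2 + r * diagDir) * diagDir

/-- The zeros `ρ = β + iγ` of `R` with `α ≤ β ≤ 1` and `0 < γ ≤ T`. -/
def riemannAuxZeros (α T : ℝ) : Set ℂ :=
  {ρ : ℂ | riemannAux ρ = 0 ∧ α ≤ ρ.re ∧ ρ.re ≤ 1 ∧ 0 < ρ.im ∧ ρ.im ≤ T}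

/-- `N(α, T)`: the number of zeros in `riemannAuxZeros α T`, counted with multiplicity. -/
noncomputable def riemannAuxCount (α T : ℝ) : ℕ :=
  ∑ᶠ ρ ∈ riemannAuxZeros α T, analyticOrderNatAt riemannAux ρ

open Filter
open scoped Real Topology

/-!
Moving the line of integration to the right, to the saddle point `√(t / 2π)`, picks up one residue
`k^{-s}` for each integer that is crossed, and so
`R(σ + it) = ∑_{k ≤ √(t / 2π)} k^{-s} + O(t^{-σ / 2})`. Hence `R` is mollified by the same
`M(s) = ∑_{d ≤ X} μ(d) d^{-s}` as the zeta function. In the mean square of `1 - R M` over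
`T ≤ t ≤ 2T`, Selberg's quadratic form controls the diagonal and a weak form of Hilbert's inequality
the rest. Since `1 - (1 - R M)²` vanishes at the zeros of `R`, Jensen's formula on discs centred at
`2 + it`, averaged over `t`, bounds the number of zeros by this mean square. When `α` is so close to
`1 / 2` that mollifying gains nothing, Jensen's formula for `R` itself suffices.
-/

/-! ### Lines of slope one -/

/-- The point `a + u(1 + i)` of the line of slope one through the real point `a`. The
parameter of `a + r * diagDir` is rescaled by `√2 / 2`, to keep square roots out of coordinates. -/
def diagPoint (a u : ℝ) : ℂ := ⟨a + u, u⟩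

lemma diagPoint_eq (a u : ℝ) : diagPoint a u = a + u * (1 + I) := by
  apply Complex.ext <;> simp [diagPoint]

lemma diagPoint_zero (a : ℝ) : diagPoint a 0 = a := by simp [diagPoint_eq]

lemma continuous_diagPoint (a : ℝ) : Continuous (diagPoint a) := by
  simp only [funext (diagPoint_eq a)]
  fun_prop

lemma diagDir_eq : diagDir = ((√2 / 2 : ℝ) : ℂ) * (1 + I) := by
  unfold diagDir
  rw [show (π / 4 * I : ℂ) = ((π / 4 : ℝ) : ℂ) * I by push_cast; ring, exp_mul_I,
    ← ofReal_cos, ← ofReal_sin, Real.cos_pi_div_four, Real.sin_pi_div_four]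
  ring

lemma diagDir_ne_zero : diagDir ≠ 0 := exp_ne_zero _

lemma norm_diagDir : ‖diagDir‖ = 1 := by
  unfold diagDir
  rw [show (π / 4 * I : ℂ) = ((π / 4 : ℝ) : ℂ) * I by push_cast; ring, norm_exp_ofReal_mul_I]

lemma add_mul_diagDir (a r : ℝ) : (a : ℂ) + r * diagDir = diagPoint a (√2 / 2 * r) := by
  rw [diagDir_eq, diagPoint_eq]; push_cast; ring

lemma neg_sqrt_two_div_two_mul_sq (r : ℝ) : -(√2 / 2 * r) ^ 2 = -(1 / 2) * r ^ 2 := by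
  rw [mul_pow, div_pow, Real.sq_sqrt zero_le_two]; ring

lemma diagPoint_mem_slitPlane {a : ℝ} (ha : 0 < a) (u : ℝ) : diagPoint a u ∈ slitPlane := by
  rw [mem_slitPlane_iff]
  by_cases h : u = 0
  · left; simp [diagPoint, h, ha]
  · right; simpa [diagPoint] using h

lemma diagPoint_ne_zero {a : ℝ} (ha : 0 < a) (u : ℝ) : diagPoint a u ≠ 0 :=
  slitPlane_ne_zero (diagPoint_mem_slitPlane ha u)

lemma normSq_diagPoint (a u : ℝ) : normSq (diagPoint a u) = a ^ 2 + 2 * a * u + 2 * u ^ 2 := by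
  simp only [normSq_apply, diagPoint]; ring

lemma sq_half_le_normSq_diagPoint (a u : ℝ) : a ^ 2 / 2 ≤ normSq (diagPoint a u) := by
  rw [normSq_diagPoint]; nlinarith [sq_nonneg (a + 2 * u)]

lemma half_le_norm_diagPoint (a u : ℝ) : a / 2 ≤ ‖diagPoint a u‖ := by
  apply le_of_sq_le_sq _ (norm_nonneg _)
  rw [← normSq_eq_norm_sq]
  nlinarith [sq_nonneg a, sq_half_le_normSq_diagPoint a u]

lemma norm_diagPoint_le {a : ℝ} (ha : 0 ≤ a) (u : ℝ) : ‖diagPoint a u‖ ≤ a + 2 * |u| := by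
  refine (norm_le_abs_re_add_abs_im _).trans ?_
  have h := abs_add_le a u
  rw [abs_of_nonneg ha] at h
  simp only [diagPoint]
  linarith

lemma abs_log_norm_diagPoint_le {a : ℝ} (ha : 1 / 2 ≤ a) (u : ℝ) :
    |Real.log ‖diagPoint a u‖| ≤ a + 3 + 2 * |u| := by
  have hlower := half_le_norm_diagPoint a u
  have hupper := norm_diagPoint_le (by linarith : 0 ≤ a) u
  have hpos : 0 < ‖diagPoint a u‖ := by linarith
  have hinv : ‖diagPoint a u‖⁻¹ ≤ 4 := by
    rw [inv_le_comm₀ hpos (by norm_num)]; linarith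
  rw [abs_le]
  constructor
  · linarith [Real.one_sub_inv_le_log_of_pos hpos, abs_nonneg u]
  · linarith [Real.log_le_sub_one_of_pos hpos]

lemma norm_log_diagPoint_le {a : ℝ} (ha : 1 / 2 ≤ a) (u : ℝ) :
    ‖log (diagPoint a u)‖ ≤ a + 7 + 2 * |u| := by
  refine (norm_le_abs_re_add_abs_im _).trans ?_
  rw [log_re, log_im]
  linarith [abs_log_norm_diagPoint_le ha u, abs_arg_le_pi (diagPoint a u), Real.pi_lt_four]

/-! ### The integrand of Riemann's auxiliary function -/

lemma norm_exp_pi_I_mul_sq (a u : ℝ) :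
    ‖exp (π * I * diagPoint a u ^ 2)‖ = Real.exp (-(2 * π * ((a + u) * u))) := by
  rw [norm_exp]
  congr 1
  simp only [diagPoint, sq, mul_re, mul_im, ofReal_re, ofReal_im, I_re, I_im]
  ring

lemma norm_cpow_neg_diagPoint {a : ℝ} (ha : 0 < a) (u : ℝ) (s : ℂ) :
    ‖diagPoint a u ^ (-s)‖ = ‖diagPoint a u‖ ^ (-s.re) * Real.exp (s.im * arg (diagPoint a u)) := by
  rw [norm_cpow_of_ne_zero (diagPoint_ne_zero ha u)]
  simp only [neg_re, neg_im, mul_neg, Real.exp_neg, div_inv_eq_mul]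
  ring_nf

lemma norm_cpow_le_exp_norm_mul_norm_log {x : ℂ} (hx : x ≠ 0) (s : ℂ) :
    ‖x ^ s‖ ≤ Real.exp (‖s‖ * ‖log x‖) := by
  rw [cpow_def_of_ne_zero hx, norm_exp, ← norm_mul, mul_comm s]
  exact Real.exp_le_exp.2 (re_le_norm _)

lemma exists_norm_numerator_le (A B : ℝ) : ∃ K : ℝ, ∀ s : ℂ, ‖s‖ ≤ B →
    ∀ a : ℝ, 1 / 2 ≤ a → a ≤ A → ∀ u : ℝ,
      ‖diagPoint a u ^ (-s) * exp (π * I * diagPoint a u ^ 2)‖ * (1 + ‖log (diagPoint a u)‖) ≤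
        K * Real.exp (-u ^ 2) := by
  set c := 2 * B + 2 * π * A + 2 with hc
  refine ⟨Real.exp (B * (A + 7) + (A + 8) + c ^ 2 / 4), fun s hs a ha haA u => ?_⟩
  have hB : 0 ≤ B := (norm_nonneg s).trans hs
  have hlog : ‖log (diagPoint a u)‖ ≤ A + 7 + 2 * |u| :=
    (norm_log_diagPoint_le ha u).trans (by linarith)
  have hpow : ‖diagPoint a u ^ (-s)‖ ≤ Real.exp (B * (A + 7 + 2 * |u|)) := by
    refine (norm_cpow_le_exp_norm_mul_norm_log (diagPoint_ne_zero (by linarith) u) _).trans ?_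
    rw [norm_neg]
    gcongr
  have hweight : 1 + ‖log (diagPoint a u)‖ ≤ Real.exp (A + 8 + 2 * |u|) := by
    linarith [Real.add_one_le_exp (A + 8 + 2 * |u|)]
  have hexponent : B * (A + 7 + 2 * |u|) + -(2 * π * ((a + u) * u)) + (A + 8 + 2 * |u|) ≤
      B * (A + 7) + (A + 8) + c ^ 2 / 4 + -u ^ 2 := by
    have hlin : -(a * u) ≤ A * |u| := by nlinarith [neg_abs_le u, abs_nonneg u]
    have hamgm : c * |u| ≤ c ^ 2 / 4 + u ^ 2 := by
      rw [← sq_abs u]; nlinarith [sq_nonneg (c / 2 - |u|)]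
    have hquad : u ^ 2 ≤ π * u ^ 2 := by nlinarith [sq_nonneg u, Real.pi_gt_three]
    rw [hc] at hamgm ⊢
    nlinarith [Real.pi_pos]
  rw [norm_mul, norm_exp_pi_I_mul_sq]
  calc _ ≤ Real.exp (B * (A + 7 + 2 * |u|)) * Real.exp (-(2 * π * ((a + u) * u))) *
        Real.exp (A + 8 + 2 * |u|) := by gcongr
    _ ≤ _ := by
        simp only [← Real.exp_add]
        exact Real.exp_le_exp.2 hexponent

/-- The denominator `e^{π i x} - e^{-π i x}` of the integrand. -/
noncomputable def auxDenom (x : ℂ) : ℂ := exp (π * I * x) - exp (-(π * I * x))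

lemma riemannAuxIntegrand_eq (s x : ℂ) :
    riemannAuxIntegrand s x = x ^ (-s) * exp (π * I * x ^ 2) / auxDenom x := rfl

lemma differentiable_auxDenom : Differentiable ℂ auxDenom := by
  unfold auxDenom; fun_prop

lemma auxDenom_eq (x : ℂ) : auxDenom x = 2 * I * sin (π * x) := by
  unfold auxDenom
  rw [sin, show π * x * I = π * I * x by ring, show -(π * x) * I = -(π * I * x) by ring]
  linear_combination (exp (π * I * x) - exp (-(π * I * x))) * I_sq

lemma normSq_auxDenom_diagPoint (a u : ℝ) : normSq (auxDenom (diagPoint a u)) =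
    4 * (Real.sin (π * (a + u)) ^ 2 + Real.sinh (π * u) ^ 2) := by
  have hpoint : diagPoint a u = ((a + u : ℝ) : ℂ) + (u : ℝ) * I := by
    rw [diagPoint_eq]; push_cast; ring
  have htwo : normSq (2 : ℂ) = 4 := by rw [normSq_apply]; norm_num
  rw [auxDenom_eq, hpoint, mul_add, ← mul_assoc, ← ofReal_mul, ← ofReal_mul, sin_add_mul_I,
    map_mul, map_mul, normSq_I, ← ofReal_sin, ← ofReal_cos, ← ofReal_cosh, ← ofReal_sinh,
    ← ofReal_mul, ← ofReal_mul, normSq_add_mul_I, htwo, mul_pow, mul_pow, Real.cosh_sq]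
  linear_combination 4 * Real.sinh (π * u) ^ 2 * Real.sin_sq_add_cos_sq (π * (a + u))

lemma abs_le_abs_sinh (x : ℝ) : |x| ≤ |Real.sinh x| := by
  rw [Real.abs_sinh]
  exact Real.self_le_sinh_iff.2 (abs_nonneg x)

lemma two_le_norm_auxDenom (N : ℕ) (u : ℝ) : 2 ≤ ‖auxDenom (diagPoint (N + 1 / 2) u)‖ := by
  apply le_of_sq_le_sq _ (norm_nonneg _)
  rw [← normSq_eq_norm_sq, normSq_auxDenom_diagPoint]
  have hshift : Real.sin (π * (N + 1 / 2 + u)) ^ 2 = Real.cos (π * u) ^ 2 := by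
    rw [show π * (N + 1 / 2 + u) = (π * u + π / 2) + N * π by ring,
      Real.sin_add_nat_mul_pi, Real.sin_add_pi_div_two, mul_pow, ← pow_mul, mul_comm N 2, pow_mul]
    norm_num
  have hsinh : Real.sin (π * u) ^ 2 ≤ Real.sinh (π * u) ^ 2 :=
    sq_le_sq.2 (Real.abs_sin_le_abs.trans (abs_le_abs_sinh _))
  rw [hshift]
  nlinarith [Real.sin_sq_add_cos_sq (π * u)]

lemma one_le_norm_auxDenom (a : ℝ) {u : ℝ} (hu : 1 ≤ |u|) : 1 ≤ ‖auxDenom (diagPoint a u)‖ := by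
  apply le_of_sq_le_sq _ (norm_nonneg _)
  rw [← normSq_eq_norm_sq, normSq_auxDenom_diagPoint]
  have hsinh : 1 ≤ |Real.sinh (π * u)| := by
    refine le_trans ?_ (abs_le_abs_sinh _)
    rw [abs_mul, abs_of_pos Real.pi_pos]
    nlinarith [Real.pi_gt_three]
  nlinarith [sq_nonneg (Real.sin (π * (a + u))), sq_abs (Real.sinh (π * u))]

lemma auxDenom_diagPoint_eq_zero_iff {a u : ℝ} :
    auxDenom (diagPoint a u) = 0 ↔ u = 0 ∧ ∃ k : ℤ, a = k := by
  rw [← normSq_eq_zero, normSq_auxDenom_diagPoint, mul_eq_zero_iff_left four_ne_zero,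
    add_eq_zero_iff_of_nonneg (sq_nonneg _) (sq_nonneg _), sq_eq_zero_iff, sq_eq_zero_iff,
    Real.sinh_eq_zero, mul_eq_zero_iff_left Real.pi_ne_zero, and_comm]
  refine and_congr_right fun hu => ?_
  rw [hu, add_zero, Real.sin_eq_zero_iff]
  refine exists_congr fun k => ?_
  rw [mul_comm, mul_right_inj' Real.pi_ne_zero, eq_comm]

lemma continuous_riemannAuxIntegrand_line (s : ℂ) (N : ℕ) :
    Continuous fun r : ℝ => riemannAuxIntegrand s ((N + 1 / 2 : ℝ) + r * diagDir) := by
  simp_rw [add_mul_diagDir, riemannAuxIntegrand_eq]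
  have hpoint : Continuous fun r : ℝ => diagPoint (N + 1 / 2) (√2 / 2 * r) :=
    (continuous_diagPoint _).comp (by fun_prop)
  refine Continuous.div (Continuous.mul ?_ (by fun_prop))
    (differentiable_auxDenom.continuous.comp hpoint) fun r => ?_
  · exact hpoint.cpow continuous_const fun r => diagPoint_mem_slitPlane (by positivity) _
  · exact norm_pos_iff.1 (by linarith [two_le_norm_auxDenom N (√2 / 2 * r)])

lemma exists_norm_riemannAuxIntegrand_line_le (N : ℕ) (B : ℝ) : ∃ K : ℝ, ∀ s : ℂ, ‖s‖ ≤ B →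
    ∀ r : ℝ, ‖riemannAuxIntegrand s ((N + 1 / 2 : ℝ) + r * diagDir)‖ *
      (1 + ‖log ((N + 1 / 2 : ℝ) + r * diagDir)‖) ≤ K * Real.exp (-(1 / 2) * r ^ 2) := by
  obtain ⟨K, hK⟩ := exists_norm_numerator_le (N + 1 / 2) B
  refine ⟨K, fun s hs r => ?_⟩
  have hnum := hK s hs (N + 1 / 2) (by linarith [(Nat.cast_nonneg N : (0 : ℝ) ≤ N)]) le_rfl
    (√2 / 2 * r)
  rw [neg_sqrt_two_div_two_mul_sq] at hnum
  rw [add_mul_diagDir, riemannAuxIntegrand_eq, norm_div]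
  refine le_trans ?_ hnum
  gcongr
  exact div_le_self (norm_nonneg _) (by linarith [two_le_norm_auxDenom N (√2 / 2 * r)])

lemma integrable_exp_neg_half_sq : Integrable fun r : ℝ => Real.exp (-(1 / 2) * r ^ 2) :=
  integrable_exp_neg_mul_sq (by norm_num)

lemma integrable_riemannAuxIntegrand_line (s : ℂ) (N : ℕ) :
    Integrable fun r : ℝ => riemannAuxIntegrand s ((N + 1 / 2 : ℝ) + r * diagDir) * diagDir := by
  obtain ⟨K, hK⟩ := exists_norm_riemannAuxIntegrand_line_le N ‖s‖
  refine Integrable.mono' (integrable_exp_neg_half_sq.const_mul K)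
    (((continuous_riemannAuxIntegrand_line s N).mul continuous_const).aestronglyMeasurable)
    (Eventually.of_forall fun r => ?_)
  rw [norm_mul, norm_diagDir, mul_one]
  refine le_trans (le_mul_of_one_le_right (norm_nonneg _) ?_) (hK s le_rfl r)
  linarith [norm_nonneg (log ((N + 1 / 2 : ℝ) + r * diagDir))]

/-- The integral of the integrand of Riemann's auxiliary function along the line of slope one
through `a`, run upwards, which is the direction opposite to that of `riemannAux`. -/
noncomputable def auxLineIntegral (s : ℂ) (a : ℝ) : ℂ :=
  ∫ r : ℝ, riemannAuxIntegrand s (a + r * diagDir) * diagDir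

lemma riemannAux_eq_neg_auxLineIntegral (s : ℂ) : riemannAux s = -auxLineIntegral s (1 / 2) := by
  unfold riemannAux auxLineIntegral
  norm_num

lemma hasDerivAt_riemannAuxIntegrand {x : ℂ} (hx : x ≠ 0) (s : ℂ) :
    HasDerivAt (fun s => riemannAuxIntegrand s x) (riemannAuxIntegrand s x * -log x) s := by
  have hpow : HasDerivAt (fun s : ℂ => x ^ (-s)) (x ^ (-s) * log x * -1) s :=
    (hasDerivAt_neg s).const_cpow (Or.inl hx)
  refine ((hpow.mul_const (exp (π * I * x ^ 2))).div_const (auxDenom x)).congr_deriv ?_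
  rw [riemannAuxIntegrand_eq]; ring

lemma differentiable_auxLineIntegral (N : ℕ) :
    Differentiable ℂ fun s => auxLineIntegral s (N + 1 / 2 : ℝ) := by
  intro s₀
  obtain ⟨K, hK⟩ := exists_norm_riemannAuxIntegrand_line_le N (‖s₀‖ + 1)
  have hmem : ∀ r : ℝ, ((N + 1 / 2 : ℝ) : ℂ) + r * diagDir ∈ slitPlane := fun r => by
    rw [add_mul_diagDir]; exact diagPoint_mem_slitPlane (by positivity) _
  have hlog : Continuous fun r : ℝ => log (((N + 1 / 2 : ℝ) : ℂ) + r * diagDir) :=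
    Continuous.clog (by fun_prop) hmem
  have hcont (s : ℂ) := continuous_riemannAuxIntegrand_line s N
  refine (hasDerivAt_integral_of_dominated_loc_of_deriv_le (𝕜 := ℂ) (μ := volume)
    (F := fun s r => riemannAuxIntegrand s ((N + 1 / 2 : ℝ) + r * diagDir) * diagDir)
    (F' := fun s r => riemannAuxIntegrand s ((N + 1 / 2 : ℝ) + r * diagDir) *
      -log ((N + 1 / 2 : ℝ) + r * diagDir) * diagDir)
    (bound := fun r => K * Real.exp (-(1 / 2) * r ^ 2)) (Metric.ball_mem_nhds s₀ zero_lt_one)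
    (Eventually.of_forall fun s => ((hcont s).mul continuous_const).aestronglyMeasurable)
    (integrable_riemannAuxIntegrand_line s₀ N)
    (((hcont s₀).mul hlog.neg).mul continuous_const).aestronglyMeasurable
    (Eventually.of_forall fun r s hs => ?_) (integrable_exp_neg_half_sq.const_mul K)
    (Eventually.of_forall fun r s _ =>
      (hasDerivAt_riemannAuxIntegrand (slitPlane_ne_zero (hmem r)) s).mul_const diagDir)
    ).2.differentiableAt
  have hs' : ‖s‖ ≤ ‖s₀‖ + 1 := by
    rw [Metric.mem_ball, dist_eq_norm] at hs
    linarith [norm_sub_norm_le s s₀]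
  rw [norm_mul, norm_mul, norm_diagDir, mul_one, norm_neg]
  refine le_trans ?_ (hK s hs' r)
  gcongr
  linarith

theorem differentiable_riemannAux : Differentiable ℂ riemannAux := by
  have heq : riemannAux = -fun s => auxLineIntegral s ((0 : ℕ) + 1 / 2 : ℝ) := by
    funext s
    rw [riemannAux_eq_neg_auxLineIntegral, Pi.neg_apply, Nat.cast_zero, zero_add]
  exact heq ▸ (differentiable_auxLineIntegral 0).neg

/-! ### The residue theorem in a horizontal strip -/

/-- The filter of the points of the strip `|im z| ≤ h` that tend to one of its two ends. -/
def stripEnds (h : ℝ) : Filter ℂ := comap (fun z => |z.re|) atTop ⊓ 𝓟 {z | |z.im| ≤ h}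

lemma tendsto_abs_re_stripEnds (h : ℝ) : Tendsto (fun z => |z.re|) (stripEnds h) atTop :=
  tendsto_comap.mono_left inf_le_left

lemma stripEnds_le_cobounded (h : ℝ) : stripEnds h ≤ Bornology.cobounded ℂ :=
  tendsto_norm_atTop_iff_cobounded.1 <|
    tendsto_atTop_mono abs_re_le_norm (tendsto_abs_re_stripEnds h)

lemma eventually_stripEnds {h : ℝ} {p : ℂ → Prop} : (∀ᶠ z in stripEnds h, p z) ↔
    ∀ᶠ R : ℝ in atTop, ∀ r y : ℝ, |r| = R → |y| ≤ h → p (r + y * I) := by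
  rw [stripEnds, eventually_inf_principal, eventually_comap]
  refine eventually_congr (Eventually.of_forall fun R => ⟨?_, ?_⟩)
  · exact fun H r y hr hy => H _ (by simpa using hr) (by simpa using hy)
  · exact fun H z hz hy => by simpa using H z.re z.im hz hy

lemma ofReal_add_mul_I_ne_zero (x : ℝ) {y : ℝ} (hy : y ≠ 0) : (x : ℂ) + y * I ≠ 0 := fun h =>
  hy (by simpa using congrArg im h)

section Strip

variable {E : Type*} [NormedAddCommGroup E] [NormedSpace ℂ E] {g : ℂ → E} {h : ℝ}

lemma tendsto_intervalIntegral_vertical (hh : 0 < h) (hg : Tendsto g (stripEnds h) (𝓝 0)) :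
    Tendsto (fun r : ℝ => ∫ y in (-h)..h, g (r + y * I)) (comap abs atTop) (𝓝 0) := by
  rw [Metric.nhds_basis_closedBall.tendsto_right_iff] at hg ⊢
  intro ε hε
  rw [eventually_comap]
  filter_upwards [eventually_stripEnds.1 (hg (ε / (2 * h)) (by positivity))] with R hR r hr
  have hbound : ∀ y ∈ Set.uIoc (-h) h, ‖g (r + y * I)‖ ≤ ε / (2 * h) := by
    intro y hy
    rw [Set.uIoc_of_le (by linarith)] at hy
    simpa using hR r y hr (abs_le.2 ⟨hy.1.le, hy.2⟩)
  rw [mem_closedBall_zero_iff]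
  refine (intervalIntegral.norm_integral_le_of_norm_le_const hbound).trans_eq ?_
  rw [abs_of_pos (by linarith)]
  field_simp
  ring

lemma intervalIntegral_sub_horizontal_eq (hh : 0 ≤ h) (hg : DifferentiableOn ℂ g {z | |z.im| ≤ h})
    (R : ℝ) : ∫ x in (-R)..R, (g (x + ((-h : ℝ) : ℂ) * I) - g (x + (h : ℂ) * I)) =
      I • (∫ y in (-h)..h, g (((-R : ℝ) : ℂ) + y * I)) -
        I • ∫ y in (-h)..h, g ((R : ℂ) + y * I) := by
  have hline {y : ℝ} (hy : |y| ≤ h) :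
      IntervalIntegrable (fun x : ℝ => g (x + (y : ℂ) * I)) volume (-R) R :=
    (hg.continuousOn.comp (by fun_prop) fun x _ => by simpa using hy).intervalIntegrable
  have hrect := integral_boundary_rect_eq_zero_of_differentiableOn g (⟨-R, -h⟩ : ℂ) (⟨R, h⟩ : ℂ)
    (hg.mono fun z hz => abs_le.2 <| by
      rw [mem_reProdIm, Set.uIcc_of_le (a := -h) (b := h) (by linarith)] at hz
      exact hz.2)
  rw [intervalIntegral.integral_sub (hline (by rw [abs_neg, abs_of_nonneg hh]))
    (hline (abs_of_nonneg hh).le), ← sub_eq_zero, ← hrect]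
  abel

lemma integral_sub_horizontal_eq_zero (hh : 0 < h) (hg : DifferentiableOn ℂ g {z | |z.im| ≤ h})
    (hends : Tendsto g (stripEnds h) (𝓝 0))
    (hint : Integrable fun x : ℝ => g (x + ((-h : ℝ) : ℂ) * I) - g (x + (h : ℂ) * I)) :
    ∫ x : ℝ, (g (x + ((-h : ℝ) : ℂ) * I) - g (x + (h : ℂ) * I)) = 0 := by
  have hside := (tendsto_intervalIntegral_vertical hh hends).const_smul I
  have hright : Tendsto (fun R : ℝ => R) atTop (comap abs atTop) :=
    tendsto_comap_iff.2 tendsto_abs_atTop_atTop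
  have hleft : Tendsto (fun R : ℝ => -R) atTop (comap abs atTop) :=
    tendsto_comap_iff.2 (tendsto_abs_atBot_atTop.comp tendsto_neg_atTop_atBot)
  have hzero := (hside.comp hleft).sub (hside.comp hright)
  rw [smul_zero, sub_zero] at hzero
  refine tendsto_nhds_unique
    (intervalIntegral_tendsto_integral hint tendsto_neg_atTop_atBot tendsto_id)
    (hzero.congr fun R => (intervalIntegral_sub_horizontal_eq hh.le hg R).symm)

end Strip

section Residue

variable {h : ℝ}

lemma inv_sub_inv_horizontal_eq (hh : 0 < h) (x : ℝ) :
    ((x : ℂ) + ((-h : ℝ) : ℂ) * I)⁻¹ - ((x : ℂ) + (h : ℂ) * I)⁻¹ =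
      (((1 + (x / h) ^ 2)⁻¹ : ℝ) : ℂ) * (2 / h * I) := by
  have hlow := ofReal_add_mul_I_ne_zero x (neg_ne_zero.2 hh.ne')
  have hup := ofReal_add_mul_I_ne_zero x hh.ne'
  have hh0 : (h : ℂ) ≠ 0 := ofReal_ne_zero.2 hh.ne'
  have hden : (1 + ((x : ℂ) / h) ^ 2) ≠ 0 := by
    have : (1 + (x / h) ^ 2 : ℝ) ≠ 0 := by positivity
    exact_mod_cast this
  push_cast at hlow ⊢
  rw [inv_sub_inv hlow hup, inv_mul_eq_div, div_eq_div_iff (mul_ne_zero hlow hup) hden]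
  field_simp
  ring_nf
  rw [I_pow_three]
  ring

lemma integrable_inv_sub_inv_horizontal (hh : 0 < h) :
    Integrable fun x : ℝ => ((x : ℂ) + ((-h : ℝ) : ℂ) * I)⁻¹ - ((x : ℂ) + (h : ℂ) * I)⁻¹ := by
  simp only [inv_sub_inv_horizontal_eq hh]
  exact ((integrable_inv_one_add_sq.comp_div hh.ne').ofReal).mul_const _

lemma integral_inv_sub_inv_horizontal (hh : 0 < h) :
    ∫ x : ℝ, (((x : ℂ) + ((-h : ℝ) : ℂ) * I)⁻¹ - ((x : ℂ) + (h : ℂ) * I)⁻¹) = 2 * π * I := by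
  have hh0 : (h : ℂ) ≠ 0 := ofReal_ne_zero.2 hh.ne'
  simp only [inv_sub_inv_horizontal_eq hh]
  rw [integral_mul_const, integral_complex_ofReal,
    Measure.integral_comp_div (fun x : ℝ => (1 + x ^ 2)⁻¹) h, integral_univ_inv_one_add_sq,
    abs_of_pos hh, smul_eq_mul]
  push_cast
  field_simp

lemma integral_horizontal_sub_eq_of_simple_pole {f : ℂ → ℂ} (hh : 0 < h)
    (hf : DifferentiableOn ℂ f {z | |z.im| ≤ h})
    (hlow : Integrable fun x : ℝ => f (x + ((-h : ℝ) : ℂ) * I) / (x + ((-h : ℝ) : ℂ) * I))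
    (hup : Integrable fun x : ℝ => f (x + (h : ℂ) * I) / (x + (h : ℂ) * I))
    (hends : Tendsto (fun z => f z / z) (stripEnds h) (𝓝 0)) :
    (∫ x : ℝ, f (x + ((-h : ℝ) : ℂ) * I) / (x + ((-h : ℝ) : ℂ) * I)) -
      (∫ x : ℝ, f (x + (h : ℂ) * I) / (x + (h : ℂ) * I)) = 2 * π * I * f 0 := by
  have hnhds : {z : ℂ | |z.im| ≤ h} ∈ 𝓝 (0 : ℂ) :=
    continuous_im.abs.continuousAt.preimage_mem_nhds (Iic_mem_nhds (by simpa using hh))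
  have hdslope : ∀ z : ℂ, z ≠ 0 → dslope f 0 z = f z / z - f 0 * z⁻¹ := by
    intro z hz
    rw [dslope_of_ne _ hz, slope_def_field, sub_zero, sub_div, div_eq_mul_inv (f 0)]
  have hends' : Tendsto (dslope f 0) (stripEnds h) (𝓝 0) := by
    have hinv := ((tendsto_inv₀_cobounded (α := ℂ)).mono_left
      (stripEnds_le_cobounded h)).const_mul (f 0)
    have hsub := hends.sub hinv
    rw [mul_zero, sub_zero] at hsub
    refine hsub.congr' ?_
    filter_upwards [stripEnds_le_cobounded h (Bornology.eventually_ne_cobounded 0)] with z hz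
    exact (hdslope z hz).symm
  have hdiff : ∀ x : ℝ,
      dslope f 0 (x + ((-h : ℝ) : ℂ) * I) - dslope f 0 (x + (h : ℂ) * I) =
        f (x + ((-h : ℝ) : ℂ) * I) / (x + ((-h : ℝ) : ℂ) * I) - f (x + (h : ℂ) * I) /
          (x + (h : ℂ) * I) - f 0 * ((x + ((-h : ℝ) : ℂ) * I)⁻¹ - (x + (h : ℂ) * I)⁻¹) := by
    intro x
    rw [hdslope _ (ofReal_add_mul_I_ne_zero x (neg_ne_zero.2 hh.ne')),
      hdslope _ (ofReal_add_mul_I_ne_zero x hh.ne')]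
    ring
  have hpole := (integrable_inv_sub_inv_horizontal hh).const_mul (f 0)
  have hlines : Integrable fun x : ℝ => f (x + ((-h : ℝ) : ℂ) * I) / (x + ((-h : ℝ) : ℂ) * I) -
    f (x + (h : ℂ) * I) / (x + (h : ℂ) * I) := hlow.sub hup
  have hzero := integral_sub_horizontal_eq_zero hh ((differentiableOn_dslope hnhds).2 hf) hends'
    (by simp only [hdiff]; exact hlines.sub hpole)
  simp only [hdiff] at hzero
  rw [integral_sub hlines hpole, integral_sub hlow hup, integral_const_mul,
    integral_inv_sub_inv_horizontal hh] at hzero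
  linear_combination hzero

lemma integral_horizontal_sub_eq_of_simple_zero {f g : ℂ → ℂ} (hh : 0 < h)
    (hf : DifferentiableOn ℂ f {z | |z.im| ≤ h}) (hg : DifferentiableOn ℂ g {z | |z.im| ≤ h})
    (hg0 : ∀ z : ℂ, |z.im| ≤ h → (g z = 0 ↔ z = 0)) (hg' : deriv g 0 ≠ 0)
    (hlow : Integrable fun x : ℝ => f (x + ((-h : ℝ) : ℂ) * I) / g (x + ((-h : ℝ) : ℂ) * I))
    (hup : Integrable fun x : ℝ => f (x + (h : ℂ) * I) / g (x + (h : ℂ) * I))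
    (hends : Tendsto (fun z => f z / g z) (stripEnds h) (𝓝 0)) :
    (∫ x : ℝ, f (x + ((-h : ℝ) : ℂ) * I) / g (x + ((-h : ℝ) : ℂ) * I)) -
      (∫ x : ℝ, f (x + (h : ℂ) * I) / g (x + (h : ℂ) * I)) = 2 * π * I * (f 0 / deriv g 0) := by
  have hnhds : {z : ℂ | |z.im| ≤ h} ∈ 𝓝 (0 : ℂ) :=
    continuous_im.abs.continuousAt.preimage_mem_nhds (Iic_mem_nhds (by simpa using hh))
  have hg00 : g 0 = 0 := (hg0 0 (by simpa using hh.le)).2 rfl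
  have hdslope : ∀ z : ℂ, z ≠ 0 → dslope g 0 z = g z / z := by
    intro z hz
    rw [dslope_of_ne _ hz, slope_def_field, hg00, sub_zero, sub_zero]
  have hquot : ∀ z : ℂ, z ≠ 0 → f z / dslope g 0 z / z = f z / g z := by
    intro z hz
    rw [hdslope z hz]
    field_simp
  have hne : ∀ z ∈ {z : ℂ | |z.im| ≤ h}, dslope g 0 z ≠ 0 := by
    intro z hz
    rcases eq_or_ne z 0 with rfl | hz0
    · rwa [dslope_same]
    · rw [hdslope z hz0]
      exact div_ne_zero (mt (hg0 z hz).1 hz0) hz0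
  have hquot_low (x : ℝ) := hquot _ (ofReal_add_mul_I_ne_zero x (neg_ne_zero.2 hh.ne'))
  have hquot_up (x : ℝ) := hquot _ (ofReal_add_mul_I_ne_zero x hh.ne')
  have key := integral_horizontal_sub_eq_of_simple_pole (f := fun z => f z / dslope g 0 z) hh
    (hf.div ((differentiableOn_dslope hnhds).2 hg) hne)
    (by simpa only [hquot_low] using hlow) (by simpa only [hquot_up] using hup)
    (hends.congr' <| by
      filter_upwards [stripEnds_le_cobounded h (Bornology.eventually_ne_cobounded 0)] with z hz
      exact (hquot z hz).symm)
  simpa only [hquot_low, hquot_up, dslope_same] using key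

end Residue

/-! ### Moving the line of integration across a pole -/

lemma exp_pi_I_mul_nat (n : ℕ) : exp (π * I * n) = (-1) ^ n := by
  rw [mul_comm, exp_nat_mul, exp_pi_mul_I]

lemma exp_pi_I_mul_nat_sq (n : ℕ) : exp (π * I * (n : ℂ) ^ 2) = (-1) ^ n := by
  have h := exp_pi_I_mul_nat (n ^ 2)
  rw [Nat.cast_pow] at h
  rw [h, sq, pow_mul]
  rcases n.even_or_odd with hn | hn
  · rw [hn.neg_one_pow, one_pow]
  · rw [hn.neg_one_pow, hn.neg_one_pow]

lemma hasDerivAt_auxDenom_nat (n : ℕ) : HasDerivAt auxDenom (2 * π * I * (-1) ^ n) n := by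
  have hlin : HasDerivAt (fun x : ℂ => π * I * x) (π * I * 1) n :=
    (hasDerivAt_id _).const_mul _
  refine (hlin.cexp.sub hlin.neg.cexp).congr_deriv ?_
  simp only [Pi.neg_apply]
  rw [exp_neg, exp_pi_I_mul_nat, ← inv_pow]
  norm_num
  ring

lemma nat_add_diagDir_mul (n : ℕ) (r y : ℝ) : (n : ℂ) + diagDir * ((r : ℂ) + y * I) =
    diagPoint (n - √2 * y) (√2 / 2 * (r + y)) := by
  rw [diagDir_eq, diagPoint_eq]
  push_cast
  linear_combination (√2 / 2 * y : ℂ) * I_sq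

lemma nat_add_diagDir_mul_re_im (n : ℕ) (z : ℂ) : (n : ℂ) + diagDir * z =
    diagPoint (n - √2 * z.im) (√2 / 2 * (z.re + z.im)) := by
  rw [← nat_add_diagDir_mul, re_add_im]

lemma abs_sqrt_two_mul_le_half {y : ℝ} (hy : |y| ≤ √2 / 4) : |√2 * y| ≤ 1 / 2 := by
  rw [abs_mul, abs_of_pos (by positivity)]
  calc _ ≤ √2 * (√2 / 4) := by gcongr
    _ = 1 / 2 := by rw [mul_div_assoc', Real.mul_self_sqrt zero_le_two]; norm_num

lemma auxDenom_nat_add_diagDir_mul_eq_zero_iff (n : ℕ) {z : ℂ} (hz : |z.im| ≤ √2 / 4) :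
    auxDenom (n + diagDir * z) = 0 ↔ z = 0 := by
  have hsqrt : √2 ≠ 0 := by positivity
  rw [nat_add_diagDir_mul_re_im, auxDenom_diagPoint_eq_zero_iff, Complex.ext_iff]
  constructor
  · rintro ⟨hu, k, hk⟩
    have hint : √2 * z.im = ((n - k : ℤ) : ℝ) := by push_cast; linarith
    have hlt : |(n - k : ℤ)| < 1 := by
      have habs : |((n - k : ℤ) : ℝ)| < 1 :=
        hint ▸ (abs_sqrt_two_mul_le_half hz).trans_lt (by norm_num)
      exact_mod_cast habs
    rw [Int.abs_lt_one_iff.1 hlt, Int.cast_zero, mul_eq_zero_iff_left hsqrt] at hint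
    rw [hint, add_zero, mul_eq_zero_iff_left (by positivity)] at hu
    exact ⟨hu, hint⟩
  · rintro ⟨hre, him⟩
    exact ⟨by simp [hre, him], n, by simp [him]⟩

lemma tendsto_riemannAuxIntegrand_stripEnds (s : ℂ) {n : ℕ} (hn : 1 ≤ n) :
    Tendsto (fun z => riemannAuxIntegrand s (n + diagDir * z)) (stripEnds (√2 / 4)) (𝓝 0) := by
  have hn1 : (1 : ℝ) ≤ n := by exact_mod_cast hn
  have hsqrt_lt : √2 < 3 / 2 := by
    rw [Real.sqrt_lt' (by norm_num)]; norm_num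
  have hsqrt_gt : 1 < √2 := by
    rw [Real.lt_sqrt (by norm_num)]; norm_num
  obtain ⟨K, hK⟩ := exists_norm_numerator_le (n + 1) ‖s‖
  have hgauss : Tendsto (fun R : ℝ => |K| * Real.exp (-((R - 1) / 2) ^ 2)) atTop (𝓝 0) := by
    have hlin : Tendsto (fun R : ℝ => (R - 1) / 2) atTop atTop :=
      (tendsto_atTop_add_const_right _ (-1) tendsto_id).atTop_div_const two_pos
    simpa using (Real.tendsto_exp_neg_atTop_nhds_zero.comp
      ((tendsto_pow_atTop two_ne_zero).comp hlin)).const_mul |K|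
  refine squeeze_zero_norm' ?_ (hgauss.comp (tendsto_abs_re_stripEnds _))
  filter_upwards [(tendsto_abs_re_stripEnds _).eventually (eventually_ge_atTop 3),
    mem_inf_of_right (mem_principal_self _)] with z hre (him : |z.im| ≤ √2 / 4)
  have hshift := abs_le.1 (abs_sqrt_two_mul_le_half him)
  have hu : (|z.re| - 1) / 2 ≤ |√2 / 2 * (z.re + z.im)| := by
    have htri := abs_sub_abs_le_abs_sub z.re (-z.im)
    rw [abs_neg, sub_neg_eq_add] at htri
    rw [abs_mul, abs_of_pos (by positivity : 0 < √2 / 2)]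
    nlinarith
  have hnum := hK s le_rfl (n - √2 * z.im) (by linarith) (by linarith) (√2 / 2 * (z.re + z.im))
  rw [nat_add_diagDir_mul_re_im, riemannAuxIntegrand_eq, norm_div]
  refine (div_le_self (norm_nonneg _) (one_le_norm_auxDenom _ (by linarith))).trans ?_
  refine (le_mul_of_one_le_right (norm_nonneg _) ?_).trans (hnum.trans ?_)
  · linarith [norm_nonneg (log (diagPoint (n - √2 * z.im) (√2 / 2 * (z.re + z.im))))]
  · rw [Function.comp_apply, ← sq_abs (√2 / 2 * _)]
    gcongr
    · exact le_abs_self K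
    · linarith

lemma riemannAuxIntegrand_nat_add_diagDir_mul (s : ℂ) (n : ℕ) {a y : ℝ} (ha : n - √2 * y = a)
    (x : ℝ) : riemannAuxIntegrand s (n + diagDir * (x + y * I)) =
      riemannAuxIntegrand s (a + (x + y : ℝ) * diagDir) := by
  rw [nat_add_diagDir_mul, add_mul_diagDir, ha]

lemma deriv_auxDenom_nat_add_diagDir_mul (n : ℕ) :
    deriv (fun z => auxDenom (n + diagDir * z)) 0 = 2 * π * I * (-1) ^ n * diagDir := by
  have hlin : HasDerivAt (fun z : ℂ => n + diagDir * z) diagDir 0 :=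
    (((hasDerivAt_id (0 : ℂ)).const_mul diagDir).const_add (n : ℂ)).congr_deriv (mul_one _)
  refine (HasDerivAt.comp (h₂ := auxDenom) 0 ?_ hlin).deriv
  simpa using hasDerivAt_auxDenom_nat n

-- The strip of half-width `√2 / 4` around the line of slope one through `n = N + 1` is bounded by
-- the lines through `n ± 1 / 2`, and `n` is the only pole of the integrand in it.
lemma auxLineIntegral_succ_sub (s : ℂ) (N : ℕ) :
    auxLineIntegral s ((N + 1 : ℕ) + 1 / 2 : ℝ) - auxLineIntegral s (N + 1 / 2 : ℝ) =
      ((N + 1 : ℕ) : ℂ) ^ (-s) := by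
  set n := N + 1 with hn
  have hn1 : (1 : ℝ) ≤ n := by exact_mod_cast N.succ_pos
  have hsqrt : √2 * √2 = 2 := Real.mul_self_sqrt zero_le_two
  have hpi : (π : ℂ) ≠ 0 := ofReal_ne_zero.2 Real.pi_ne_zero
  have hpow : DifferentiableOn ℂ (fun z : ℂ => ((n : ℂ) + diagDir * z) ^ (-s))
      {z | |z.im| ≤ √2 / 4} := by
    refine DifferentiableOn.cpow_const (by fun_prop) fun z hz => ?_
    rw [nat_add_diagDir_mul_re_im]
    exact diagPoint_mem_slitPlane (by linarith [abs_le.1 (abs_sqrt_two_mul_le_half hz)]) _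
  have hquot (z : ℂ) : (n + diagDir * z) ^ (-s) * exp (π * I * (n + diagDir * z) ^ 2) * diagDir /
      auxDenom (n + diagDir * z) = riemannAuxIntegrand s (n + diagDir * z) * diagDir :=
    mul_div_right_comm _ _ _
  have hlow := riemannAuxIntegrand_nat_add_diagDir_mul s n (a := n + 1 / 2) (y := -(√2 / 4))
    (by linarith)
  have hup := riemannAuxIntegrand_nat_add_diagDir_mul s n (a := N + 1 / 2) (y := √2 / 4)
    (by rw [hn]; push_cast; linarith)
  have hintegrable (M : ℕ) := integrable_riemannAuxIntegrand_line s M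
  have key := integral_horizontal_sub_eq_of_simple_zero
    (f := fun z => (n + diagDir * z) ^ (-s) * exp (π * I * (n + diagDir * z) ^ 2) * diagDir)
    (g := fun z => auxDenom (n + diagDir * z)) (by positivity : 0 < √2 / 4)
    ((hpow.mul (Differentiable.differentiableOn (by fun_prop))).mul_const _)
    (differentiable_auxDenom.comp (by fun_prop)).differentiableOn
    (fun z hz => auxDenom_nat_add_diagDir_mul_eq_zero_iff n hz)
    (by rw [deriv_auxDenom_nat_add_diagDir_mul]; simp [hpi, diagDir_ne_zero])
    (by simp only [hquot, hlow]; exact (hintegrable n).comp_add_right (-(√2 / 4)))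
    (by simp only [hquot, hup]; exact (hintegrable N).comp_add_right (√2 / 4))
    (by simpa only [hquot, zero_mul] using
      (tendsto_riemannAuxIntegrand_stripEnds s N.succ_pos).mul_const diagDir)
  simp only [hquot, hlow, hup, deriv_auxDenom_nat_add_diagDir_mul, mul_zero, add_zero,
    exp_pi_I_mul_nat_sq] at key
  rw [integral_add_right_eq_self fun r : ℝ =>
      riemannAuxIntegrand s ((n + 1 / 2 : ℝ) + r * diagDir) * diagDir,
    integral_add_right_eq_self fun r : ℝ =>
      riemannAuxIntegrand s ((N + 1 / 2 : ℝ) + r * diagDir) * diagDir] at key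
  have hdir := diagDir_ne_zero
  rw [auxLineIntegral, auxLineIntegral, key]
  field_simp

lemma riemannAux_eq_sum_sub (s : ℂ) (N : ℕ) : riemannAux s =
    ∑ n ∈ Finset.Icc 1 N, (n : ℂ) ^ (-s) - auxLineIntegral s (N + 1 / 2) := by
  induction N with
  | zero => rw [riemannAux_eq_neg_auxLineIntegral]; simp
  | succ N ih =>
    rw [ih, Finset.sum_Icc_succ_top (by lia), ← auxLineIntegral_succ_sub s N]
    ring

/-! ### The main term of Riemann's auxiliary function -/

lemma hasDerivAt_arg_diagPoint {a : ℝ} (ha : 0 < a) (u : ℝ) :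
    HasDerivAt (fun u => arg (diagPoint a u)) (a / normSq (diagPoint a u)) u := by
  have hpoint : HasDerivAt (diagPoint a) (1 + I) u := by
    rw [funext (diagPoint_eq a)]
    simpa only [ofRealCLM_apply, ofReal_one, one_mul] using
      ((ofRealCLM.hasDerivAt (x := u)).mul_const (1 + I)).const_add (a : ℂ)
  have him := (imCLM.hasFDerivAt (x := log (diagPoint a u))).comp_hasDerivAt u
    (hpoint.clog_real (diagPoint_mem_slitPlane ha u))
  have harg : (fun u => arg (diagPoint a u)) = imCLM ∘ fun u => log (diagPoint a u) := by
    funext v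
    rw [Function.comp_apply, imCLM_apply, log_im]
  rw [harg]
  refine him.congr_deriv ?_
  simp only [imCLM_apply, div_im, add_re, one_re, I_re, add_im, one_im, I_im, diagPoint]
  ring

lemma arg_diagPoint_zero {a : ℝ} (ha : 0 ≤ a) : arg (diagPoint a 0) = 0 := by
  rw [diagPoint_zero, arg_ofReal_of_nonneg ha]

lemma apply_le_apply_of_hasDerivAt_self_mul {f q : ℝ → ℝ}
    (hf : ∀ v, HasDerivAt f (v * q v) v) (hq : ∀ v, 0 ≤ q v) (u : ℝ) : f 0 ≤ f u := by
  have hcont : Continuous f := continuous_iff_continuousAt.2 fun v => (hf v).continuousAt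
  rcases le_total 0 u with hu | hu
  · refine monotoneOn_of_deriv_nonneg (convex_Ici 0) hcont.continuousOn
      (fun v _ => (hf v).differentiableAt.differentiableWithinAt) (fun v hv => ?_)
      Set.self_mem_Ici hu hu
    rw [interior_Ici] at hv
    rw [(hf v).deriv]
    exact mul_nonneg (le_of_lt hv) (hq v)
  · refine antitoneOn_of_deriv_nonpos (convex_Iic 0) hcont.continuousOn
      (fun v _ => (hf v).differentiableAt.differentiableWithinAt) (fun v hv => ?_)
      hu Set.self_mem_Iic hu
    rw [interior_Iic] at hv
    rw [(hf v).deriv]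
    exact mul_nonpos_of_nonpos_of_nonneg (le_of_lt hv) (hq v)

lemma sq_mul_arg_diagPoint_le {a : ℝ} (ha : 0 < a) (u : ℝ) :
    a ^ 2 * arg (diagPoint a u) ≤ a * u + u ^ 2 / 2 := by
  have hderiv (v : ℝ) : HasDerivAt (fun u => a * u + u ^ 2 / 2 - a ^ 2 * arg (diagPoint a u))
      (v * ((3 * a ^ 2 + 4 * a * v + 2 * v ^ 2) / normSq (diagPoint a v))) v := by
    have hpos : normSq (diagPoint a v) ≠ 0 := normSq_eq_zero.not.2 (diagPoint_ne_zero ha v)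
    refine ((((hasDerivAt_id v).const_mul a).add (((hasDerivAt_id v).pow 2).div_const 2)).sub
      ((hasDerivAt_arg_diagPoint ha v).const_mul (a ^ 2))).congr_deriv ?_
    field_simp
    rw [normSq_diagPoint]
    simp only [id_eq, Nat.cast_ofNat]
    ring
  have hmin := apply_le_apply_of_hasDerivAt_self_mul hderiv (fun v =>
    div_nonneg (by nlinarith [sq_nonneg (a + v), sq_nonneg a]) (normSq_nonneg _)) u
  simp only [arg_diagPoint_zero ha.le] at hmin
  linarith

lemma abs_arg_diagPoint_le {a : ℝ} (ha : 0 < a) (u : ℝ) : |arg (diagPoint a u)| ≤ 2 / a * |u| := by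
  have h := Convex.norm_image_sub_le_of_norm_hasDerivWithin_le (f := fun u => arg (diagPoint a u))
    (C := 2 / a) (s := Set.univ) (x := 0) (y := u)
    (fun v _ => (hasDerivAt_arg_diagPoint ha v).hasDerivWithinAt) (fun v _ => ?_) convex_univ
    (Set.mem_univ _) (Set.mem_univ _)
  · simpa only [arg_diagPoint_zero ha.le, sub_zero, Real.norm_eq_abs] using h
  · have hsq := sq_half_le_normSq_diagPoint a v
    have ha2 : 0 < a ^ 2 := by positivity
    rw [Real.norm_of_nonneg (div_nonneg ha.le (normSq_nonneg _)), div_le_div_iff₀ (by linarith) ha]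
    nlinarith

lemma half_rpow_neg_le {x σ : ℝ} (hx : 0 ≤ x) (hσ4 : σ ≤ 4) :
    (x / 2) ^ (-σ) ≤ 16 * x ^ (-σ) := by
  calc (x / 2) ^ (-σ) = 2 ^ σ * x ^ (-σ) := by
        rw [Real.div_rpow hx zero_le_two, Real.rpow_neg zero_le_two, div_inv_eq_mul, mul_comm]
    _ ≤ 2 ^ (4 : ℝ) * x ^ (-σ) := by gcongr; norm_num
    _ = 16 * x ^ (-σ) := by norm_num

/-- With `t = 2πη²`, `η` is the saddle point of the integrand and the line through `⌊η⌋ + 1 / 2`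
passes within `1 / 2` of it, so that the growth of `x^{-it}` is absorbed by the Gaussian decay of
`e^{π i x²}`. -/
lemma mul_arg_diagPoint_sub_le {η : ℝ} (hη : 0 ≤ η) (u : ℝ) :
    2 * π * η ^ 2 * arg (diagPoint (⌊η⌋₊ + 1 / 2) u) - 2 * π * ((⌊η⌋₊ + 1 / 2 + u) * u) ≤
      18 * π - u ^ 2 := by
  have hfloor_le : (⌊η⌋₊ : ℝ) ≤ η := Nat.floor_le hη
  have hlt_floor : η < ⌊η⌋₊ + 1 := Nat.lt_floor_add_one η
  set a : ℝ := ⌊η⌋₊ + 1 / 2 with ha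
  have ha0 : 0 < a := by positivity
  have hsaddle := sq_mul_arg_diagPoint_le ha0 u
  have hshift : (η ^ 2 - a ^ 2) * arg (diagPoint a u) ≤ 3 * |u| := by
    have hsq : |η ^ 2 - a ^ 2| ≤ 3 / 2 * a := by
      rw [abs_le]; constructor <;> nlinarith
    calc _ ≤ |η ^ 2 - a ^ 2| * |arg (diagPoint a u)| := (le_abs_self _).trans_eq (abs_mul _ _)
      _ ≤ 3 / 2 * a * (2 / a * |u|) := by gcongr; exact abs_arg_diagPoint_le ha0 u
      _ = 3 * |u| := by field_simp
  have hamgm : 3 * |u| ≤ 9 + u ^ 2 / 4 := by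
    rw [← sq_abs u]; nlinarith [sq_nonneg (|u| / 2 - 3)]
  have hexponent : η ^ 2 * arg (diagPoint a u) - (a + u) * u ≤ 9 - u ^ 2 / 4 := by nlinarith
  nlinarith [sq_nonneg u, mul_le_mul_of_nonneg_left hexponent Real.two_pi_pos.le,
    Real.pi_gt_three]

lemma norm_riemannAuxIntegrand_diagPoint_le {s : ℂ} {η : ℝ} (h0 : 0 ≤ s.re) (h4 : s.re ≤ 4)
    (hη : 0 ≤ η) (him : s.im = 2 * π * η ^ 2) (u : ℝ) :
    ‖riemannAuxIntegrand s (diagPoint (⌊η⌋₊ + 1 / 2) u)‖ ≤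
      8 * Real.exp (18 * π) * ((⌊η⌋₊ : ℝ) + 1 / 2) ^ (-s.re) * Real.exp (-u ^ 2) := by
  have hden := two_le_norm_auxDenom ⌊η⌋₊ u
  have hexponent := mul_arg_diagPoint_sub_le hη u
  set a : ℝ := ⌊η⌋₊ + 1 / 2
  have ha0 : 0 < a := by positivity
  have hpow : ‖diagPoint a u‖ ^ (-s.re) ≤ 16 * a ^ (-s.re) :=
    (Real.rpow_le_rpow_of_nonpos (by positivity) (half_le_norm_diagPoint a u)
      (by linarith)).trans (half_rpow_neg_le ha0.le h4)
  have hnum : ‖diagPoint a u ^ (-s) * exp (π * I * diagPoint a u ^ 2)‖ = ‖diagPoint a u‖ ^ (-s.re) *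
      Real.exp (2 * π * η ^ 2 * arg (diagPoint a u) - 2 * π * ((a + u) * u)) := by
    rw [norm_mul, norm_cpow_neg_diagPoint ha0, norm_exp_pi_I_mul_sq, mul_assoc, ← Real.exp_add,
      him, sub_eq_add_neg]
  rw [riemannAuxIntegrand_eq, norm_div, hnum]
  calc _ ≤ 16 * a ^ (-s.re) * Real.exp (18 * π - u ^ 2) / 2 := by gcongr
    _ = _ := by rw [sub_eq_add_neg, Real.exp_add]; ring

lemma norm_auxLineIntegral_le {s : ℂ} {η : ℝ} (h0 : 0 ≤ s.re) (h4 : s.re ≤ 4) (hη : 0 ≤ η)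
    (him : s.im = 2 * π * η ^ 2) :
    ‖auxLineIntegral s (⌊η⌋₊ + 1 / 2)‖ ≤
      8 * Real.exp (18 * π) * ((⌊η⌋₊ : ℝ) + 1 / 2) ^ (-s.re) *
        ∫ r : ℝ, Real.exp (-(1 / 2) * r ^ 2) := by
  unfold auxLineIntegral
  rw [← integral_const_mul]
  refine norm_integral_le_of_norm_le (integrable_exp_neg_half_sq.const_mul _)
    (Eventually.of_forall fun r => ?_)
  rw [norm_mul, norm_diagDir, mul_one, add_mul_diagDir, ← neg_sqrt_two_div_two_mul_sq]
  exact norm_riemannAuxIntegrand_diagPoint_le h0 h4 hη him (√2 / 2 * r)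

lemma floor_sqrt_add_half_rpow_neg_le {σ t : ℝ} (hσ : 0 ≤ σ) (hσ4 : σ ≤ 4) (ht : 2 * π ≤ t) :
    ((⌊√(t / (2 * π))⌋₊ : ℝ) + 1 / 2) ^ (-σ) ≤ 16 * (2 * π) ^ 2 * t ^ (-(σ / 2)) := by
  have ht0 : 0 < t := Real.two_pi_pos.trans_le ht
  set η := √(t / (2 * π)) with hη
  have hη1 : 1 ≤ η := by
    rwa [hη, Real.one_le_sqrt, one_le_div Real.two_pi_pos]
  have hlt_floor : η < ⌊η⌋₊ + 1 := Nat.lt_floor_add_one η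
  have hη_rpow : η ^ (-σ) = (2 * π) ^ (σ / 2) * t ^ (-(σ / 2)) := by
    rw [hη, Real.sqrt_eq_rpow, ← Real.rpow_mul (by positivity),
      Real.div_rpow ht0.le Real.two_pi_pos.le, show 1 / 2 * -σ = -(σ / 2) by ring,
      Real.rpow_neg Real.two_pi_pos.le, div_inv_eq_mul, mul_comm]
  calc _ ≤ (η / 2) ^ (-σ) :=
        Real.rpow_le_rpow_of_nonpos (by positivity) (by linarith) (by linarith)
    _ ≤ 16 * ((2 * π) ^ (σ / 2) * t ^ (-(σ / 2))) :=
        hη_rpow ▸ half_rpow_neg_le (by positivity) hσ4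
    _ ≤ 16 * ((2 * π) ^ (2 : ℝ) * t ^ (-(σ / 2))) := by
        gcongr <;> linarith [Real.pi_gt_three]
    _ = _ := by rw [Real.rpow_two]; ring

lemma exists_norm_riemannAux_sub_sum_le : ∃ C : ℝ, 0 < C ∧ ∀ σ t : ℝ, 0 ≤ σ → σ ≤ 4 →
    2 * π ≤ t → ‖riemannAux (σ + t * I) -
      ∑ n ∈ Finset.Icc 1 ⌊√(t / (2 * π))⌋₊, (n : ℂ) ^ (-(σ + t * I : ℂ))‖ ≤
        C * t ^ (-(σ / 2)) := by
  set J := ∫ r : ℝ, Real.exp (-(1 / 2) * r ^ 2)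
  have : 0 ≤ J := integral_nonneg fun r => (Real.exp_pos _).le
  refine ⟨8 * Real.exp (18 * π) * (16 * (2 * π) ^ 2) * (J + 1), by positivity,
    fun σ t hσ hσ4 ht => ?_⟩
  have ht0 : 0 ≤ t := Real.two_pi_pos.le.trans ht
  set s : ℂ := σ + t * I
  have hre : s.re = σ := by simp [s]
  have him : s.im = 2 * π * √(t / (2 * π)) ^ 2 := by
    rw [Real.sq_sqrt (div_nonneg ht0 Real.two_pi_pos.le), mul_div_cancel₀ t Real.two_pi_pos.ne']
    simp [s]
  have hpow := floor_sqrt_add_half_rpow_neg_le hσ hσ4 ht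
  have hline := norm_auxLineIntegral_le (hre ▸ hσ) (hre ▸ hσ4) (Real.sqrt_nonneg _) him
  rw [riemannAux_eq_sum_sub _ ⌊√(t / (2 * π))⌋₊, sub_sub_cancel_left, norm_neg]
  rw [hre] at hline
  calc _ ≤ 8 * Real.exp (18 * π) * (16 * (2 * π) ^ 2 * t ^ (-(σ / 2))) * (J + 1) :=
        hline.trans (by gcongr; linarith)
    _ = _ := by ring

/-! ### Jensen's inequality on discs, averaged over their centres -/

lemma sum_order_mul_log_le_circleAverage_sub {f : ℂ → ℂ} {c : ℂ} {r : ℝ} (hr : 0 < r)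
    (hf : AnalyticOnNhd ℂ f (Metric.closedBall c r)) (hc : f c ≠ 0) {S : Finset ℂ}
    (hS : ∀ ρ ∈ S, ‖c - ρ‖ ≤ r) :
    ∑ ρ ∈ S, (analyticOrderNatAt f ρ : ℝ) * Real.log (r * ‖c - ρ‖⁻¹) ≤
      Real.circleAverage (Real.log ‖f ·‖) c r - Real.log ‖f c‖ := by
  have hmem_iff (z : ℂ) : z ∈ Metric.closedBall c r ↔ ‖c - z‖ ≤ r := by
    rw [Metric.mem_closedBall, dist_comm, dist_eq_norm]
  rw [← abs_of_pos hr] at hf hmem_iff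
  have hjensen := hf.circleAverage_log_norm hr.ne' hc
  set D := MeromorphicOn.divisor f (Metric.closedBall c |r|) with hD
  have hDfin := D.finiteSupport (isCompact_closedBall c |r|)
  have hlog_nonneg : ∀ z ∈ Metric.closedBall c |r|, 0 ≤ Real.log (r * ‖c - z‖⁻¹) := by
    intro z hz
    rw [hmem_iff, abs_of_pos hr] at hz
    rcases (norm_nonneg (c - z)).eq_or_lt with h0 | h0
    · rw [← h0, inv_zero, mul_zero, Real.log_zero]
    · exact Real.log_nonneg (by rwa [← div_eq_mul_inv, one_le_div h0])
  have hterm_nonneg (z : ℂ) : 0 ≤ (D z : ℝ) * Real.log (r * ‖c - z‖⁻¹) := by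
    by_cases hz : z ∈ Metric.closedBall c |r|
    · exact mul_nonneg (by exact_mod_cast MeromorphicOn.AnalyticOnNhd.divisor_nonneg hf z)
        (hlog_nonneg z hz)
    · rw [hD, Function.locallyFinsuppWithin.apply_eq_zero_of_notMem _ hz, Int.cast_zero, zero_mul]
  have hsum_le : ∑ ρ ∈ S, (analyticOrderNatAt f ρ : ℝ) * Real.log (r * ‖c - ρ‖⁻¹) ≤
      ∑ᶠ z, (D z : ℝ) * Real.log (r * ‖c - z‖⁻¹) := by
    classical
    have hsupport : (Function.support fun z => (D z : ℝ) * Real.log (r * ‖c - z‖⁻¹)) ⊆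
        (hDfin.toFinset ∪ S : Finset ℂ) := by
      intro z hz
      rw [Finset.coe_union, Set.Finite.coe_toFinset]
      exact Or.inl fun h0 => hz (by simp only [h0, Int.cast_zero, zero_mul])
    rw [finsum_eq_sum_of_support_subset _ hsupport]
    refine (Finset.sum_le_sum fun ρ hρ => le_of_eq ?_).trans
      (Finset.sum_le_sum_of_subset_of_nonneg Finset.subset_union_right fun z _ _ => hterm_nonneg z)
    have hρ_mem : ρ ∈ Metric.closedBall c |r| := by
      rw [hmem_iff, abs_of_pos hr]; exact hS ρ hρ
    have hDρ : D ρ = (analyticOrderNatAt f ρ : ℤ) := by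
      rw [hD, MeromorphicOn.AnalyticOnNhd.divisor_apply hf hρ_mem, analyticOrderNatAt]
      cases analyticOrderAt f ρ <;> rfl
    rw [hDρ, Int.cast_natCast]
  linarith

lemma circleAverage_log_norm_le {f : ℂ → ℂ} {c : ℂ} {r : ℝ}
    (hf : AnalyticOnNhd ℂ f (Metric.sphere c |r|)) {u : ℂ → ℝ} (hu : Continuous u)
    (hfu : ∀ z, Real.log ‖f z‖ ≤ u z) :
    Real.circleAverage (Real.log ‖f ·‖) c r ≤ Real.circleAverage u c r :=
  Real.circleAverage_mono hf.meromorphicOn.circleIntegrable_log_norm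
    hu.continuousOn.circleIntegrable' fun z _ => hfu z

lemma norm_two_add_mul_I_sub_sq_le {δ α : ℝ} (hα1 : α ≤ 1) (hδ : 0 ≤ δ) {ρ : ℂ} (hαρ : α ≤ ρ.re)
    (hρ1 : ρ.re ≤ 1) {t : ℝ} (ht : |t - ρ.im| ≤ √δ / 2) :
    ‖(2 + t * I : ℂ) - ρ‖ ^ 2 ≤ (2 - α + δ) ^ 2 - δ := by
  have hsq : ‖(2 + t * I : ℂ) - ρ‖ ^ 2 = (2 - ρ.re) ^ 2 + (t - ρ.im) ^ 2 := by
    rw [← normSq_eq_norm_sq, normSq_apply]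
    simp only [sub_re, add_re, re_ofNat, re_ofReal_mul, I_re, mul_zero, add_zero, sub_im, add_im,
      im_ofNat, im_ofReal_mul, I_im, mul_one, zero_add]
    ring
  have him : (t - ρ.im) ^ 2 ≤ δ / 4 := by
    calc (t - ρ.im) ^ 2 = |t - ρ.im| ^ 2 := (sq_abs _).symm
      _ ≤ (√δ / 2) ^ 2 := by gcongr
      _ = δ / 4 := by rw [div_pow, Real.sq_sqrt hδ]; norm_num
  nlinarith

lemma div_eight_le_log_mul_inv {δ r d : ℝ} (hδ : 0 ≤ δ) (hr2 : r ≤ 2) (hr : 0 < r) (hd : 0 < d)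
    (hdr : d ^ 2 ≤ r ^ 2 - δ) : δ / 8 ≤ Real.log (r * d⁻¹) := by
  have hhalf : Real.log (r * d⁻¹) = 1 / 2 * Real.log (r ^ 2 / d ^ 2) := by
    rw [← div_eq_mul_inv, ← div_pow, Real.log_pow]; push_cast; ring
  have hlog := Real.one_sub_inv_le_log_of_pos (x := r ^ 2 / d ^ 2) (by positivity)
  have hratio : d ^ 2 / r ^ 2 ≤ 1 - δ / 4 := by
    have hr4 : r ^ 2 ≤ 4 := by nlinarith
    rw [div_le_iff₀ (by positivity)]
    nlinarith [mul_le_mul_of_nonneg_left hr4 hδ]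
  rw [inv_div] at hlog
  linarith

lemma log_mul_inv_norm_two_add_mul_I_sub_ge {δ α : ℝ} (hδ : 0 < δ) (hδ2 : δ ≤ 1 / 2)
    (hα : 1 / 2 ≤ α) (hα1 : α ≤ 1) {ρ : ℂ} (hαρ : α ≤ ρ.re) (hρ1 : ρ.re ≤ 1) {t : ℝ}
    (ht : |t - ρ.im| ≤ √δ / 2) :
    ‖(2 + t * I : ℂ) - ρ‖ ≤ 2 - α + δ ∧
      δ / 8 ≤ Real.log ((2 - α + δ) * ‖(2 + t * I : ℂ) - ρ‖⁻¹) := by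
  have hsq := norm_two_add_mul_I_sub_sq_le hα1 hδ.le hαρ hρ1 ht
  have hpos : 0 < ‖(2 + t * I : ℂ) - ρ‖ := norm_pos_iff.2 <| sub_ne_zero.2 fun h => by
    have := congrArg re h
    simp only [add_re, re_ofNat, re_ofReal_mul, I_re, mul_zero, add_zero] at this
    linarith
  exact ⟨by nlinarith, div_eight_le_log_mul_inv hδ.le (by linarith) (by linarith) hpos hsq⟩

lemma intervalIntegrable_indicator_Icc_one (a b c d : ℝ) :
    IntervalIntegrable ((Set.Icc c d).indicator fun _ => (1 : ℝ)) volume a b :=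
  intervalIntegrable_iff.2 ((integrableOn_const measure_Ioc_lt_top.ne).indicator measurableSet_Icc)

lemma integral_indicator_Icc_one {a b c d : ℝ} (hac : a < c) (hcd : c ≤ d) (hdb : d ≤ b) :
    ∫ t in a..b, (Set.Icc c d).indicator (fun _ => (1 : ℝ)) t = d - c := by
  rw [intervalIntegral.integral_of_le (by linarith), setIntegral_indicator measurableSet_Icc,
    Set.inter_eq_self_of_subset_right (Set.Icc_subset_Ioc hac hdb), setIntegral_const,
    measureReal_def, Real.volume_Icc, ENNReal.toReal_ofReal (sub_nonneg.2 hcd), smul_eq_mul,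
    mul_one]

lemma continuous_uncurry_circleMap_vertical {u : ℂ → ℝ} (hu : Continuous u) (c r : ℝ) :
    Continuous (Function.uncurry fun t θ : ℝ => u (circleMap (c + t * I) r θ)) := by
  simp only [circleMap, Function.uncurry_def]
  fun_prop

lemma circleAverage_vertical_eq (u : ℂ → ℝ) (c r t : ℝ) : Real.circleAverage u (c + t * I) r =
    (2 * π)⁻¹ * ∫ θ in (0)..(2 * π), u (circleMap (c + t * I) r θ) :=
  Real.circleAverage_def

lemma continuous_circleAverage_vertical {u : ℂ → ℝ} (hu : Continuous u) (c r : ℝ) :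
    Continuous fun t : ℝ => Real.circleAverage u (c + t * I) r := by
  simp_rw [circleAverage_vertical_eq]
  exact continuous_const.mul
    (intervalIntegral.continuous_parametric_intervalIntegral_of_continuous'
      (continuous_uncurry_circleMap_vertical hu c r) _ _)

lemma integral_circleMap_vertical_le {u : ℂ → ℝ} (hu : Continuous u) (hu0 : ∀ z, 0 ≤ u z)
    {a b r : ℝ} (c : ℝ) (hab : a ≤ b) (hr : 0 ≤ r) (θ : ℝ) :
    ∫ t in a..b, u (circleMap (c + t * I) r θ) ≤
      ∫ t in (a - r)..(b + r), u ((c + r * Real.cos θ : ℝ) + t * I) := by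
  have hshift (t : ℝ) : u (circleMap (c + t * I) r θ) =
      (fun t : ℝ => u ((c + r * Real.cos θ : ℝ) + t * I)) (t + r * Real.sin θ) := by
    simp only [circleMap, exp_mul_I, ← ofReal_cos, ← ofReal_sin]
    congr 1
    push_cast
    ring
  rw [intervalIntegral.integral_congr fun t _ => hshift t,
    intervalIntegral.integral_comp_add_right
      (fun t : ℝ => u ((c + r * Real.cos θ : ℝ) + t * I))]
  refine intervalIntegral.integral_mono_interval ?_ (by linarith) ?_
    (Eventually.of_forall fun t => hu0 _) ((hu.comp (by fun_prop)).intervalIntegrable _ _)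
  · nlinarith [Real.neg_one_le_sin θ]
  · nlinarith [Real.sin_le_one θ]

lemma integral_circleAverage_vertical_le {u : ℂ → ℝ} (hu : Continuous u) (hu0 : ∀ z, 0 ≤ u z)
    {a b c r : ℝ} (hab : a ≤ b) (hr : 0 ≤ r) {G : ℝ → ℝ} (hG : Continuous G)
    (hGu : ∀ σ, c - r ≤ σ → σ ≤ c + r → ∫ t in (a - r)..(b + r), u (σ + t * I) ≤ G σ) :
    ∫ t in a..b, Real.circleAverage u (c + t * I) r ≤
      (2 * π)⁻¹ * ∫ θ in (0)..(2 * π), G (c + r * Real.cos θ) := by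
  have hcont := continuous_uncurry_circleMap_vertical hu c r
  simp_rw [circleAverage_vertical_eq]
  rw [intervalIntegral.integral_const_mul, intervalIntegral_intervalIntegral_swap]
  · gcongr
    refine intervalIntegral.integral_mono_on Real.two_pi_pos.le ?_
      ((hG.comp (by fun_prop)).intervalIntegrable _ _) fun θ _ => ?_
    · exact (intervalIntegral.continuous_parametric_intervalIntegral_of_continuous'
        (f := fun θ t => u (circleMap (c + t * I) r θ))
        (hcont.comp continuous_swap) _ _).intervalIntegrable _ _
    · refine (integral_circleMap_vertical_le hu hu0 c hab hr θ).trans (hGu _ ?_ ?_)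
      · nlinarith [Real.neg_one_le_cos θ]
      · nlinarith [Real.cos_le_one θ]
  · exact (hcont.continuousOn.integrableOn_compact (isCompact_uIcc.prod isCompact_uIcc)).mono_set
      (Set.prod_mono Set.uIoc_subset_uIcc Set.uIoc_subset_uIcc)

lemma sum_order_mul_indicator_le {f : ℂ → ℂ} (hf : Differentiable ℂ f) {u : ℂ → ℝ}
    (hu : Continuous u) (hfu : ∀ z, Real.log ‖f z‖ ≤ u z) {δ α t : ℝ} (hδ : 0 < δ)
    (hδ2 : δ ≤ 1 / 2) (hα : 1 / 2 ≤ α) (hα1 : α ≤ 1) {S : Finset ℂ}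
    (hS : ∀ ρ ∈ S, α ≤ ρ.re ∧ ρ.re ≤ 1) (ht : f (2 + t * I) ≠ 0) :
    ∑ ρ ∈ S, (analyticOrderNatAt f ρ : ℝ) * (δ / 8) *
        (Set.Icc (ρ.im - √δ / 2) (ρ.im + √δ / 2)).indicator (fun _ => (1 : ℝ)) t ≤
      Real.circleAverage u (2 + t * I) (2 - α + δ) - Real.log ‖f (2 + t * I)‖ := by
  classical
  have hlog := fun ρ (hρ : ρ ∈ S) =>
    log_mul_inv_norm_two_add_mul_I_sub_ge (t := t) hδ hδ2 hα hα1 (hS ρ hρ).1 (hS ρ hρ).2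
  have hjensen := sum_order_mul_log_le_circleAverage_sub (by linarith : 0 < 2 - α + δ)
    (fun z _ => hf.analyticAt z) ht (S := {ρ ∈ S | |t - ρ.im| ≤ √δ / 2}) (fun ρ hρ =>
      (hlog ρ (Finset.mem_filter.1 hρ).1 (Finset.mem_filter.1 hρ).2).1)
  refine le_trans ?_ (hjensen.trans
    (sub_le_sub_right (circleAverage_log_norm_le (fun z _ => hf.analyticAt z) hu hfu) _))
  rw [Finset.sum_filter]
  refine Finset.sum_le_sum fun ρ hρ => ?_
  have hmem : t ∈ Set.Icc (ρ.im - √δ / 2) (ρ.im + √δ / 2) ↔ |t - ρ.im| ≤ √δ / 2 := by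
    rw [← Set.mem_Icc_iff_abs_le, abs_sub_comm]
  by_cases h : |t - ρ.im| ≤ √δ / 2
  · rw [if_pos h, Set.indicator_of_mem (hmem.2 h), mul_one]
    exact mul_le_mul_of_nonneg_left (hlog ρ hρ h).2 (Nat.cast_nonneg _)
  · rw [if_neg h, Set.indicator_of_notMem (hmem.not.2 h), mul_zero]

/-- A zero `ρ` contributes at least `δ / 8` to Jensen's formula on the disc centred at `2 + it` for
`t` in an interval of length `√δ`, whence the weight `δ * √δ / 8` once Jensen's formula has been
integrated over `t`. -/
lemma sum_order_mul_le_of_integral_le {f : ℂ → ℂ} (hf : Differentiable ℂ f) {u : ℂ → ℝ}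
    (hu : Continuous u) (hu0 : ∀ z, 0 ≤ u z) (hfu : ∀ z, Real.log ‖f z‖ ≤ u z)
    {δ α a b w : ℝ} (hδ : 0 < δ) (hδ2 : δ ≤ 1 / 2) (hα : 1 / 2 ≤ α) (hα1 : α ≤ 1)
    (hab : a ≤ b) {S : Finset ℂ} (hS : ∀ ρ ∈ S, α ≤ ρ.re ∧ ρ.re ≤ 1 ∧ a ≤ ρ.im ∧ ρ.im ≤ b)
    (hw : ∀ t ∈ Set.Icc (a - 1) (b + 1), f (2 + t * I) ≠ 0 ∧ -Real.log ‖f (2 + t * I)‖ ≤ w)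
    {G : ℝ → ℝ} (hG : Continuous G)
    (hGu : ∀ σ, α - δ ≤ σ → σ ≤ 4 → ∫ t in (a - 3)..(b + 3), u (σ + t * I) ≤ G σ) :
    (∑ ρ ∈ S, (analyticOrderNatAt f ρ : ℝ)) * (δ * √δ / 8) ≤
      (2 * π)⁻¹ * (∫ θ in (0)..(2 * π), G (2 + (2 - α + δ) * Real.cos θ)) + (b - a + 2) * w := by
  set r := 2 - α + δ
  have hsqrt : √δ / 2 < 1 := by linarith [Real.sqrt_le_one.2 (by linarith : δ ≤ 1)]
  have hsqrt0 : 0 ≤ √δ / 2 := by positivity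
  set g : ℝ → ℝ := fun t => ∑ ρ ∈ S, (analyticOrderNatAt f ρ : ℝ) * (δ / 8) *
    (Set.Icc (ρ.im - √δ / 2) (ρ.im + √δ / 2)).indicator (fun _ => (1 : ℝ)) t with hg
  have hg_integrable (ρ : ℂ) := (intervalIntegrable_indicator_Icc_one (a - 1) (b + 1)
    (ρ.im - √δ / 2) (ρ.im + √δ / 2)).const_mul ((analyticOrderNatAt f ρ : ℝ) * (δ / 8))
  have hg_integral : ∫ t in (a - 1)..(b + 1), g t =
      (∑ ρ ∈ S, (analyticOrderNatAt f ρ : ℝ)) * (δ * √δ / 8) := by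
    rw [hg, intervalIntegral.integral_finsetSum fun ρ _ => hg_integrable ρ, Finset.sum_mul]
    refine Finset.sum_congr rfl fun ρ hρ => ?_
    obtain ⟨-, -, haρ, hρb⟩ := hS ρ hρ
    rw [intervalIntegral.integral_const_mul,
      integral_indicator_Icc_one (by linarith) (by linarith) (by linarith)]
    ring
  have havg := continuous_circleAverage_vertical hu 2 r
  have hg_le : ∀ t ∈ Set.Icc (a - 1) (b + 1), g t ≤ Real.circleAverage u (2 + t * I) r + w :=
    fun t ht => (sum_order_mul_indicator_le hf hu hfu hδ hδ2 hα hα1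
      (fun ρ hρ => ⟨(hS ρ hρ).1, (hS ρ hρ).2.1⟩) (hw t ht).1).trans (by linarith [(hw t ht).2])
  have hmono : ∫ t in (a - 1)..(b + 1), g t ≤
      ∫ t in (a - 1)..(b + 1), (Real.circleAverage u (2 + t * I) r + w) := by
    refine intervalIntegral.integral_mono_on (by linarith) ?_
      ((havg.add continuous_const).intervalIntegrable _ _) hg_le
    simpa only [Finset.sum_fn] using IntervalIntegrable.sum S fun ρ _ => hg_integrable ρ
  have hmean : ∀ σ, 2 - r ≤ σ → σ ≤ 2 + r →
      ∫ t in (a - 1 - r)..(b + 1 + r), u (σ + t * I) ≤ G σ := fun σ h1 h2 => by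
    refine le_trans ?_ (hGu σ (by linarith) (by linarith))
    exact intervalIntegral.integral_mono_interval (by linarith) (by linarith) (by linarith)
      (Eventually.of_forall fun t => hu0 _) ((hu.comp (by fun_prop)).intervalIntegrable _ _)
  have hdiscs := integral_circleAverage_vertical_le hu hu0 (by linarith) (by linarith) hG hmean
  push_cast at havg hdiscs
  rw [hg_integral, intervalIntegral.integral_add (havg.intervalIntegrable _ _) (by simp),
    intervalIntegral.integral_const, smul_eq_mul] at hmono
  calc _ ≤ _ := hmono
    _ ≤ _ := by
      rw [show b + 1 - (a - 1) = b - a + 2 by ring]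
      gcongr

open scoped ArithmeticFunction.Moebius

/-! ### The diagonal quadratic form of the mollified sum -/

lemma sum_Icc_filter_dvd {M : Type*} [AddCommMonoid M] (f : ℕ → M) {d : ℕ} (hd : 0 < d) (N : ℕ) :
    ∑ n ∈ Finset.Icc 1 N with d ∣ n, f n = ∑ j ∈ Finset.Icc 1 (N / d), f (d * j) := by
  symm
  refine Finset.sum_nbij' (fun j => d * j) (fun n => n / d) ?_ ?_ ?_ ?_ ?_
  · intro j hj
    simp only [Finset.mem_Icc, Finset.mem_filter] at *
    refine ⟨⟨Nat.mul_pos hd (by omega), ?_⟩, dvd_mul_right _ _⟩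
    rw [mul_comm]; exact (Nat.le_div_iff_mul_le hd).1 hj.2
  · intro n hn
    simp only [Finset.mem_Icc, Finset.mem_filter] at *
    obtain ⟨⟨hpos, hle⟩, c, rfl⟩ := hn
    rw [Nat.mul_div_cancel_left _ hd]
    refine ⟨Nat.pos_of_mul_pos_left hpos, ?_⟩
    rwa [Nat.le_div_iff_mul_le hd, mul_comm]
  · intro j _; exact Nat.mul_div_cancel_left _ hd
  · intro n hn
    simp only [Finset.mem_Icc, Finset.mem_filter] at *
    exact Nat.mul_div_cancel' hn.2
  · intro _ _; rfl

lemma sum_Icc_sum_divisors {M : Type*} [AddCommMonoid M] (f : ℕ → ℕ → M) (N : ℕ) :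
    ∑ n ∈ Finset.Icc 1 N, ∑ d ∈ n.divisors, f d n =
      ∑ d ∈ Finset.Icc 1 N, ∑ j ∈ Finset.Icc 1 (N / d), f d (d * j) := by
  have hdiv : ∀ n ∈ Finset.Icc 1 N, ∑ d ∈ n.divisors, f d n =
      ∑ d ∈ Finset.Icc 1 N, if d ∣ n then f d n else 0 := by
    intro n hn
    rw [← Finset.sum_filter]
    refine Finset.sum_congr ?_ fun _ _ => rfl
    ext d
    simp only [Finset.mem_Icc, Finset.mem_filter, Nat.mem_divisors] at *
    constructor
    · rintro ⟨h, _⟩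
      exact ⟨⟨Nat.pos_of_dvd_of_pos h (by omega), (Nat.le_of_dvd (by omega) h).trans hn.2⟩, h⟩
    · rintro ⟨_, h⟩; exact ⟨h, by omega⟩
  rw [Finset.sum_congr rfl hdiv, Finset.sum_comm]
  refine Finset.sum_congr rfl fun d hd => ?_
  rw [← Finset.sum_filter, sum_Icc_filter_dvd (f d) (Finset.mem_Icc.1 hd).1]

lemma sum_Icc_inv_le (N : ℕ) : ∑ n ∈ Finset.Icc 1 N, (1 / n : ℝ) ≤ 1 + Real.log N := by
  have h := harmonic_le_one_add_log N
  rw [harmonic_eq_sum_Icc] at h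
  push_cast at h
  simpa [one_div] using h

lemma sum_divisors_moebius {R : Type*} [Ring R] (n : ℕ) :
    ∑ d ∈ n.divisors, (μ d : R) = if n = 1 then 1 else 0 := by
  rw [← Int.cast_sum, ← ArithmeticFunction.coe_mul_zeta_apply,
    ArithmeticFunction.moebius_mul_coe_zeta, ArithmeticFunction.one_apply]
  split_ifs <;> simp

lemma abs_moebius_cast_le_one (n : ℕ) : |(μ n : ℝ)| ≤ 1 := by
  exact_mod_cast ArithmeticFunction.abs_moebius_le_one (n := n)

lemma sum_moebius_divisors_coprime_mem {q m : ℕ} (hm : 0 < m) :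
    ∑ n ∈ m.divisors with n.Coprime q, μ n ∈ ({0, 1} : Set ℤ) := by
  induction m using Nat.strong_induction_on with
  | _ m ih =>
    by_cases hmq : m.Coprime q
    · rw [Finset.filter_true_of_mem fun n hn => hmq.coprime_dvd_left (Nat.dvd_of_mem_divisors hn)]
      have := sum_divisors_moebius (R := ℤ) m
      simp only [Int.cast_id] at this
      rw [this]
      split_ifs <;> simp
    · -- A prime dividing both `m` and `q` can be removed from `m` without changing the sum.
      obtain ⟨p, hp, ⟨r, rfl⟩, hpq⟩ := Nat.Prime.not_coprime_iff_dvd.1 hmq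
      have hr : 0 < r := Nat.pos_of_mul_pos_left hm
      have hdivisors : {n ∈ (p * r).divisors | n.Coprime q} = {n ∈ r.divisors | n.Coprime q} := by
        ext n
        simp only [Finset.mem_filter, Nat.mem_divisors, and_congr_left_iff]
        refine fun hnq => ⟨fun h => ⟨?_, hr.ne'⟩, fun h => ⟨h.1.mul_left p, hm.ne'⟩⟩
        exact (hnq.coprime_dvd_right hpq).dvd_of_dvd_mul_left h.1
      rw [hdivisors]
      exact ih r (by nlinarith [hp.two_le]) hr

lemma sum_moebius_divisors_of_coprime {q m : ℕ} (hm : m ≠ 1) (hmq : m.Coprime q) :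
    ∑ n ∈ m.divisors with n.Coprime q, (μ n : ℝ) = 0 := by
  rw [Finset.filter_true_of_mem fun n hn => hmq.coprime_dvd_left (Nat.dvd_of_mem_divisors hn),
    sum_divisors_moebius, if_neg hm]

lemma sum_moebius_coprime_mul_div (q N : ℕ) :
    ∑ n ∈ Finset.Icc 1 N with n.Coprime q, (μ n : ℝ) * (N / n : ℕ) =
      ∑ m ∈ Finset.Icc 1 N, ∑ n ∈ m.divisors with n.Coprime q, (μ n : ℝ) := by
  simp only [Finset.sum_filter]
  rw [sum_Icc_sum_divisors (fun n _ => if n.Coprime q then (μ n : ℝ) else 0)]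
  refine Finset.sum_congr rfl fun n _ => ?_
  rw [Finset.sum_const, Nat.card_Icc, Nat.add_sub_cancel, nsmul_eq_mul]
  split_ifs <;> ring

lemma abs_moebius_mul_div_sub_natDiv_le {n : ℕ} (hn : 0 < n) (N : ℕ) :
    |(μ n : ℝ) * ((N : ℝ) / n - (N / n : ℕ))| ≤ if n = 1 then 0 else 1 := by
  split_ifs with hn1
  · simp [hn1]
  have hfract : |(N : ℝ) / n - (N / n : ℕ)| ≤ 1 := by
    rw [abs_of_nonneg (sub_nonneg.2 Nat.cast_div_le), sub_le_iff_le_add,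
      div_le_iff₀ (by positivity)]
    have : (N : ℝ) < (N / n : ℕ) * n + n := by exact_mod_cast Nat.lt_div_mul_add (a := N) hn
    linarith
  rw [abs_mul]
  exact mul_le_one₀ (abs_moebius_cast_le_one n) (abs_nonneg _) hfract

lemma abs_sum_moebius_divisors_add_le_one {q m : ℕ} (hm : 0 < m) :
    |∑ n ∈ m.divisors with n.Coprime q, (μ n : ℝ)| +
      (if m.Coprime q then if m = 1 then 0 else 1 else 0) ≤ 1 := by
  have habs : |∑ n ∈ m.divisors with n.Coprime q, (μ n : ℝ)| ≤ 1 := by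
    rw [← Int.cast_sum]
    rcases sum_moebius_divisors_coprime_mem (q := q) hm with h | h <;> rw [h] <;> simp
  split_ifs with hmq hm1
  · simpa using habs
  · simp [sum_moebius_divisors_of_coprime hm1 hmq]
  · simpa using habs

/-- Multiplied by `N`, the sum differs from `∑_{m ≤ N} ∑_{n ∣ m, (n, q) = 1} μ(n)` by the fractional
parts of `N / n`; a given `m > 1` contributes to at most one of the two, because the inner sum
vanishes when `m` is prime to `q`. -/
lemma abs_sum_moebius_coprime_div_le_one (q N : ℕ) :
    |∑ n ∈ Finset.Icc 1 N with n.Coprime q, (μ n : ℝ) / n| ≤ 1 := by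
  rcases Nat.eq_zero_or_pos N with rfl | hN
  · simp
  set S := {n ∈ Finset.Icc 1 N | n.Coprime q} with hS
  set c : ℕ → ℝ := fun m => ∑ n ∈ m.divisors with n.Coprime q, (μ n : ℝ)
  have hpos : ∀ n ∈ S, 0 < n := fun n hn => (Finset.mem_Icc.1 (Finset.mem_filter.1 hn).1).1
  have hsplit : (N : ℝ) * ∑ n ∈ S, (μ n : ℝ) / n =
      ∑ m ∈ Finset.Icc 1 N, c m + ∑ n ∈ S, (μ n : ℝ) * ((N : ℝ) / n - (N / n : ℕ)) := by
    rw [← sum_moebius_coprime_mul_div, ← Finset.sum_add_distrib, Finset.mul_sum]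
    exact Finset.sum_congr rfl fun n _ => by ring
  have hbound : |(N : ℝ) * ∑ n ∈ S, (μ n : ℝ) / n| ≤ N * 1 := by
    rw [hsplit]
    calc _ ≤ ∑ m ∈ Finset.Icc 1 N, |c m| + ∑ n ∈ S, (if n = 1 then (0 : ℝ) else 1) :=
          (abs_add_le _ _).trans (add_le_add (Finset.abs_sum_le_sum_abs _ _)
            ((Finset.abs_sum_le_sum_abs _ _).trans
              (Finset.sum_le_sum fun n hn => abs_moebius_mul_div_sub_natDiv_le (hpos n hn) N)))
      _ = ∑ m ∈ Finset.Icc 1 N, (|c m| + (if m.Coprime q then if m = 1 then 0 else 1 else 0)) := by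
          rw [Finset.sum_add_distrib, hS, Finset.sum_filter]
      _ ≤ ∑ _ ∈ Finset.Icc 1 N, (1 : ℝ) := Finset.sum_le_sum fun _ hm =>
          abs_sum_moebius_divisors_add_le_one (Finset.mem_Icc.1 hm).1
      _ = N * 1 := by simp
  rw [abs_mul, Nat.abs_cast] at hbound
  exact le_of_mul_le_mul_left hbound (Nat.cast_pos.2 hN)

/-- The quadratic form `∑ μ(e)μ(e')/(ee')` over coprime `e, e' ≤ Y` that are prime to `g`, which is
the inner sum of `mollifiedDiagonal`. -/
noncomputable def coprimeMoebiusForm (Y g : ℕ) : ℝ :=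
  ∑ e ∈ Finset.Icc 1 Y with e.Coprime g, ∑ e' ∈ Finset.Icc 1 Y with e'.Coprime g,
    if e.Coprime e' then (μ e : ℝ) / e * ((μ e' : ℝ) / e') else 0

lemma moebius_mul_div (f j : ℕ) : (μ (f * j) : ℝ) / ((f * j : ℕ) : ℝ) =
    if j.Coprime f then (μ f : ℝ) / f * ((μ j : ℝ) / j) else 0 := by
  split_ifs with h
  · rw [ArithmeticFunction.isMultiplicative_moebius.map_mul_of_coprime h.symm]
    push_cast
    rw [mul_div_mul_comm]
  · rw [ArithmeticFunction.moebius_eq_zero_of_not_squarefree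
      fun hs => h (Nat.coprime_of_squarefree_mul hs).symm, Int.cast_zero, zero_div]

lemma sum_moebius_multiples_eq {f : ℕ} (hf : 0 < f) (Y g : ℕ) :
    ∑ e ∈ Finset.Icc 1 Y with e.Coprime g, (if f ∣ e then (μ e : ℝ) / e else 0) =
      (if f.Coprime g then (μ f : ℝ) / f else 0) *
        ∑ j ∈ Finset.Icc 1 (Y / f) with j.Coprime (f * g), (μ j : ℝ) / j := by
  rw [← Finset.sum_filter, Finset.filter_comm, Finset.sum_filter,
    sum_Icc_filter_dvd (fun e => if e.Coprime g then (μ e : ℝ) / e else 0) hf,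
    Finset.sum_filter, Finset.mul_sum]
  refine Finset.sum_congr rfl fun j _ => ?_
  rw [moebius_mul_div]
  simp only [Nat.coprime_mul_iff_left, Nat.coprime_mul_iff_right]
  grind

lemma abs_sum_moebius_multiples_le {f : ℕ} (hf : 0 < f) (Y g : ℕ) :
    |∑ e ∈ Finset.Icc 1 Y with e.Coprime g, if f ∣ e then (μ e : ℝ) / e else 0| ≤ 1 / f := by
  have hfactor : |if f.Coprime g then (μ f : ℝ) / f else 0| ≤ 1 / f := by
    split_ifs
    · rw [abs_div, Nat.abs_cast]
      gcongr
      exact abs_moebius_cast_le_one f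
    · simp
  rw [sum_moebius_multiples_eq hf, abs_mul]
  exact (mul_le_of_le_one_right (abs_nonneg _)
    (abs_sum_moebius_coprime_div_le_one _ _)).trans hfactor

lemma sum_moebius_common_divisors {e e' Y : ℕ} (he : 0 < e) (heY : e ≤ Y) :
    ∑ f ∈ Finset.Icc 1 Y with f ∣ e ∧ f ∣ e', (μ f : ℝ) = if e.Coprime e' then 1 else 0 := by
  have hgcd : {f ∈ Finset.Icc 1 Y | f ∣ e ∧ f ∣ e'} = (e.gcd e').divisors := by
    ext f
    simp only [Finset.mem_filter, Finset.mem_Icc, Nat.mem_divisors, Nat.dvd_gcd_iff]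
    refine ⟨fun h => ⟨h.2, (Nat.gcd_pos_of_pos_left _ he).ne'⟩, fun h => ⟨⟨?_, ?_⟩, h.1⟩⟩
    · exact Nat.pos_of_dvd_of_pos h.1.1 he
    · exact (Nat.le_of_dvd he h.1.1).trans heY
  rw [hgcd, sum_divisors_moebius]

/-- Selberg's diagonalisation of the quadratic form. -/
lemma coprimeMoebiusForm_eq (Y g : ℕ) : coprimeMoebiusForm Y g = ∑ f ∈ Finset.Icc 1 Y,
    (μ f : ℝ) * (∑ e ∈ Finset.Icc 1 Y with e.Coprime g,
      if f ∣ e then (μ e : ℝ) / e else 0) ^ 2 := by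
  have hterm : ∀ e ∈ {e ∈ Finset.Icc 1 Y | e.Coprime g}, ∀ e',
      (if e.Coprime e' then (μ e : ℝ) / e * ((μ e' : ℝ) / e') else 0) =
      ∑ f ∈ Finset.Icc 1 Y, (μ f : ℝ) * ((if f ∣ e then (μ e : ℝ) / e else 0) *
        (if f ∣ e' then (μ e' : ℝ) / e' else 0)) := by
    intro e he e'
    obtain ⟨he0, heY⟩ := Finset.mem_Icc.1 (Finset.mem_filter.1 he).1
    calc _ = (if e.Coprime e' then 1 else 0) * ((μ e : ℝ) / e * ((μ e' : ℝ) / e')) := by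
          rw [ite_zero_mul, one_mul]
      _ = _ := by
          rw [← sum_moebius_common_divisors he0 heY, Finset.sum_mul, Finset.sum_filter]
          refine Finset.sum_congr rfl fun f _ => ?_
          grind
  unfold coprimeMoebiusForm
  rw [Finset.sum_congr rfl fun e he => Finset.sum_congr rfl fun e' _ => hterm e he e']
  simp_rw [Finset.sum_comm (t := Finset.Icc 1 Y)]
  refine Finset.sum_congr rfl fun f _ => ?_
  rw [sq, Finset.sum_mul_sum, Finset.mul_sum]
  exact Finset.sum_congr rfl fun e _ => (Finset.mul_sum _ _ _).symm

lemma abs_coprimeMoebiusForm_le (Y g : ℕ) : |coprimeMoebiusForm Y g| ≤ 2 := by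
  rw [coprimeMoebiusForm_eq]
  calc _ ≤ ∑ f ∈ Finset.Ioo 0 (Y + 1), ((f : ℝ) ^ 2)⁻¹ := by
        refine (Finset.abs_sum_le_sum_abs _ _).trans (Finset.sum_le_sum fun f hf => ?_)
        rw [abs_mul, abs_pow, ← inv_pow, inv_eq_one_div]
        refine (mul_le_of_le_one_left (by positivity) (abs_moebius_cast_le_one f)).trans ?_
        gcongr
        exact abs_sum_moebius_multiples_le (Finset.mem_Icc.1 hf).1 Y g
    _ ≤ 2 := by simpa using sum_Ioo_inv_sq_le (α := ℝ) 0 (Y + 1)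

/-- The diagonal contribution `∑ μ(d)μ(d')/(dk)` over `d, d' ≤ X`, `k, k' ≤ K` with `dk = d'k'` to
the mean square of the mollified sum. -/
noncomputable def mollifiedDiagonal (X K : ℕ) : ℝ :=
  ∑ p ∈ (Finset.Icc 1 X ×ˢ Finset.Icc 1 K) ×ˢ (Finset.Icc 1 X ×ˢ Finset.Icc 1 K) with
      p.1.1 * p.1.2 = p.2.1 * p.2.2,
    (μ p.1.1 : ℝ) * (μ p.2.1 : ℝ) / ((p.1.1 * p.1.2 : ℕ) : ℝ)

lemma exists_coprime_param {d k d' k' : ℕ} (hd : 0 < d) (hk : 0 < k) (h : d * k = d' * k') :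
    ∃ g m e e' : ℕ, e.Coprime e' ∧ d = g * e ∧ d' = g * e' ∧ k = m * e' ∧ k' = m * e := by
  obtain ⟨e, e', hcop, hde, hde'⟩ := Nat.exists_coprime d d'
  have hg : 0 < d.gcd d' := Nat.gcd_pos_of_pos_left _ hd
  set g := d.gcd d'
  have hek : e * k = e' * k' := by
    apply Nat.eq_of_mul_eq_mul_left hg
    calc g * (e * k) = d * k := by rw [hde]; ring
      _ = d' * k' := h
      _ = g * (e' * k') := by rw [hde']; ring
  obtain ⟨m, rfl⟩ : e' ∣ k := hcop.symm.dvd_of_dvd_mul_left (Dvd.intro _ hek.symm)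
  refine ⟨g, m, e, e', hcop, by rw [hde, mul_comm], by rw [hde', mul_comm], mul_comm _ _, ?_⟩
  apply Nat.eq_of_mul_eq_mul_left (Nat.pos_of_mul_pos_right hk)
  rw [← hek]; ring

lemma eq_of_coprime_mul_eq {g e e' g₂ e₂ e₂' : ℕ} (hcop : e.Coprime e') (hcop₂ : e₂.Coprime e₂')
    (h : g * e = g₂ * e₂) (h' : g * e' = g₂ * e₂') : g = g₂ := by
  have hgcd := Nat.gcd_mul_left g e e'
  rwa [h, h', Nat.gcd_mul_left, hcop.gcd_eq_one, hcop₂.gcd_eq_one, mul_one, mul_one, eq_comm]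
    at hgcd

lemma mem_Icc_min_div {g m e X K : ℕ} (hg : 0 < g) (hm : 0 < m) :
    e ∈ Finset.Icc 1 (min (X / g) (K / m)) ↔ 1 ≤ e ∧ g * e ≤ X ∧ m * e ≤ K := by
  rw [Finset.mem_Icc, le_min_iff, Nat.le_div_iff_mul_le hg, Nat.le_div_iff_mul_le hm,
    mul_comm e g, mul_comm e m]

/-- The solutions of `dk = d'k'` are `(ge, me', ge', me)` with `e` and `e'` coprime. -/
lemma mollifiedDiagonal_eq_sum_coprime (X K : ℕ) : mollifiedDiagonal X K =
    ∑ q ∈ (Finset.Icc 1 X ×ˢ Finset.Icc 1 K).sigma fun q =>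
        {r ∈ Finset.Icc 1 (min (X / q.1) (K / q.2)) ×ˢ Finset.Icc 1 (min (X / q.1) (K / q.2)) |
          r.1.Coprime r.2},
      (μ (q.1.1 * q.2.1) : ℝ) * (μ (q.1.1 * q.2.2) : ℝ) /
        ((q.1.1 * q.2.1 * (q.1.2 * q.2.2) : ℕ) : ℝ) := by
  unfold mollifiedDiagonal
  symm
  refine Finset.sum_nbij
    (fun q => ((q.1.1 * q.2.1, q.1.2 * q.2.2), (q.1.1 * q.2.2, q.1.2 * q.2.1))) ?maps ?inj ?surj
    fun _ _ => rfl
  case maps =>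
    rintro ⟨⟨g, m⟩, e, e'⟩ h
    simp only [Finset.mem_filter, Finset.mem_product, Finset.mem_sigma] at h ⊢
    obtain ⟨⟨hg, hm⟩, ⟨he, he'⟩, -⟩ := h
    rw [mem_Icc_min_div (Finset.mem_Icc.1 hg).1 (Finset.mem_Icc.1 hm).1] at he he'
    simp only [Finset.mem_Icc] at hg hm ⊢
    exact ⟨⟨⟨⟨Nat.mul_pos hg.1 he.1, he.2.1⟩, Nat.mul_pos hm.1 he'.1, he'.2.2⟩,
      ⟨Nat.mul_pos hg.1 he'.1, he'.2.1⟩, Nat.mul_pos hm.1 he.1, he.2.2⟩, by ring⟩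
  case inj =>
    rintro ⟨⟨g, m⟩, e, e'⟩ h ⟨⟨g₂, m₂⟩, e₂, e₂'⟩ h₂ heq
    simp only [Finset.mem_coe, Finset.mem_filter, Finset.mem_product, Finset.mem_sigma,
      Finset.mem_Icc] at h h₂
    simp only [Prod.mk.injEq] at heq
    obtain ⟨⟨hge, hme'⟩, hge', hme⟩ := heq
    obtain rfl := eq_of_coprime_mul_eq h.2.2 h₂.2.2 hge hge'
    obtain rfl := eq_of_coprime_mul_eq h.2.2 h₂.2.2 hme hme'
    obtain rfl := Nat.eq_of_mul_eq_mul_left h.1.1.1 hge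
    obtain rfl := Nat.eq_of_mul_eq_mul_left h.1.1.1 hge'
    rfl
  case surj =>
    rintro ⟨⟨d, k⟩, d', k'⟩ h
    simp only [Finset.coe_filter, Set.mem_ofPred_eq, Finset.mem_product, Finset.mem_Icc] at h
    obtain ⟨⟨⟨hd, hk⟩, hd', hk'⟩, heq⟩ := h
    obtain ⟨g, m, e, e', hcop, rfl, rfl, rfl, rfl⟩ := exists_coprime_param hd.1 hk.1 heq
    have hg : 0 < g := Nat.pos_of_mul_pos_right hd.1
    have he : 0 < e := Nat.pos_of_mul_pos_left hd.1
    have hm : 0 < m := Nat.pos_of_mul_pos_right hk.1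
    have he' : 0 < e' := Nat.pos_of_mul_pos_left hk.1
    refine ⟨⟨(g, m), (e, e')⟩, ?_, rfl⟩
    simp only [Finset.mem_coe, Finset.mem_filter, Finset.mem_product, Finset.mem_sigma,
      mem_Icc_min_div hg hm]
    simp only [Finset.mem_Icc]
    exact ⟨⟨⟨hg, (Nat.le_mul_of_pos_right g he).trans hd.2⟩,
      hm, (Nat.le_mul_of_pos_right m he').trans hk.2⟩,
      ⟨⟨he, hd.2, hk'.2⟩, he', hd'.2, hk.2⟩, hcop⟩

lemma moebius_mul_moebius_div_eq {g m : ℕ} (hg : 0 < g) (e e' : ℕ) :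
    (μ (g * e) : ℝ) * (μ (g * e') : ℝ) / ((g * e * (m * e') : ℕ) : ℝ) =
      (μ g : ℝ) ^ 2 / (g * m) * if e.Coprime g then if e'.Coprime g then
        (μ e : ℝ) / e * ((μ e' : ℝ) / e') else 0 else 0 := by
  calc _ = (μ (g * e) : ℝ) / ((g * e : ℕ) : ℝ) * ((μ (g * e') : ℝ) / ((g * e' : ℕ) : ℝ))
        * (g / m) := by push_cast; field_simp
    _ = _ := by
        rw [moebius_mul_div, moebius_mul_div]
        split_ifs
        · field_simp
        all_goals simp

lemma mollifiedDiagonal_eq (X K : ℕ) : mollifiedDiagonal X K =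
    ∑ g ∈ Finset.Icc 1 X, ∑ m ∈ Finset.Icc 1 K,
      (μ g : ℝ) ^ 2 / ((g : ℝ) * m) * coprimeMoebiusForm (min (X / g) (K / m)) g := by
  rw [mollifiedDiagonal_eq_sum_coprime, Finset.sum_sigma, Finset.sum_product]
  refine Finset.sum_congr rfl fun g hg => Finset.sum_congr rfl fun m _ => ?_
  unfold coprimeMoebiusForm
  simp only [Finset.sum_filter, Finset.sum_product,
    moebius_mul_moebius_div_eq (Finset.mem_Icc.1 hg).1]
  rw [Finset.mul_sum]
  refine Finset.sum_congr rfl fun e _ => ?_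
  by_cases hcop : e.Coprime g
  · rw [if_pos hcop, Finset.mul_sum]
    refine Finset.sum_congr rfl fun e' _ => ?_
    rw [if_pos hcop]
    split_ifs <;> simp
  · simp [hcop]

lemma mollifiedDiagonal_le (X K : ℕ) :
    mollifiedDiagonal X K ≤ 2 * (1 + Real.log X) * (1 + Real.log K) := by
  rw [mollifiedDiagonal_eq]
  calc _ ≤ ∑ g ∈ Finset.Icc 1 X, ∑ m ∈ Finset.Icc 1 K, 1 / (g : ℝ) * (1 / (m : ℝ)) * 2 := by
        refine Finset.sum_le_sum fun g _ => Finset.sum_le_sum fun m _ => (le_abs_self _).trans ?_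
        rw [abs_mul]
        refine mul_le_mul ?_ (abs_coprimeMoebiusForm_le _ _) (abs_nonneg _) (by positivity)
        rw [abs_of_nonneg (by positivity), one_div_mul_one_div]
        gcongr
        exact (sq_le_one_iff_abs_le_one _).2 (abs_moebius_cast_le_one g)
    _ = 2 * (∑ g ∈ Finset.Icc 1 X, 1 / (g : ℝ)) * ∑ m ∈ Finset.Icc 1 K, 1 / (m : ℝ) := by
        simp only [← Finset.sum_mul, ← Finset.mul_sum]
        ring
    _ ≤ _ := by
        have := Real.log_natCast_nonneg X
        gcongr
        · exact sum_Icc_inv_le X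
        · exact sum_Icc_inv_le K

/-- The coefficient of `n^{-s}` in `(∑_{d ≤ X} μ(d) d^{-s}) (∑_{k ≤ K} k^{-s})`. -/
noncomputable def mollifiedCoeff (X K n : ℕ) : ℝ :=
  ∑ p ∈ Finset.Icc 1 X ×ˢ Finset.Icc 1 K with p.1 * p.2 = n, (μ p.1 : ℝ)

lemma mollifiedCoeff_eq_zero {X K n : ℕ} (hXK : X ≤ K) (hn : 1 < n) (hnX : n ≤ X) :
    mollifiedCoeff X K n = 0 := by
  have hpairs : {p ∈ Finset.Icc 1 X ×ˢ Finset.Icc 1 K | p.1 * p.2 = n} =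
      n.divisorsAntidiagonal := by
    rw [Nat.divisorsAntidiagonal_eq_prod_filter_of_le (by omega) le_rfl]
    ext ⟨d, k⟩
    simp only [Finset.mem_filter, Finset.mem_product, Finset.mem_Icc, Finset.mem_Ioc,
      and_congr_left_iff]
    rintro rfl
    have hd : 0 < d := Nat.pos_of_mul_pos_right (by omega : 0 < d * k)
    have hk : 0 < k := Nat.pos_of_mul_pos_left (by omega : 0 < d * k)
    have := Nat.le_mul_of_pos_right d hk
    have := Nat.le_mul_of_pos_left k hd
    omega
  rw [mollifiedCoeff, hpairs, Nat.sum_divisorsAntidiagonal (fun d _ => (μ d : ℝ)),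
    sum_divisors_moebius, if_neg hn.ne']

lemma mollifiedDiagonal_eq_sum_sq (X K : ℕ) : mollifiedDiagonal X K =
    ∑ n ∈ Finset.Icc 1 (X * K), mollifiedCoeff X K n ^ 2 / n := by
  unfold mollifiedDiagonal mollifiedCoeff
  set P := Finset.Icc 1 X ×ˢ Finset.Icc 1 K with hP
  have hmaps : ∀ p ∈ P, p.1 * p.2 ∈ Finset.Icc 1 (X * K) := by
    rintro ⟨d, k⟩ h
    simp only [hP, Finset.mem_product, Finset.mem_Icc] at h ⊢
    exact ⟨Nat.mul_pos h.1.1 h.2.1, Nat.mul_le_mul h.1.2 h.2.2⟩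
  rw [Finset.sum_filter, Finset.sum_product,
    ← Finset.sum_fiberwise_of_maps_to (g := fun p : ℕ × ℕ => p.1 * p.2) hmaps]
  refine Finset.sum_congr rfl fun n _ => ?_
  rw [sq, Finset.sum_mul_sum, Finset.sum_div]
  refine Finset.sum_congr rfl fun p hp => ?_
  have hp2 := (Finset.mem_filter.1 hp).2
  rw [Finset.sum_div, Finset.sum_filter]
  refine Finset.sum_congr rfl fun q _ => ?_
  simp only [hp2, eq_comm (a := n)]

/-! ### Divisor sums and off-diagonal sums -/

lemma sum_Icc_rpow_neg_half_le (J : ℕ) :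
    ∑ j ∈ Finset.Icc 1 J, (j : ℝ) ^ (-(1 / 2) : ℝ) ≤ 2 * √J := by
  induction J with
  | zero => simp
  | succ n ih =>
    have hsq := Real.sq_sqrt (Nat.cast_nonneg (α := ℝ) n)
    have hsq_succ := Real.sq_sqrt (by positivity : (0 : ℝ) ≤ n + 1)
    have hterm : ((n + 1 : ℕ) : ℝ) ^ (-(1 / 2) : ℝ) ≤ 2 * √(n + 1) - 2 * √n := by
      rw [Real.rpow_neg (by positivity), ← Real.sqrt_eq_rpow, inv_eq_one_div, Nat.cast_add_one,
        div_le_iff₀ (by positivity)]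
      nlinarith [sq_nonneg (√(n + 1) - √n)]
    rw [Finset.sum_Icc_succ_top (by omega), Nat.cast_add_one]
    push_cast at hterm
    linarith

lemma sum_Icc_rpow_neg_le_of_le_half {a : ℝ} (ha : a ≤ 1 / 2) (J : ℕ) :
    ∑ j ∈ Finset.Icc 1 J, (j : ℝ) ^ (-a) ≤ 2 * (J : ℝ) ^ (1 - a) := by
  rcases Nat.eq_zero_or_pos J with rfl | hJ
  · rw [Finset.Icc_eq_empty (by omega), Finset.sum_empty]
    positivity
  have hJ0 : (0 : ℝ) < J := Nat.cast_pos.2 hJ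
  calc _ ≤ ∑ j ∈ Finset.Icc 1 J, (J : ℝ) ^ (1 / 2 - a) * (j : ℝ) ^ (-(1 / 2) : ℝ) := by
        refine Finset.sum_le_sum fun j hj => ?_
        obtain ⟨hj1, hjJ⟩ := Finset.mem_Icc.1 hj
        calc (j : ℝ) ^ (-a) = (j : ℝ) ^ (1 / 2 - a) * (j : ℝ) ^ (-(1 / 2) : ℝ) := by
              rw [← Real.rpow_add (Nat.cast_pos.2 hj1)]; ring_nf
          _ ≤ _ := by gcongr
    _ ≤ (J : ℝ) ^ (1 / 2 - a) * (2 * √J) := by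
        rw [← Finset.mul_sum]
        gcongr
        exact sum_Icc_rpow_neg_half_le J
    _ = _ := by
        rw [Real.sqrt_eq_rpow, mul_left_comm, ← Real.rpow_add hJ0]; ring_nf

lemma sum_Icc_rpow_neg_le_of_le_one {a : ℝ} (ha : a ≤ 1) (J : ℕ) :
    ∑ j ∈ Finset.Icc 1 J, (j : ℝ) ^ (-a) ≤ (1 + Real.log J) * (J : ℝ) ^ (1 - a) := by
  calc _ ≤ ∑ j ∈ Finset.Icc 1 J, (1 / (j : ℝ)) * (J : ℝ) ^ (1 - a) := by
        refine Finset.sum_le_sum fun j hj => ?_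
        obtain ⟨hj1, hjJ⟩ := Finset.mem_Icc.1 hj
        have hj0 : (0 : ℝ) < j := Nat.cast_pos.2 hj1
        calc (j : ℝ) ^ (-a) = (1 / (j : ℝ)) * (j : ℝ) ^ (1 - a) := by
              rw [sub_eq_add_neg, Real.rpow_add hj0, Real.rpow_one]; field_simp
          _ ≤ _ := by gcongr
    _ ≤ _ := by
        rw [← Finset.sum_mul]
        gcongr
        exact sum_Icc_inv_le J

lemma card_divisors_mul_le (m n : ℕ) :
    (m * n).divisors.card ≤ m.divisors.card * n.divisors.card := by
  rw [Nat.divisors_mul]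
  exact Finset.card_mul_le

lemma sum_card_divisors_mul_rpow_le {f : ℕ → ℝ} (hf0 : ∀ n, 0 ≤ f n)
    (hf : ∀ m n, f (m * n) ≤ f m * f n) {a L : ℝ} {N : ℕ} (ha : a ≤ 1) (hL0 : 0 ≤ L)
    (hL : ∀ J ≤ N, ∑ j ∈ Finset.Icc 1 J, f j * (j : ℝ) ^ (-a) ≤ L * (J : ℝ) ^ (1 - a)) :
    ∑ n ∈ Finset.Icc 1 N, (n.divisors.card : ℝ) * (f n * (n : ℝ) ^ (-a)) ≤
      (∑ d ∈ Finset.Icc 1 N, f d * (1 / (d : ℝ))) * (L * (N : ℝ) ^ (1 - a)) := by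
  have hdiv : ∑ n ∈ Finset.Icc 1 N, (n.divisors.card : ℝ) * (f n * (n : ℝ) ^ (-a)) =
      ∑ d ∈ Finset.Icc 1 N, ∑ j ∈ Finset.Icc 1 (N / d), f (d * j) * ((d * j : ℕ) : ℝ) ^ (-a) := by
    rw [← sum_Icc_sum_divisors (fun _ n => f n * (n : ℝ) ^ (-a)) N]
    refine Finset.sum_congr rfl fun n _ => ?_
    rw [Finset.sum_const, nsmul_eq_mul]
  rw [hdiv, Finset.sum_mul]
  refine Finset.sum_le_sum fun d hd => ?_
  have hd0 : (0 : ℝ) < d := Nat.cast_pos.2 (Finset.mem_Icc.1 hd).1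
  have hfd := hf0 d
  calc _ ≤ ∑ j ∈ Finset.Icc 1 (N / d), f d * (d : ℝ) ^ (-a) * (f j * (j : ℝ) ^ (-a)) := by
        refine Finset.sum_le_sum fun j _ => ?_
        rw [Nat.cast_mul, Real.mul_rpow (by positivity) (by positivity), mul_mul_mul_comm]
        gcongr
        exact hf d j
    _ ≤ f d * (d : ℝ) ^ (-a) * (L * ((N : ℝ) / d) ^ (1 - a)) := by
        rw [← Finset.mul_sum]
        gcongr
        refine (hL _ (Nat.div_le_self _ _)).trans ?_
        gcongr
        exact Nat.cast_div_le
    _ = _ := by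
        rw [Real.div_rpow (by positivity) (by positivity), sub_eq_add_neg, Real.rpow_add hd0,
          Real.rpow_one]
        field_simp

lemma sum_card_divisors_rpow_le {a L : ℝ} {N : ℕ} (ha : a ≤ 1) (hL0 : 0 ≤ L)
    (hL : ∀ J ≤ N, ∑ j ∈ Finset.Icc 1 J, (j : ℝ) ^ (-a) ≤ L * (J : ℝ) ^ (1 - a)) :
    ∑ n ∈ Finset.Icc 1 N, (n.divisors.card : ℝ) * (n : ℝ) ^ (-a) ≤
      (1 + Real.log N) * (L * (N : ℝ) ^ (1 - a)) := by
  have h := sum_card_divisors_mul_rpow_le (f := fun _ => 1) (fun _ => zero_le_one)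
    (fun _ _ => by norm_num) ha hL0 (by simpa only [one_mul] using hL)
  simp only [one_mul] at h
  exact h.trans (by gcongr; exact sum_Icc_inv_le N)

lemma sum_card_divisors_div_le (N : ℕ) :
    ∑ n ∈ Finset.Icc 1 N, (n.divisors.card : ℝ) * (1 / (n : ℝ)) ≤ (1 + Real.log N) ^ 2 := by
  have hlog := Real.log_natCast_nonneg N
  have h := sum_card_divisors_rpow_le (a := 1) (L := 1 + Real.log N) (N := N) le_rfl (by positivity)
    fun J hJ => (sum_Icc_rpow_neg_le_of_le_one le_rfl J).trans (by
      rcases Nat.eq_zero_or_pos J with rfl | hJ0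
      · simpa using hlog
      · gcongr)
  simpa [Real.rpow_neg_one, sq, one_div] using h

lemma sum_card_divisors_sq_rpow_le {a L : ℝ} {N : ℕ} (ha : a ≤ 1) (hL0 : 0 ≤ L)
    (hL : ∀ J ≤ N, ∑ j ∈ Finset.Icc 1 J, (j : ℝ) ^ (-a) ≤ L * (J : ℝ) ^ (1 - a)) :
    ∑ n ∈ Finset.Icc 1 N, (n.divisors.card : ℝ) ^ 2 * (n : ℝ) ^ (-a) ≤
      L * (1 + Real.log N) ^ 3 * (N : ℝ) ^ (1 - a) := by
  have hlog := Real.log_natCast_nonneg N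
  have hone : ∀ J ≤ N, ∑ j ∈ Finset.Icc 1 J, (j.divisors.card : ℝ) * (j : ℝ) ^ (-a) ≤
      (1 + Real.log N) * L * (J : ℝ) ^ (1 - a) := by
    intro J hJ
    refine (sum_card_divisors_rpow_le ha hL0 fun I hI => hL I (hI.trans hJ)).trans ?_
    rw [← mul_assoc]
    rcases Nat.eq_zero_or_pos J with rfl | hJ0
    · rw [Nat.cast_zero, Real.log_zero, add_zero]
      gcongr
      linarith
    · gcongr
  have h := sum_card_divisors_mul_rpow_le (f := fun n => (n.divisors.card : ℝ))
    (fun _ => Nat.cast_nonneg _) (fun m n => by exact_mod_cast card_divisors_mul_le m n) ha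
    (by positivity) hone
  calc _ = ∑ n ∈ Finset.Icc 1 N, (n.divisors.card : ℝ) * (n.divisors.card * (n : ℝ) ^ (-a)) :=
        Finset.sum_congr rfl fun n _ => by ring
    _ ≤ (1 + Real.log N) ^ 2 * ((1 + Real.log N) * L * (N : ℝ) ^ (1 - a)) :=
        h.trans (by gcongr; exact sum_card_divisors_div_le N)
    _ = _ := by ring

lemma sum_inv_abs_sub_le_of_injOn {n N : ℕ} {s : Finset ℕ}
    (hinj : Set.InjOn (fun m : ℕ => ((n : ℤ) - m).natAbs) s)
    (hmem : ∀ m ∈ s, ((n : ℤ) - m).natAbs ∈ Finset.Icc 1 N) :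
    ∑ m ∈ s, 1 / |(n : ℝ) - m| ≤ 1 + Real.log N := by
  calc _ = ∑ j ∈ s.image fun m : ℕ => ((n : ℤ) - m).natAbs, 1 / (j : ℝ) := by
        rw [Finset.sum_image hinj]
        refine Finset.sum_congr rfl fun m _ => ?_
        rw [Nat.cast_natAbs]
        push_cast
        rfl
    _ ≤ ∑ j ∈ Finset.Icc 1 N, 1 / (j : ℝ) :=
        Finset.sum_le_sum_of_subset_of_nonneg (Finset.image_subset_iff.2 hmem)
          fun _ _ _ => by positivity
    _ ≤ _ := sum_Icc_inv_le N

lemma sum_inv_abs_sub_le {n N : ℕ} (hn : n ∈ Finset.Icc 1 N) :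
    ∑ m ∈ Finset.Icc 1 N with n ≠ m, 1 / |(n : ℝ) - m| ≤ 2 * (1 + Real.log N) := by
  rw [Finset.mem_Icc] at hn
  have hlt : ∑ m ∈ Finset.Icc 1 N with m < n, 1 / |(n : ℝ) - m| ≤ 1 + Real.log N := by
    refine sum_inv_abs_sub_le_of_injOn (fun a ha b hb hab => ?_) fun m hm => ?_
    · simp only [Finset.coe_filter, Finset.mem_Icc, Set.mem_ofPred_eq] at ha hb hab
      omega
    · simp only [Finset.mem_filter, Finset.mem_Icc] at hm ⊢
      omega
  have hgt : ∑ m ∈ Finset.Icc 1 N with n < m, 1 / |(n : ℝ) - m| ≤ 1 + Real.log N := by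
    refine sum_inv_abs_sub_le_of_injOn (fun a ha b hb hab => ?_) fun m hm => ?_
    · simp only [Finset.coe_filter, Finset.mem_Icc, Set.mem_ofPred_eq] at ha hb hab
      omega
    · simp only [Finset.mem_filter, Finset.mem_Icc] at hm ⊢
      omega
  have hsplit : {m ∈ Finset.Icc 1 N | n ≠ m} =
      {m ∈ Finset.Icc 1 N | m < n} ∪ {m ∈ Finset.Icc 1 N | n < m} := by
    rw [← Finset.filter_or]
    exact Finset.filter_congr fun m _ => by omega
  rw [hsplit, Finset.sum_union (Finset.disjoint_filter.2 fun m _ hmn hnm => by omega)]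
  linarith

lemma inv_abs_log_sub_log_le {m n : ℕ} (hm : 0 < m) (hn : 0 < n) (hmn : m ≠ n) :
    1 / |Real.log m - Real.log n| ≤ 1 + √m * √n / |(m : ℝ) - n| := by
  wlog hlt : n < m generalizing m n
  · have := this hn hm hmn.symm (by omega)
    rwa [abs_sub_comm, abs_sub_comm (m : ℝ), mul_comm (√m)]
  have hm0 : (0 : ℝ) < m := Nat.cast_pos.2 hm
  have hn0 : (0 : ℝ) < n := Nat.cast_pos.2 hn
  have hsub : 0 < (m : ℝ) - n := sub_pos.2 (Nat.cast_lt.2 hlt)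
  have hlog : (m - n : ℝ) / m ≤ Real.log m - Real.log n := by
    rw [← Real.log_div hm0.ne' hn0.ne']
    calc (m - n : ℝ) / m = 1 - ((m : ℝ) / n)⁻¹ := by rw [inv_div, sub_div, div_self hm0.ne']
      _ ≤ _ := Real.one_sub_inv_le_log_of_pos (by positivity)
  have hdiv : 0 < (m - n : ℝ) / m := div_pos hsub hm0
  rw [abs_of_pos (hdiv.trans_le hlog), abs_of_pos hsub]
  calc _ ≤ 1 / ((m - n : ℝ) / m) := one_div_le_one_div_of_le hdiv hlog
    _ = 1 + √n * √n / (m - n : ℝ) := by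
        rw [Real.mul_self_sqrt hn0.le]
        field_simp
        ring
    _ ≤ _ := by gcongr

lemma sq_sum_Icc_le (b : ℕ → ℝ) (N : ℕ) :
    (∑ n ∈ Finset.Icc 1 N, b n) ^ 2 ≤
      (1 + Real.log N) * ∑ n ∈ Finset.Icc 1 N, b n ^ 2 * n := by
  have hcs : (∑ n ∈ Finset.Icc 1 N, b n * √n * (1 / √n)) ^ 2 ≤ _ :=
    Finset.sum_mul_sq_le_sq_mul_sq (Finset.Icc 1 N) (fun n => b n * √n) (fun n => 1 / √n)
  have hcancel : ∑ n ∈ Finset.Icc 1 N, b n * √n * (1 / √n) = ∑ n ∈ Finset.Icc 1 N, b n := by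
    refine Finset.sum_congr rfl fun n hn => ?_
    have : √(n : ℝ) ≠ 0 := (Real.sqrt_pos.2 (Nat.cast_pos.2 (Finset.mem_Icc.1 hn).1)).ne'
    field_simp
  simp only [mul_pow, div_pow, Real.sq_sqrt (Nat.cast_nonneg _), one_pow] at hcs
  rw [hcancel, mul_comm] at hcs
  have : 0 ≤ ∑ n ∈ Finset.Icc 1 N, b n ^ 2 * (n : ℝ) :=
    Finset.sum_nonneg fun n _ => by positivity
  exact hcs.trans (by gcongr; exact sum_Icc_inv_le N)

lemma mul_div_abs_log_sub_log_le {x y : ℝ} (hx : 0 ≤ x) (hy : 0 ≤ y) {m n : ℕ} (hm : 0 < m)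
    (hn : 0 < n) (hmn : m ≠ n) :
    x * y / |Real.log m - Real.log n| ≤
      x * y + (x ^ 2 * m / |(m : ℝ) - n| + y ^ 2 * n / |(n : ℝ) - m|) / 2 := by
  have hpos : 0 < |(m : ℝ) - n| := abs_pos.2 (sub_ne_zero.2 (Nat.cast_injective.ne hmn))
  have amgm : x * √m * (y * √n) ≤ (x ^ 2 * m + y ^ 2 * n) / 2 := by
    have := two_mul_le_add_sq (x * √m) (y * √n)
    simp only [mul_pow, Real.sq_sqrt (Nat.cast_nonneg _)] at this
    linarith
  calc x * y / |Real.log m - Real.log n| = x * y * (1 / |Real.log m - Real.log n|) := by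
        rw [mul_one_div]
    _ ≤ x * y * (1 + √m * √n / |(m : ℝ) - n|) := by
        gcongr
        exact inv_abs_log_sub_log_le hm hn hmn
    _ = x * y + x * √m * (y * √n) / |(m : ℝ) - n| := by ring
    _ ≤ x * y + (x ^ 2 * m + y ^ 2 * n) / 2 / |(m : ℝ) - n| := by gcongr
    _ = _ := by rw [abs_sub_comm (n : ℝ)]; ring

lemma sum_offDiag_div_abs_sub_le (w : ℕ → ℝ) (hw : ∀ n, 0 ≤ w n) (N : ℕ) :
    ∑ n ∈ Finset.Icc 1 N, ∑ m ∈ Finset.Icc 1 N, (if n ≠ m then w n / |(n : ℝ) - m| else 0) ≤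
      2 * (1 + Real.log N) * ∑ n ∈ Finset.Icc 1 N, w n := by
  rw [Finset.mul_sum]
  refine Finset.sum_le_sum fun n hn => ?_
  calc _ = w n * ∑ m ∈ Finset.Icc 1 N with n ≠ m, 1 / |(n : ℝ) - m| := by
        rw [← Finset.sum_filter, Finset.mul_sum]
        exact Finset.sum_congr rfl fun m _ => by rw [mul_one_div]
    _ ≤ w n * (2 * (1 + Real.log N)) :=
        mul_le_mul_of_nonneg_left (sum_inv_abs_sub_le hn) (hw n)
    _ = _ := mul_comm _ _

/-- A weak form of Hilbert's inequality for the frequencies `log n`. -/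
lemma sum_offDiag_div_log_le (b : ℕ → ℝ) (hb : ∀ n, 0 ≤ b n) (N : ℕ) :
    ∑ n ∈ Finset.Icc 1 N, ∑ m ∈ Finset.Icc 1 N,
      (if n ≠ m then b n * b m / |Real.log n - Real.log m| else 0) ≤
      3 * (1 + Real.log N) * ∑ n ∈ Finset.Icc 1 N, b n ^ 2 * n := by
  set w : ℕ → ℝ := fun n => b n ^ 2 * n
  have hoff := sum_offDiag_div_abs_sub_le w (fun n => by positivity) N
  calc _ ≤ ∑ n ∈ Finset.Icc 1 N, ∑ m ∈ Finset.Icc 1 N, (b n * b m +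
        ((if n ≠ m then w n / |(n : ℝ) - m| else 0) +
          (if m ≠ n then w m / |(m : ℝ) - n| else 0)) / 2) := by
        refine Finset.sum_le_sum fun n hn => Finset.sum_le_sum fun m hm => ?_
        by_cases hnm : n = m
        · simpa [hnm] using mul_self_nonneg (b m)
        · rw [if_pos hnm, if_pos hnm, if_pos (Ne.symm hnm)]
          exact mul_div_abs_log_sub_log_le (hb n) (hb m) (Finset.mem_Icc.1 hn).1
            (Finset.mem_Icc.1 hm).1 hnm
    _ = (∑ n ∈ Finset.Icc 1 N, b n) ^ 2 + ∑ n ∈ Finset.Icc 1 N, ∑ m ∈ Finset.Icc 1 N,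
          (if n ≠ m then w n / |(n : ℝ) - m| else 0) := by
        simp only [Finset.sum_add_distrib, ← Finset.sum_div]
        rw [sq, Finset.sum_mul_sum,
          Finset.sum_comm (f := fun n m => if m ≠ n then w m / |(m : ℝ) - n| else 0)]
        ring
    _ ≤ _ := by linarith [sq_sum_Icc_le b N]

lemma card_filter_mul_eq_le_card_divisors (P : Finset (ℕ × ℕ)) {n : ℕ} (hn : n ≠ 0) :
    {p ∈ P | p.1 * p.2 = n}.card ≤ n.divisors.card := by
  refine Finset.card_le_card_of_injOn Prod.fst (fun p hp => ?_) fun p hp q hq hpq => ?_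
  · exact Nat.mem_divisors.2 ⟨Dvd.intro _ (Finset.mem_filter.1 hp).2, hn⟩
  · have hp := (Finset.mem_filter.1 hp).2
    have hq := (Finset.mem_filter.1 hq).2
    have hp0 : 0 < p.1 := Nat.pos_of_ne_zero fun h => hn (by rw [← hp, h, zero_mul])
    exact Prod.ext hpq (Nat.eq_of_mul_eq_mul_left hp0 (by rw [hp, hpq, hq]))

lemma sum_pairs_le {X K : ℕ} {P : Finset (ℕ × ℕ)} (hP : P ⊆ Finset.Icc 1 X ×ˢ Finset.Icc 1 K)
    {g : ℕ → ℝ} (hg : ∀ n, 0 ≤ g n) :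
    ∑ p ∈ P, g (p.1 * p.2) ≤ ∑ n ∈ Finset.Icc 1 (X * K), (n.divisors.card : ℝ) * g n := by
  have hmaps : ∀ p ∈ P, p.1 * p.2 ∈ Finset.Icc 1 (X * K) := by
    intro p hp
    have h := hP hp
    simp only [Finset.mem_product, Finset.mem_Icc] at h ⊢
    exact ⟨Nat.mul_pos h.1.1 h.2.1, Nat.mul_le_mul h.1.2 h.2.2⟩
  rw [← Finset.sum_fiberwise_of_maps_to (g := fun p : ℕ × ℕ => p.1 * p.2) hmaps]
  refine Finset.sum_le_sum fun n hn => ?_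
  calc _ = ({p ∈ P | p.1 * p.2 = n}.card : ℝ) * g n := by
        rw [← nsmul_eq_mul, ← Finset.sum_const]
        exact Finset.sum_congr rfl fun p hp => by rw [(Finset.mem_filter.1 hp).2]
    _ ≤ _ := by
        gcongr
        · exact hg n
        · exact card_filter_mul_eq_le_card_divisors P (Nat.ne_of_gt (Finset.mem_Icc.1 hn).1)

/-! ### The mollified Dirichlet polynomial -/

lemma abs_integral_cos_mul_le {Δ : ℝ} (hΔ : Δ ≠ 0) (a b : ℝ) :
    |∫ t in a..b, Real.cos (t * Δ)| ≤ 2 / |Δ| := by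
  rw [intervalIntegral.integral_comp_mul_right (fun x => Real.cos x) hΔ, integral_cos, smul_eq_mul,
    abs_mul, abs_inv, inv_mul_eq_div]
  gcongr
  calc _ ≤ |Real.sin (b * Δ)| + |Real.sin (a * Δ)| := abs_sub _ _
    _ ≤ 2 := by linarith [Real.abs_sin_le_one (b * Δ), Real.abs_sin_le_one (a * Δ)]

lemma abs_integral_indicator_cos_mul_le {A B b Δ : ℝ} (hAB : A ≤ B) (hΔ : Δ ≠ 0) :
    |∫ t in A..B, (Set.Ici b).indicator (fun t => Real.cos (t * Δ)) t| ≤ 2 / |Δ| := by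
  have hinter : (Set.Ioc A B ∩ Set.Ici b : Set ℝ) =ᵐ[volume] Set.Ioc (max A b) B := by
    rw [← Set.Ioc_inter_Ioi]
    exact (ae_eq_refl _).inter Ioi_ae_eq_Ici.symm
  rw [intervalIntegral.integral_of_le hAB, setIntegral_indicator measurableSet_Ici,
    setIntegral_congr_set hinter]
  rcases le_total (max A b) B with h | h
  · rw [← intervalIntegral.integral_of_le h]
    exact abs_integral_cos_mul_le hΔ _ _
  · rw [Set.Ioc_eq_empty_of_le h, setIntegral_empty, abs_zero]
    positivity

lemma intervalIntegrable_indicator_cos_mul (b Δ A B : ℝ) : IntervalIntegrable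
    ((Set.Ici b).indicator fun t => Real.cos (t * Δ)) volume A B := by
  rw [intervalIntegrable_iff]
  refine IntegrableOn.indicator ?_ measurableSet_Ici
  rw [← intervalIntegrable_iff]
  exact Continuous.intervalIntegrable (by fun_prop) _ _

lemma sq_rpow_neg_mul_self {x : ℝ} (hx : 0 < x) (σ : ℝ) :
    (x ^ (-σ)) ^ 2 * x = x ^ (-(2 * σ - 1)) := by
  rw [← Real.rpow_mul_natCast hx.le, ← Real.rpow_add_one hx.ne']
  congr 1
  push_cast
  ring

/-- The mollifier `∑_{d ≤ X} μ(d) d^{-s}`, approximating `1 / ζ`. -/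
noncomputable def mollifier (X : ℕ) (s : ℂ) : ℂ := ∑ d ∈ Finset.Icc 1 X, (μ d : ℂ) * (d : ℂ) ^ (-s)

/-- The truncated zeta series `∑_{k ≤ K} k^{-s}`, the main term of `R`. -/
noncomputable def zetaPartial (K : ℕ) (s : ℂ) : ℂ := ∑ k ∈ Finset.Icc 1 K, (k : ℂ) ^ (-s)

/-- The number `⌊√(t / 2π)⌋` of terms of the main sum of `R(σ + it)`; it is `0` for `t ≤ 0`. -/
noncomputable def mainLength (t : ℝ) : ℕ := ⌊√(t / (2 * π))⌋₊

lemma le_mainLength_iff {k : ℕ} {t : ℝ} (ht : 0 ≤ t) :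
    k ≤ mainLength t ↔ 2 * π * (k : ℝ) ^ 2 ≤ t := by
  unfold mainLength
  rw [Nat.le_floor_iff (Real.sqrt_nonneg _), Real.le_sqrt (Nat.cast_nonneg k),
    le_div_iff₀ (by positivity), mul_comm]
  positivity

lemma mainLength_mono {t t' : ℝ} (h : t ≤ t') : mainLength t ≤ mainLength t' := by
  unfold mainLength
  gcongr

lemma mainLength_le_sqrt_div_two {t : ℝ} (ht : 0 ≤ t) : (mainLength t : ℝ) ≤ √t / 2 := by
  refine (Nat.floor_le (Real.sqrt_nonneg _)).trans ?_
  rw [Real.sqrt_le_left (by positivity), div_pow, Real.sq_sqrt ht]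
  gcongr
  linarith [Real.pi_gt_three]

lemma sqrt_div_four_le_mainLength {T : ℝ} (hT : 10000 ≤ T) : √T / 4 ≤ mainLength (T - 3) := by
  have hsqrt : 100 ≤ √T := Real.le_sqrt_of_sq_le (by linarith)
  have hsq : √T ^ 2 = T := Real.sq_sqrt (by linarith)
  have hle : √T / 4 + 1 ≤ √((T - 3) / (2 * π)) := by
    apply Real.le_sqrt_of_sq_le
    rw [le_div_iff₀ (by positivity)]
    calc _ ≤ (√T / 4 + 1) ^ 2 * 6.3 := by gcongr; linarith [Real.pi_lt_d2]
      _ ≤ T - 3 := by nlinarith [hsqrt]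
  have := Nat.sub_one_lt_floor (√((T - 3) / (2 * π)))
  unfold mainLength
  linarith

lemma natCast_cpow_neg {n : ℕ} (hn : 0 < n) (σ t : ℝ) : (n : ℂ) ^ (-(σ + t * I : ℂ)) =
    (((n : ℝ) ^ (-σ) : ℝ) : ℂ) * exp (((-(t * Real.log n) : ℝ) : ℂ) * I) := by
  have hn' : (n : ℂ) ≠ 0 := by exact_mod_cast hn.ne'
  have hn2 : (0 : ℝ) < n := by exact_mod_cast hn
  rw [cpow_def_of_ne_zero hn', Real.rpow_def_of_pos hn2, ofReal_exp, ← exp_add, ← natCast_log]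
  congr 1
  push_cast
  ring

lemma sq_norm_sum_mul_exp {ι : Type*} (P : Finset ι) (c θ : ι → ℝ) :
    ‖∑ p ∈ P, (c p : ℂ) * exp ((θ p : ℂ) * I)‖ ^ 2 =
      ∑ p ∈ P, ∑ q ∈ P, c p * c q * Real.cos (θ p - θ q) := by
  have hre : (∑ p ∈ P, (c p : ℂ) * exp ((θ p : ℂ) * I)).re = ∑ p ∈ P, c p * Real.cos (θ p) := by
    simp only [re_sum, re_ofReal_mul, exp_ofReal_mul_I_re]
  have him : (∑ p ∈ P, (c p : ℂ) * exp ((θ p : ℂ) * I)).im = ∑ p ∈ P, c p * Real.sin (θ p) := by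
    simp only [im_sum, im_ofReal_mul, exp_ofReal_mul_I_im]
  rw [← normSq_eq_norm_sq, normSq_apply, hre, him, Finset.sum_mul_sum, Finset.sum_mul_sum]
  simp only [← Finset.sum_add_distrib, Real.cos_sub]
  exact Finset.sum_congr rfl fun p _ => Finset.sum_congr rfl fun q _ => by ring

lemma differentiable_mollifier (X : ℕ) : Differentiable ℂ (mollifier X) := by
  unfold mollifier
  refine Differentiable.fun_sum fun d hd => ?_
  have hd0 : (d : ℂ) ≠ 0 := by
    have := (Finset.mem_Icc.1 hd).1
    exact_mod_cast (by omega : d ≠ 0)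
  exact (differentiable_const _).mul (differentiable_neg.const_cpow (Or.inl hd0))

lemma norm_mollifier_le (X : ℕ) {s : ℂ} (hs : 1 / 2 ≤ s.re) : ‖mollifier X s‖ ≤ 2 * √X := by
  refine ((norm_sum_le _ _).trans (Finset.sum_le_sum fun d hd => ?_)).trans
    (sum_Icc_rpow_neg_half_le X)
  have hd1 : 1 ≤ d := (Finset.mem_Icc.1 hd).1
  have hμ : ‖(μ d : ℂ)‖ ≤ 1 := by
    simpa only [norm_intCast] using abs_moebius_cast_le_one d
  rw [norm_mul, norm_natCast_cpow_of_pos hd1]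
  calc _ ≤ 1 * (d : ℝ) ^ (-s).re := by gcongr
    _ ≤ _ := by
      rw [one_mul]
      exact Real.rpow_le_rpow_of_exponent_le (by exact_mod_cast hd1) (by rw [neg_re]; linarith)

/-- The index pairs `(d, k) ≠ (1, 1)` of the product of the mollifier and the truncated zeta
series; the term of `(1, 1)` is `1`. -/
def mollifiedPairs (X K : ℕ) : Finset (ℕ × ℕ) := (Finset.Icc 1 X ×ˢ Finset.Icc 1 K).erase (1, 1)

lemma mollifiedPairs_subset (X K : ℕ) : mollifiedPairs X K ⊆ Finset.Icc 1 X ×ˢ Finset.Icc 1 K :=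
  Finset.erase_subset _ _

lemma mul_mem_Icc_of_mem_mollifiedPairs {X K : ℕ} {p : ℕ × ℕ} (hp : p ∈ mollifiedPairs X K) :
    p.1 * p.2 ∈ Finset.Icc 1 (X * K) := by
  have h := mollifiedPairs_subset X K hp
  simp only [Finset.mem_product, Finset.mem_Icc] at h ⊢
  exact ⟨Nat.mul_pos h.1.1 h.2.1, Nat.mul_le_mul h.1.2 h.2.2⟩

lemma filter_mollifiedPairs_eq_one (X K : ℕ) :
    {p ∈ mollifiedPairs X K | p.1 * p.2 = 1} = ∅ := by
  refine Finset.filter_eq_empty_iff.2 fun p hp h => (Finset.mem_erase.1 hp).1 ?_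
  exact Prod.ext (Nat.eq_one_of_mul_eq_one_right h) (Nat.eq_one_of_mul_eq_one_left h)

/-- The weight `μ(d) (dk)^{-σ}` of a pair. -/
noncomputable def pairWeight (σ : ℝ) (p : ℕ × ℕ) : ℝ := (μ p.1 : ℝ) * ((p.1 * p.2 : ℕ) : ℝ) ^ (-σ)

lemma abs_pairWeight_le (σ : ℝ) (p : ℕ × ℕ) :
    |pairWeight σ p| ≤ ((p.1 * p.2 : ℕ) : ℝ) ^ (-σ) := by
  have hpow : 0 ≤ ((p.1 * p.2 : ℕ) : ℝ) ^ (-σ) := by positivity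
  rw [pairWeight, abs_mul, abs_of_nonneg hpow]
  exact mul_le_of_le_one_left hpow (abs_moebius_cast_le_one p.1)

/-- The weight of a pair `(d, k)` in the product of the mollifier with the zeta series truncated
at `k ≤ L`. -/
noncomputable def truncWeight (σ : ℝ) (L : ℕ) (p : ℕ × ℕ) : ℝ :=
  if p.2 ≤ L then pairWeight σ p else 0

lemma truncWeight_mul_exp {X L : ℕ} {p : ℕ × ℕ} (hp : p ∈ Finset.Icc 1 X ×ˢ Finset.Icc 1 L)
    (σ t : ℝ) : (truncWeight σ L p : ℂ) *
      exp (((-(t * Real.log ((p.1 * p.2 : ℕ) : ℝ)) : ℝ) : ℂ) * I) =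
      ((μ p.1 : ℂ) * (p.1 : ℂ) ^ (-(σ + t * I : ℂ))) * (p.2 : ℂ) ^ (-(σ + t * I : ℂ)) := by
  simp only [Finset.mem_product, Finset.mem_Icc] at hp
  rw [truncWeight, if_pos hp.2.2, pairWeight, ofReal_mul, mul_assoc, mul_assoc,
    ← natCast_cpow_neg (Nat.mul_pos hp.1.1 hp.2.1), Nat.cast_mul, natCast_mul_natCast_cpow,
    ofReal_intCast]

lemma zetaPartial_mul_mollifier_sub_one {X K L : ℕ} (hX : 1 ≤ X) (hL : 1 ≤ L) (hLK : L ≤ K)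
    (σ t : ℝ) : zetaPartial L (σ + t * I) * mollifier X (σ + t * I) - 1 =
      ∑ p ∈ mollifiedPairs X K, (truncWeight σ L p : ℂ) *
        exp (((-(t * Real.log ((p.1 * p.2 : ℕ) : ℝ)) : ℝ) : ℂ) * I) := by
  set F : ℕ × ℕ → ℂ := fun p => (truncWeight σ L p : ℂ) *
    exp (((-(t * Real.log ((p.1 * p.2 : ℕ) : ℝ)) : ℝ) : ℂ) * I)
  have hone : F (1, 1) = 1 := by simp [F, truncWeight, pairWeight, hL]
  have hmem : ((1, 1) : ℕ × ℕ) ∈ Finset.Icc 1 X ×ˢ Finset.Icc 1 K := by simp; omega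
  have hsub : Finset.Icc 1 X ×ˢ Finset.Icc 1 L ⊆ Finset.Icc 1 X ×ˢ Finset.Icc 1 K :=
    Finset.product_subset_product_right (Finset.Icc_subset_Icc_right hLK)
  have hzero : ∀ p ∈ Finset.Icc 1 X ×ˢ Finset.Icc 1 K, p ∉ Finset.Icc 1 X ×ˢ Finset.Icc 1 L →
      F p = 0 := by
    intro p hp hpL
    simp only [Finset.mem_product, Finset.mem_Icc] at hp hpL
    have : ¬ p.2 ≤ L := fun h => hpL ⟨hp.1, hp.2.1, h⟩
    simp [F, truncWeight, this]
  rw [← hone, mollifiedPairs, sub_eq_iff_eq_add', Finset.add_sum_erase _ F hmem,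
    ← Finset.sum_subset hsub hzero, Finset.sum_congr rfl fun p hp => truncWeight_mul_exp hp σ t,
    zetaPartial, mollifier, mul_comm, Finset.sum_mul_sum, Finset.sum_product]

lemma sum_truncWeight_fiber {X K L : ℕ} (hLK : L ≤ K) (σ : ℝ) {n : ℕ} (hn : 1 < n) :
    ∑ p ∈ mollifiedPairs X K with p.1 * p.2 = n, truncWeight σ L p =
      (n : ℝ) ^ (-σ) * mollifiedCoeff X L n := by
  have hsub : {p ∈ Finset.Icc 1 X ×ˢ Finset.Icc 1 L | p.1 * p.2 = n} ⊆
      {p ∈ mollifiedPairs X K | p.1 * p.2 = n} := by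
    intro p hp
    simp only [mollifiedPairs, Finset.mem_filter, Finset.mem_erase, Finset.mem_product,
      Finset.mem_Icc] at hp ⊢
    refine ⟨⟨?_, hp.1.1, hp.1.2.1, hp.1.2.2.trans hLK⟩, hp.2⟩
    rintro rfl
    omega
  rw [mollifiedCoeff, Finset.mul_sum, ← Finset.sum_subset hsub]
  · refine Finset.sum_congr rfl fun p hp => ?_
    simp only [Finset.mem_filter, Finset.mem_product, Finset.mem_Icc] at hp
    rw [truncWeight, if_pos hp.1.2.2, pairWeight, hp.2, mul_comm]
  · intro p hp hpL
    simp only [mollifiedPairs, Finset.mem_filter, Finset.mem_erase, Finset.mem_product,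
      Finset.mem_Icc] at hp hpL
    exact if_neg fun h => hpL ⟨⟨hp.1.2.1, hp.1.2.2.1, h⟩, hp.2⟩

lemma mollifiedCoeff_eq_zero_of_lt {X L n : ℕ} (hn : X * L < n) : mollifiedCoeff X L n = 0 := by
  refine Finset.sum_eq_zero fun p hp => absurd ?_ hn.not_ge
  simp only [Finset.mem_filter, Finset.mem_product, Finset.mem_Icc] at hp
  exact hp.2 ▸ Nat.mul_le_mul hp.1.1.2 hp.1.2.2

lemma sum_sum_eq_fiber_sq {ι κ : Type*} [DecidableEq κ] {P : Finset ι} {N : Finset κ} {g : ι → κ}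
    (hg : ∀ p ∈ P, g p ∈ N) (c : ι → ℝ) :
    ∑ p ∈ P, ∑ q ∈ P, (if g p = g q then c p * c q else 0) =
      ∑ n ∈ N, (∑ p ∈ P with g p = n, c p) ^ 2 := by
  rw [← Finset.sum_fiberwise_of_maps_to hg]
  refine Finset.sum_congr rfl fun n _ => ?_
  rw [sq, Finset.sum_mul_sum]
  refine Finset.sum_congr rfl fun p hp => ?_
  rw [Finset.sum_filter]
  refine Finset.sum_congr rfl fun q _ => ?_
  simp only [(Finset.mem_filter.1 hp).2, eq_comm (a := n)]

-- The coefficients vanish for `1 < n ≤ X`, and `n^{-2σ} ≤ X^{1-2σ} / n` beyond `X`.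
lemma sq_sum_truncWeight_fiber_le {X K L n : ℕ} (hX : 1 ≤ X) (hXL : X ≤ L) (hLK : L ≤ K) {σ : ℝ}
    (hσ : 1 / 2 ≤ σ) (hn : 1 ≤ n) :
    (∑ p ∈ mollifiedPairs X K with p.1 * p.2 = n, truncWeight σ L p) ^ 2 ≤
      (X : ℝ) ^ (1 - 2 * σ) * (mollifiedCoeff X L n ^ 2 / n) := by
  have hX0 : (0 : ℝ) < X := by exact_mod_cast hX
  have hn0 : (0 : ℝ) < n := by exact_mod_cast hn
  rcases eq_or_lt_of_le hn with rfl | hn1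
  · rw [filter_mollifiedPairs_eq_one, Finset.sum_empty, zero_pow two_ne_zero]
    positivity
  rw [sum_truncWeight_fiber hLK σ hn1]
  rcases le_or_gt n X with hnX | hnX
  · simp [mollifiedCoeff_eq_zero hXL hn1 hnX]
  have hpow : ((n : ℝ) ^ (-σ)) ^ 2 * n ≤ (X : ℝ) ^ (1 - 2 * σ) := by
    rw [sq_rpow_neg_mul_self hn0, neg_sub]
    exact Real.rpow_le_rpow_of_nonpos hX0 (by exact_mod_cast hnX.le) (by linarith)
  calc _ = ((n : ℝ) ^ (-σ)) ^ 2 * n * (mollifiedCoeff X L n ^ 2 / n) := by field_simp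
    _ ≤ _ := by gcongr

lemma sum_diag_truncWeight_le {X K L : ℕ} (hX : 1 ≤ X) (hXL : X ≤ L) (hLK : L ≤ K) {σ : ℝ}
    (hσ : 1 / 2 ≤ σ) :
    ∑ p ∈ mollifiedPairs X K, ∑ q ∈ mollifiedPairs X K,
      (if p.1 * p.2 = q.1 * q.2 then truncWeight σ L p * truncWeight σ L q else 0) ≤
      (X : ℝ) ^ (1 - 2 * σ) * mollifiedDiagonal X L := by
  rw [sum_sum_eq_fiber_sq (g := fun p : ℕ × ℕ => p.1 * p.2)
    fun p hp => mul_mem_Icc_of_mem_mollifiedPairs hp]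
  calc _ ≤ ∑ n ∈ Finset.Icc 1 (X * K),
        (X : ℝ) ^ (1 - 2 * σ) * (mollifiedCoeff X L n ^ 2 / n) :=
      Finset.sum_le_sum fun n hn =>
        sq_sum_truncWeight_fiber_le hX hXL hLK hσ (Finset.mem_Icc.1 hn).1
    _ = ∑ n ∈ Finset.Icc 1 (X * L),
        (X : ℝ) ^ (1 - 2 * σ) * (mollifiedCoeff X L n ^ 2 / n) := by
      refine (Finset.sum_subset
        (Finset.Icc_subset_Icc_right (Nat.mul_le_mul_left X hLK)) fun n hn hn' => ?_).symm
      rw [Finset.mem_Icc] at hn hn'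
      rw [mollifiedCoeff_eq_zero_of_lt (by omega)]
      simp
    _ = _ := by rw [mollifiedDiagonal_eq_sum_sq, Finset.mul_sum]

lemma mollifiedDiagonal_le_two_mul_sq_log {X L K : ℕ} (hX : 1 ≤ X) (hXL : X ≤ L) (hLK : L ≤ K) :
    mollifiedDiagonal X L ≤ 2 * (1 + Real.log K) ^ 2 := by
  have : (0 : ℝ) < X := by exact_mod_cast hX
  have : (0 : ℝ) < L := by exact_mod_cast hX.trans hXL
  have := Real.log_natCast_nonneg X
  have := Real.log_natCast_nonneg L
  refine (mollifiedDiagonal_le X L).trans ?_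
  rw [sq, ← mul_assoc]
  gcongr
  exact hXL.trans hLK

/-- The contribution of the pairs `p = (d, k)` and `q = (e, l)` to `|1 - D M|²` at height `t`,
where `D` is the zeta series truncated at `mainLength t`: the indicator switches the term on once
`t ≥ 2πk²` and `t ≥ 2πl²`. -/
noncomputable def crossTerm (σ : ℝ) (p q : ℕ × ℕ) (t : ℝ) : ℝ :=
  pairWeight σ p * pairWeight σ q *
    (Set.Ici (max (2 * π * (p.2 : ℝ) ^ 2) (2 * π * (q.2 : ℝ) ^ 2))).indicator
      (fun t => Real.cos (t * (Real.log (p.1 * p.2 : ℕ) - Real.log (q.1 * q.2 : ℕ)))) t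

lemma truncWeight_mul_cos_eq_crossTerm {t : ℝ} (ht : 0 ≤ t) (σ : ℝ) (p q : ℕ × ℕ) :
    truncWeight σ (mainLength t) p * truncWeight σ (mainLength t) q *
      Real.cos (-(t * Real.log (p.1 * p.2 : ℕ)) - -(t * Real.log (q.1 * q.2 : ℕ))) =
      crossTerm σ p q t := by
  rw [show -(t * Real.log (p.1 * p.2 : ℕ)) - -(t * Real.log (q.1 * q.2 : ℕ)) =
    -(t * (Real.log (p.1 * p.2 : ℕ) - Real.log (q.1 * q.2 : ℕ))) by ring, Real.cos_neg]
  simp only [truncWeight, crossTerm, le_mainLength_iff ht, Set.indicator_apply, Set.mem_Ici,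
    max_le_iff]
  split_ifs <;> simp_all

lemma intervalIntegrable_crossTerm (σ : ℝ) (p q : ℕ × ℕ) (A B : ℝ) :
    IntervalIntegrable (crossTerm σ p q) volume A B :=
  (intervalIntegrable_indicator_cos_mul _ _ _ _).const_mul _

lemma integral_crossTerm_le {p q : ℕ × ℕ} (hp : 0 < p.1 * p.2) (hq : 0 < q.1 * q.2)
    (hpq : p.1 * p.2 ≠ q.1 * q.2) (σ : ℝ) {A B : ℝ} (hAB : A ≤ B) :
    ∫ t in A..B, crossTerm σ p q t ≤ ((p.1 * p.2 : ℕ) : ℝ) ^ (-σ) * ((q.1 * q.2 : ℕ) : ℝ) ^ (-σ) *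
      (2 / |Real.log (p.1 * p.2 : ℕ) - Real.log (q.1 * q.2 : ℕ)|) := by
  have hlog : Real.log (p.1 * p.2 : ℕ) - Real.log (q.1 * q.2 : ℕ) ≠ 0 := by
    rw [sub_ne_zero]
    refine fun h => hpq ?_
    exact_mod_cast Real.log_injOn_pos (Set.mem_Ioi.2 (Nat.cast_pos.2 hp))
      (Set.mem_Ioi.2 (Nat.cast_pos.2 hq)) h
  unfold crossTerm
  rw [intervalIntegral.integral_const_mul]
  refine (le_abs_self _).trans ?_
  rw [abs_mul, abs_mul]
  gcongr
  · exact abs_pairWeight_le σ p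
  · exact abs_pairWeight_le σ q
  · exact abs_integral_indicator_cos_mul_le hAB hlog

/-- The off-diagonal part of `|1 - D M|²`. -/
noncomputable def offDiagonal (X K : ℕ) (σ t : ℝ) : ℝ :=
  ∑ p ∈ mollifiedPairs X K, ∑ q ∈ mollifiedPairs X K,
    if p.1 * p.2 ≠ q.1 * q.2 then crossTerm σ p q t else 0

lemma sq_norm_one_sub_eq {X K : ℕ} {t : ℝ} (hX : 1 ≤ X) (hXt : X ≤ mainLength t)
    (htK : mainLength t ≤ K) (ht : 0 ≤ t) (σ : ℝ) :
    ‖1 - zetaPartial (mainLength t) (σ + t * I) * mollifier X (σ + t * I)‖ ^ 2 =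
      ∑ p ∈ mollifiedPairs X K, ∑ q ∈ mollifiedPairs X K, (if p.1 * p.2 = q.1 * q.2 then
        truncWeight σ (mainLength t) p * truncWeight σ (mainLength t) q else 0) +
      offDiagonal X K σ t := by
  rw [norm_sub_rev, zetaPartial_mul_mollifier_sub_one hX (hX.trans hXt) htK, sq_norm_sum_mul_exp,
    offDiagonal]
  simp only [← Finset.sum_add_distrib]
  refine Finset.sum_congr rfl fun p _ => Finset.sum_congr rfl fun q _ => ?_
  by_cases h : p.1 * p.2 = q.1 * q.2
  · simp [h]
  · rw [if_neg h, if_pos h, zero_add, truncWeight_mul_cos_eq_crossTerm ht]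

lemma sq_norm_one_sub_le {X K : ℕ} {t σ : ℝ} (hX : 1 ≤ X) (hXt : X ≤ mainLength t)
    (htK : mainLength t ≤ K) (ht : 0 ≤ t) (hσ : 1 / 2 ≤ σ) :
    ‖1 - zetaPartial (mainLength t) (σ + t * I) * mollifier X (σ + t * I)‖ ^ 2 ≤
      (X : ℝ) ^ (1 - 2 * σ) * (2 * (1 + Real.log K) ^ 2) + offDiagonal X K σ t := by
  rw [sq_norm_one_sub_eq hX hXt htK ht]
  gcongr
  refine (sum_diag_truncWeight_le hX hXt htK hσ).trans ?_
  gcongr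
  exact mollifiedDiagonal_le_two_mul_sq_log hX hXt htK

lemma intervalIntegrable_ite_crossTerm (P : Prop) [Decidable P] (σ : ℝ) (p q : ℕ × ℕ) (A B : ℝ) :
    IntervalIntegrable (fun t => if P then crossTerm σ p q t else 0) volume A B := by
  split_ifs
  · exact intervalIntegrable_crossTerm σ p q A B
  · exact intervalIntegrable_const

lemma intervalIntegrable_offDiagonal (X K : ℕ) (σ A B : ℝ) :
    IntervalIntegrable (offDiagonal X K σ) volume A B := by
  have : offDiagonal X K σ = ∑ p ∈ mollifiedPairs X K, ∑ q ∈ mollifiedPairs X K,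
      fun t => if p.1 * p.2 ≠ q.1 * q.2 then crossTerm σ p q t else 0 := by
    funext t
    simp only [offDiagonal, Finset.sum_apply]
  rw [this]
  exact IntervalIntegrable.sum _ fun p _ => IntervalIntegrable.sum _ fun q _ =>
    intervalIntegrable_ite_crossTerm _ σ p q A B

lemma integral_offDiagonal_le_sum_pairs (X K : ℕ) (σ : ℝ) {A B : ℝ} (hAB : A ≤ B) :
    ∫ t in A..B, offDiagonal X K σ t ≤
      ∑ p ∈ mollifiedPairs X K, ∑ q ∈ mollifiedPairs X K, if p.1 * p.2 ≠ q.1 * q.2 then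
        ((p.1 * p.2 : ℕ) : ℝ) ^ (-σ) * ((q.1 * q.2 : ℕ) : ℝ) ^ (-σ) *
          (2 / |Real.log (p.1 * p.2 : ℕ) - Real.log (q.1 * q.2 : ℕ)|) else 0 := by
  unfold offDiagonal
  rw [intervalIntegral.integral_finsetSum fun p _ => by
    simpa only [Finset.sum_fn] using IntervalIntegrable.sum (mollifiedPairs X K) fun q _ =>
      intervalIntegrable_ite_crossTerm (p.1 * p.2 ≠ q.1 * q.2) σ p q A B]
  refine Finset.sum_le_sum fun p hp => ?_
  rw [intervalIntegral.integral_finsetSum fun q _ =>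
    intervalIntegrable_ite_crossTerm (p.1 * p.2 ≠ q.1 * q.2) σ p q A B]
  refine Finset.sum_le_sum fun q hq => ?_
  split_ifs with hpq
  · exact integral_crossTerm_le (Finset.mem_Icc.1 (mul_mem_Icc_of_mem_mollifiedPairs hp)).1
      (Finset.mem_Icc.1 (mul_mem_Icc_of_mem_mollifiedPairs hq)).1 hpq σ hAB
  · simp

lemma integral_offDiagonal_le (X K : ℕ) (σ : ℝ) {A B : ℝ} (hAB : A ≤ B) :
    ∫ t in A..B, offDiagonal X K σ t ≤ 6 * (1 + Real.log ((X * K : ℕ) : ℝ)) *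
      ∑ n ∈ Finset.Icc 1 (X * K), (n.divisors.card : ℝ) ^ 2 * (n : ℝ) ^ (-(2 * σ - 1)) := by
  set N := Finset.Icc 1 (X * K)
  set τ : ℕ → ℝ := fun n => (n.divisors.card : ℝ)
  set h : ℕ → ℕ → ℝ := fun n m => if n ≠ m then
    (n : ℝ) ^ (-σ) * (m : ℝ) ^ (-σ) * (2 / |Real.log n - Real.log m|) else 0
  have hh0 : ∀ n m, 0 ≤ h n m := by
    intro n m
    simp only [h]
    split_ifs <;> positivity
  have hsq : ∀ n ∈ N, (τ n * (n : ℝ) ^ (-σ)) ^ 2 * n = τ n ^ 2 * (n : ℝ) ^ (-(2 * σ - 1)) := by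
    intro n hn
    rw [mul_pow, mul_assoc, sq_rpow_neg_mul_self (Nat.cast_pos.2 (Finset.mem_Icc.1 hn).1)]
  calc _ ≤ ∑ p ∈ mollifiedPairs X K, ∑ q ∈ mollifiedPairs X K, h (p.1 * p.2) (q.1 * q.2) :=
        integral_offDiagonal_le_sum_pairs X K σ hAB
    _ ≤ ∑ p ∈ mollifiedPairs X K, ∑ m ∈ N, τ m * h (p.1 * p.2) m :=
        Finset.sum_le_sum fun p _ => sum_pairs_le (mollifiedPairs_subset X K) (hh0 _)
    _ ≤ ∑ n ∈ N, τ n * ∑ m ∈ N, τ m * h n m :=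
        sum_pairs_le (g := fun n => ∑ m ∈ N, τ m * h n m) (mollifiedPairs_subset X K)
          fun n => Finset.sum_nonneg fun m _ => mul_nonneg (Nat.cast_nonneg _) (hh0 n m)
    _ = 2 * ∑ n ∈ N, ∑ m ∈ N, (if n ≠ m then
          (τ n * (n : ℝ) ^ (-σ)) * (τ m * (m : ℝ) ^ (-σ)) / |Real.log n - Real.log m| else 0) := by
        simp only [h, Finset.mul_sum]
        refine Finset.sum_congr rfl fun n _ => Finset.sum_congr rfl fun m _ => ?_
        split_ifs <;> ring
    _ ≤ 2 * (3 * (1 + Real.log ((X * K : ℕ) : ℝ)) * ∑ n ∈ N, (τ n * (n : ℝ) ^ (-σ)) ^ 2 * n) := by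
        gcongr
        exact sum_offDiag_div_log_le (fun n => τ n * (n : ℝ) ^ (-σ)) (fun n => by positivity) _
    _ = _ := by rw [Finset.sum_congr rfl hsq]; ring

/-! ### The mean square of `1 - R M` -/

lemma two_le_log {T : ℝ} (hT : 10000 ≤ T) : 2 ≤ Real.log T := by
  rw [Real.le_log_iff_exp_le (by linarith), show (2 : ℝ) = 1 + 1 by norm_num, Real.exp_add]
  nlinarith [Real.exp_one_lt_d9, Real.exp_pos 1]

lemma one_le_mainLength {T : ℝ} (hT : 10000 ≤ T) : 1 ≤ mainLength (T - 3) := by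
  rw [le_mainLength_iff (by linarith)]
  norm_num
  linarith [Real.pi_lt_d2]

lemma mainLength_sub_three_le {T : ℝ} (hT : 0 ≤ T) : (mainLength (T - 3) : ℝ) ≤ √T / 2 :=
  le_trans (by exact_mod_cast mainLength_mono (by linarith)) (mainLength_le_sqrt_div_two hT)

lemma mainLength_two_mul_add_three_le {T : ℝ} (hT : 10000 ≤ T) :
    (mainLength (2 * T + 3) : ℝ) ≤ √T := by
  refine (mainLength_le_sqrt_div_two (by linarith)).trans ?_
  rw [div_le_iff₀ two_pos, Real.sqrt_le_left (by positivity), mul_pow, Real.sq_sqrt (by linarith)]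
  linarith

lemma mainLength_mul_mainLength_le {T : ℝ} (hT : 10000 ≤ T) :
    ((mainLength (T - 3) * mainLength (2 * T + 3) : ℕ) : ℝ) ≤ T := by
  have hT0 : 0 ≤ T := by linarith
  push_cast
  calc _ ≤ (√T / 2) * √T := by
        gcongr
        · exact mainLength_sub_three_le hT0
        · exact mainLength_two_mul_add_three_le hT
    _ ≤ T := by nlinarith [Real.mul_self_sqrt hT0]

lemma mainLength_rpow_le {T σ : ℝ} (hT : 10000 ≤ T) (hσ : 1 / 2 ≤ σ) (hσ4 : σ ≤ 4) :
    (mainLength (T - 3) : ℝ) ^ (1 - 2 * σ) ≤ 16384 * T ^ (1 / 2 - σ) := by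
  have hT0 : 0 < T := by linarith
  calc _ ≤ (√T / 4) ^ (1 - 2 * σ) := Real.rpow_le_rpow_of_nonpos (by positivity)
        (sqrt_div_four_le_mainLength hT) (by linarith)
    _ = T ^ (1 / 2 - σ) * (1 / 4) ^ (1 - 2 * σ) := by
        rw [div_eq_mul_one_div, Real.mul_rpow (by positivity) (by positivity), Real.sqrt_eq_rpow,
          ← Real.rpow_mul hT0.le]
        congr 2
        ring
    _ ≤ T ^ (1 / 2 - σ) * (1 / 4) ^ (-7 : ℝ) := by
        gcongr ?_ * ?_
        exact Real.rpow_le_rpow_of_exponent_ge (by norm_num) (by norm_num) (by linarith)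
    _ = 16384 * T ^ (1 / 2 - σ) := by
        rw [show (-7 : ℝ) = ((-7 : ℤ) : ℝ) by norm_num, Real.rpow_intCast]
        ring

lemma exists_sq_norm_riemannAux_sub_mul_mollifier_le : ∃ C, 0 < C ∧ ∀ T : ℝ, 10000 ≤ T →
    ∀ σ : ℝ, 1 / 2 ≤ σ → σ ≤ 4 → ∀ t : ℝ, T - 3 ≤ t →
      (‖riemannAux (σ + t * I) - zetaPartial (mainLength t) (σ + t * I)‖ *
        ‖mollifier (mainLength (T - 3)) (σ + t * I)‖) ^ 2 ≤ C * T ^ (1 / 2 - σ) := by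
  obtain ⟨C, hC, hR⟩ := exists_norm_riemannAux_sub_sum_le
  refine ⟨32 * C ^ 2, by positivity, fun T hT σ hσ hσ4 t ht => ?_⟩
  have hT0 : 0 < T := by linarith
  have ht0 : 0 < t := by linarith
  have happrox : ‖riemannAux (σ + t * I) - zetaPartial (mainLength t) (σ + t * I)‖ ≤
      C * t ^ (-(σ / 2)) := hR σ t (by linarith) hσ4 (by linarith [Real.pi_lt_d2])
  calc _ ≤ ((C * t ^ (-(σ / 2))) * (2 * √(mainLength (T - 3)))) ^ 2 := by
        gcongr
        exact norm_mollifier_le _ (by simpa using hσ)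
    _ = 4 * C ^ 2 * t ^ (-σ) * mainLength (T - 3) := by
        rw [mul_pow, mul_pow, mul_pow, Real.sq_sqrt (Nat.cast_nonneg _),
          ← Real.rpow_mul_natCast ht0.le, Nat.cast_ofNat, neg_mul, div_mul_cancel₀ _ two_ne_zero]
        ring
    _ ≤ 4 * C ^ 2 * (T / 2) ^ (-σ) * (√T / 2) := by
        gcongr ?_ * ?_ * ?_
        · exact Real.rpow_le_rpow_of_nonpos (by positivity) (by linarith) (by linarith)
        · exact mainLength_sub_three_le hT0.le
    _ = 2 * C ^ 2 * T ^ (1 / 2 - σ) * (1 / 2) ^ (-σ) := by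
        rw [div_eq_mul_one_div T, Real.mul_rpow hT0.le (by norm_num),
          show (1 / 2 - σ : ℝ) = -σ + 1 / 2 by ring, Real.rpow_add hT0, Real.sqrt_eq_rpow]
        ring
    _ ≤ 2 * C ^ 2 * T ^ (1 / 2 - σ) * (1 / 2) ^ (-4 : ℝ) := by
        gcongr ?_ * ?_
        exact Real.rpow_le_rpow_of_exponent_ge (by norm_num) (by norm_num) (by linarith)
    _ = _ := by
        rw [show (-4 : ℝ) = ((-4 : ℤ) : ℝ) by norm_num, Real.rpow_intCast]
        ring

lemma sq_norm_one_sub_mul_le (R Z M : ℂ) :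
    ‖1 - R * M‖ ^ 2 ≤ 2 * ‖1 - Z * M‖ ^ 2 + 2 * (‖R - Z‖ * ‖M‖) ^ 2 := by
  have htri : ‖1 - R * M‖ ≤ ‖1 - Z * M‖ + ‖R - Z‖ * ‖M‖ := by
    rw [← norm_mul, show 1 - R * M = (1 - Z * M) - (R - Z) * M by ring]
    exact norm_sub_le _ _
  calc _ ≤ (‖1 - Z * M‖ + ‖R - Z‖ * ‖M‖) ^ 2 := by gcongr
    _ ≤ _ := by linarith [add_sq_le (a := ‖1 - Z * M‖) (b := ‖R - Z‖ * ‖M‖)]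

lemma exists_sq_norm_one_sub_riemannAux_mul_le : ∃ C, 0 < C ∧ ∀ T : ℝ, 10000 ≤ T →
    ∀ σ : ℝ, 1 / 2 ≤ σ → σ ≤ 4 → ∀ t ∈ Set.Icc (T - 3) (2 * T + 3),
      ‖1 - riemannAux (σ + t * I) * mollifier (mainLength (T - 3)) (σ + t * I)‖ ^ 2 ≤
        C * T ^ (1 / 2 - σ) * Real.log T ^ 2 +
          2 * offDiagonal (mainLength (T - 3)) (mainLength (2 * T + 3)) σ t := by
  obtain ⟨C, hC, hR⟩ := exists_sq_norm_riemannAux_sub_mul_mollifier_le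
  refine ⟨262144 + 2 * C, by positivity, fun T hT σ hσ hσ4 t ht => ?_⟩
  have hlog : 1 ≤ Real.log T := by linarith [two_le_log hT]
  have hX := one_le_mainLength hT
  have hXt : mainLength (T - 3) ≤ mainLength t := mainLength_mono ht.1
  have htK : mainLength t ≤ mainLength (2 * T + 3) := mainLength_mono ht.2
  have hlogK : 1 + Real.log (mainLength (2 * T + 3)) ≤ 2 * Real.log T := by
    have : Real.log (mainLength (2 * T + 3)) ≤ Real.log T := by
      refine Real.log_le_log (by exact_mod_cast (by omega : 0 < mainLength (2 * T + 3)))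
        ((mainLength_two_mul_add_three_le hT).trans ?_)
      exact (Real.sqrt_le_left (by linarith)).2 (by nlinarith)
    linarith
  have := Real.log_natCast_nonneg (mainLength (2 * T + 3))
  have hdiag : (mainLength (T - 3) : ℝ) ^ (1 - 2 * σ) *
      (2 * (1 + Real.log (mainLength (2 * T + 3))) ^ 2) ≤
      131072 * (T ^ (1 / 2 - σ) * Real.log T ^ 2) := by
    calc _ ≤ 16384 * T ^ (1 / 2 - σ) * (2 * (2 * Real.log T) ^ 2) := by
          gcongr
          exact mainLength_rpow_le hT hσ hσ4
      _ = _ := by ring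
  have herror : C * T ^ (1 / 2 - σ) ≤ C * T ^ (1 / 2 - σ) * Real.log T ^ 2 :=
    le_mul_of_one_le_right (by positivity) (one_le_pow₀ hlog)
  linarith [sq_norm_one_sub_mul_le (riemannAux (σ + t * I))
      (zetaPartial (mainLength t) (σ + t * I)) (mollifier (mainLength (T - 3)) (σ + t * I)),
    sq_norm_one_sub_le hX hXt htK (by linarith [ht.1]) hσ, hR T hT σ hσ hσ4 t ht.1]

lemma continuous_sq_norm_one_sub_riemannAux_mul (X : ℕ) :
    Continuous fun s => ‖1 - riemannAux s * mollifier X s‖ ^ 2 := by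
  have := differentiable_riemannAux.continuous
  have := (differentiable_mollifier X).continuous
  fun_prop

lemma exists_integral_sq_norm_one_sub_le_sum_divisors : ∃ C, 0 < C ∧ ∀ T : ℝ, 10000 ≤ T →
    ∀ σ : ℝ, 1 / 2 ≤ σ → σ ≤ 4 → ∫ t in (T - 3)..(2 * T + 3),
      ‖1 - riemannAux (σ + t * I) * mollifier (mainLength (T - 3)) (σ + t * I)‖ ^ 2 ≤
      C * (T ^ (3 / 2 - σ) * Real.log T ^ 2 + Real.log T *
        ∑ n ∈ Finset.Icc 1 (mainLength (T - 3) * mainLength (2 * T + 3)),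
          (n.divisors.card : ℝ) ^ 2 * (n : ℝ) ^ (-(2 * σ - 1))) := by
  obtain ⟨C, hC, hR⟩ := exists_sq_norm_one_sub_riemannAux_mul_le
  refine ⟨2 * C + 24, by positivity, fun T hT σ hσ hσ4 => ?_⟩
  set X := mainLength (T - 3)
  set K := mainLength (2 * T + 3)
  set V := ∑ n ∈ Finset.Icc 1 (X * K), (n.divisors.card : ℝ) ^ 2 * (n : ℝ) ^ (-(2 * σ - 1))
  have hV : 0 ≤ V := Finset.sum_nonneg fun n _ => by positivity
  have hT0 : 0 < T := by linarith
  have hlog : 1 ≤ Real.log T := by linarith [two_le_log hT]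
  have hX : 1 ≤ X := one_le_mainLength hT
  have hXK : X ≤ K := mainLength_mono (by linarith)
  have hoffDiagonal : ∫ t in (T - 3)..(2 * T + 3), offDiagonal X K σ t ≤ 12 * Real.log T * V := by
    have : Real.log ((X * K : ℕ) : ℝ) ≤ Real.log T := Real.log_le_log
      (by exact_mod_cast Nat.mul_pos hX (hX.trans hXK)) (mainLength_mul_mainLength_le hT)
    exact (integral_offDiagonal_le X K σ (by linarith)).trans
      (mul_le_mul_of_nonneg_right (by linarith) hV)
  have hcont : Continuous fun t : ℝ => ‖1 - riemannAux (σ + t * I) * mollifier X (σ + t * I)‖ ^ 2 :=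
    (continuous_sq_norm_one_sub_riemannAux_mul X).comp (by fun_prop)
  calc _ ≤ ∫ t in (T - 3)..(2 * T + 3),
        (C * T ^ (1 / 2 - σ) * Real.log T ^ 2 + 2 * offDiagonal X K σ t) :=
      intervalIntegral.integral_mono_on (by linarith) (hcont.intervalIntegrable _ _)
        (intervalIntegrable_const.add ((intervalIntegrable_offDiagonal X K σ _ _).const_mul 2))
        (hR T hT σ hσ hσ4)
    _ = (T + 6) * (C * T ^ (1 / 2 - σ) * Real.log T ^ 2) +
        2 * ∫ t in (T - 3)..(2 * T + 3), offDiagonal X K σ t := by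
      rw [intervalIntegral.integral_add intervalIntegrable_const
        ((intervalIntegrable_offDiagonal X K σ _ _).const_mul 2), intervalIntegral.integral_const,
        intervalIntegral.integral_const_mul, smul_eq_mul]
      ring
    _ ≤ (2 * T) * (C * T ^ (1 / 2 - σ) * Real.log T ^ 2) + 2 * (12 * Real.log T * V) := by
      gcongr
      linarith
    _ = 2 * C * (T ^ (3 / 2 - σ) * Real.log T ^ 2) + 24 * (Real.log T * V) := by
      rw [show (3 / 2 - σ : ℝ) = 1 / 2 - σ + 1 by ring, Real.rpow_add_one hT0.ne']
      ring
    _ ≤ _ := by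
      have : 0 ≤ C * (Real.log T * V) := by positivity
      have : 0 ≤ T ^ (3 / 2 - σ) * Real.log T ^ 2 := by positivity
      linarith

lemma sum_card_divisors_sq_rpow_le_of_le_half {T a : ℝ} {N : ℕ} (hT : 1 ≤ Real.log T) (hN1 : 1 ≤ N)
    (hN : (N : ℝ) ≤ T) (ha : a ≤ 1 / 2) :
    ∑ n ∈ Finset.Icc 1 N, (n.divisors.card : ℝ) ^ 2 * (n : ℝ) ^ (-a) ≤
      16 * Real.log T ^ 3 * T ^ (1 - a) := by
  have hlog : Real.log N ≤ Real.log T := Real.log_le_log (by exact_mod_cast hN1) hN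
  have := Real.log_natCast_nonneg N
  calc _ ≤ 2 * (1 + Real.log N) ^ 3 * (N : ℝ) ^ (1 - a) :=
        sum_card_divisors_sq_rpow_le (by linarith) (by norm_num)
          fun J _ => sum_Icc_rpow_neg_le_of_le_half ha J
    _ ≤ 2 * (2 * Real.log T) ^ 3 * T ^ (1 - a) := by gcongr <;> linarith
    _ = _ := by ring

lemma sum_card_divisors_sq_rpow_le_of_le_one {T a : ℝ} {N : ℕ} (hT : 1 ≤ Real.log T) (hN1 : 1 ≤ N)
    (hN : (N : ℝ) ≤ T) (ha : a ≤ 1) :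
    ∑ n ∈ Finset.Icc 1 N, (n.divisors.card : ℝ) ^ 2 * (n : ℝ) ^ (-a) ≤
      16 * Real.log T ^ 4 * T ^ (1 - a) := by
  have hlog : Real.log N ≤ Real.log T := Real.log_le_log (by exact_mod_cast hN1) hN
  have hlog0 := Real.log_natCast_nonneg N
  have hsum : ∀ J ≤ N, ∑ j ∈ Finset.Icc 1 J, (j : ℝ) ^ (-a) ≤
      (1 + Real.log N) * (J : ℝ) ^ (1 - a) := by
    intro J hJN
    rcases J.eq_zero_or_pos with rfl | hJ
    · rw [Finset.Icc_eq_empty (by norm_num), Finset.sum_empty]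
      positivity
    refine (sum_Icc_rpow_neg_le_of_le_one ha J).trans ?_
    gcongr
  calc _ ≤ (1 + Real.log N) * (1 + Real.log N) ^ 3 * (N : ℝ) ^ (1 - a) :=
        sum_card_divisors_sq_rpow_le ha (by linarith) hsum
    _ ≤ (2 * Real.log T) * (2 * Real.log T) ^ 3 * T ^ (1 - a) := by gcongr <;> linarith
    _ = _ := by ring

lemma sum_card_divisors_sq_rpow_le_of_one_le {T a : ℝ} {N : ℕ} (hT : 1 ≤ Real.log T) (hN1 : 1 ≤ N)
    (hN : (N : ℝ) ≤ T) (ha : 1 ≤ a) :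
    ∑ n ∈ Finset.Icc 1 N, (n.divisors.card : ℝ) ^ 2 * (n : ℝ) ^ (-a) ≤ 16 * Real.log T ^ 4 := by
  calc _ ≤ ∑ n ∈ Finset.Icc 1 N, (n.divisors.card : ℝ) ^ 2 * (n : ℝ) ^ (-1 : ℝ) := by
        refine Finset.sum_le_sum fun n hn => ?_
        gcongr ?_ * ?_
        exact Real.rpow_le_rpow_of_exponent_le
          (by exact_mod_cast (Finset.mem_Icc.1 hn).1) (by linarith)
    _ ≤ _ := by simpa using sum_card_divisors_sq_rpow_le_of_le_one hT hN1 hN le_rfl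

lemma log_pow_three_le_rpow {T : ℝ} (hT : 1 ≤ T) : Real.log T ^ 3 ≤ 13824 * T ^ (1 / 8 : ℝ) := by
  have hlog0 := Real.log_nonneg hT
  calc Real.log T ^ 3 ≤ (T ^ (1 / 24 : ℝ) / (1 / 24)) ^ 3 := by
        gcongr
        exact Real.log_le_rpow_div (by linarith) (by norm_num)
    _ = 13824 * (T ^ (1 / 24 : ℝ)) ^ 3 := by ring
    _ = 13824 * T ^ (1 / 8 : ℝ) := by
        rw [← Real.rpow_mul_natCast (by linarith)]
        norm_num

lemma rpow_le_exp_mul_rpow {T x y c : ℝ} (hT : 1 < T) (h : x ≤ y + c / Real.log T) :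
    T ^ x ≤ Real.exp c * T ^ y := by
  have hlog := Real.log_pos hT
  rw [Real.rpow_def_of_pos (by linarith), Real.rpow_def_of_pos (by linarith), ← Real.exp_add]
  gcongr
  calc _ ≤ Real.log T * (y + c / Real.log T) := by gcongr
    _ = _ := by field_simp; ring

lemma log_pow_four_mul_rpow_le {T x y : ℝ} (hT : 1 < T) (hxy : x + 1 / 8 ≤ y + 1 / Real.log T) :
    16 * Real.log T ^ 4 * T ^ x ≤ 700000 * Real.log T * T ^ y := by
  have hlog := Real.log_pos hT
  have hpow : T ^ (x + 1 / 8) ≤ 3 * T ^ y :=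
    (rpow_le_exp_mul_rpow hT hxy).trans <| by
      gcongr
      linarith [Real.exp_one_lt_d9]
  calc _ = 16 * Real.log T * (Real.log T ^ 3 * T ^ x) := by ring
    _ ≤ 16 * Real.log T * ((13824 * T ^ (1 / 8 : ℝ)) * T ^ x) := by
        gcongr
        exact log_pow_three_le_rpow hT.le
    _ = 16 * Real.log T * (13824 * T ^ (x + 1 / 8)) := by
        rw [Real.rpow_add (by linarith)]
        ring
    _ ≤ 16 * Real.log T * (13824 * (3 * T ^ y)) := by gcongr
    _ ≤ _ := by
        have : 0 ≤ Real.log T * T ^ y := by positivity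
        linarith

-- For `σ ≤ 3/4` one logarithm too many is absorbed by `log² T ≤ T^(α - 1/2)`; beyond, the sum is
-- smaller than the target by a power of `T`.
lemma sum_card_divisors_sq_rpow_le_decay {T α σ : ℝ} {N : ℕ} (hT : 10000 ≤ T) (hN1 : 1 ≤ N)
    (hN : (N : ℝ) ≤ T) (hα : α ≤ 1) (hαT : Real.log T ^ 2 ≤ T ^ (α - 1 / 2))
    (hσ : α - 1 / Real.log T ≤ σ) (hσ4 : σ ≤ 4) :
    ∑ n ∈ Finset.Icc 1 N, (n.divisors.card : ℝ) ^ 2 * (n : ℝ) ^ (-(2 * σ - 1)) ≤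
      700000 * Real.log T * T ^ (3 / 2 - α - (σ - α) / 12) := by
  have hT1 : 1 < T := by linarith
  have hlog : 1 ≤ Real.log T := by linarith [two_le_log hT]
  have hδ0 : 0 < 1 / Real.log T := by positivity
  have : 1 / Real.log T ≤ 1 := (div_le_one (by linarith)).2 hlog
  have hexp_two : Real.exp 2 ≤ 9 := by
    rw [show (2 : ℝ) = 1 + 1 by norm_num, Real.exp_add]
    nlinarith [Real.exp_one_lt_d9, Real.exp_pos 1]
  set y := 3 / 2 - α - (σ - α) / 12 with hy
  rcases le_or_gt σ (3 / 4) with hσ34 | hσ34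
  · calc _ ≤ 16 * Real.log T ^ 3 * T ^ (1 - (2 * σ - 1)) :=
          sum_card_divisors_sq_rpow_le_of_le_half hlog hN1 hN (by linarith)
      _ = 16 * Real.log T * (Real.log T ^ 2 * T ^ (1 - (2 * σ - 1))) := by ring
      _ ≤ 16 * Real.log T * (T ^ (α - 1 / 2) * T ^ (1 - (2 * σ - 1))) := by gcongr
      _ ≤ 16 * Real.log T * (9 * T ^ y) := by
          rw [← Real.rpow_add (by linarith)]
          gcongr
          refine (rpow_le_exp_mul_rpow (y := y) (c := 2) hT1 ?_).trans (by gcongr)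
          rw [show 2 / Real.log T = 2 * (1 / Real.log T) by ring]
          linarith
      _ ≤ _ := by
          have : 0 ≤ Real.log T * T ^ y := by positivity
          linarith
  rcases le_or_gt σ 1 with hσ1 | hσ1
  · exact (sum_card_divisors_sq_rpow_le_of_le_one hlog hN1 hN (by linarith)).trans
      (log_pow_four_mul_rpow_le hT1 (by linarith))
  · refine (sum_card_divisors_sq_rpow_le_of_one_le hlog hN1 hN (by linarith)).trans ?_
    simpa only [Real.rpow_zero, mul_one] using
      log_pow_four_mul_rpow_le (x := 0) (y := y) hT1 (by linarith)

lemma exists_integral_sq_norm_one_sub_le_exp : ∃ C, 0 < C ∧ ∀ T : ℝ, 10000 ≤ T → ∀ α : ℝ,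
    1 / 2 ≤ α - 1 / Real.log T → α ≤ 1 → Real.log T ^ 2 ≤ T ^ (α - 1 / 2) → ∀ σ : ℝ,
    α - 1 / Real.log T ≤ σ → σ ≤ 4 → ∫ t in (T - 3)..(2 * T + 3),
      ‖1 - riemannAux (σ + t * I) * mollifier (mainLength (T - 3)) (σ + t * I)‖ ^ 2 ≤
      C * T ^ (3 / 2 - α) * Real.log T ^ 2 *
        Real.exp (-(Real.log T / 12 * (σ - (α - 1 / Real.log T)))) := by
  obtain ⟨C, hC, hR⟩ := exists_integral_sq_norm_one_sub_le_sum_divisors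
  refine ⟨C * 700003 * Real.exp (1 / 12), by positivity, fun T hT α hα hα1 hαT σ hσ hσ4 => ?_⟩
  have hT1 : 1 < T := by linarith
  have hlog : 1 ≤ Real.log T := by linarith [two_le_log hT]
  have hX := one_le_mainLength hT
  have hXK : mainLength (T - 3) ≤ mainLength (2 * T + 3) := mainLength_mono (by linarith)
  set y := 3 / 2 - α - (σ - α) / 12 with hy
  have hpow : T ^ (3 / 2 - σ) ≤ 3 * T ^ y := by
    refine (rpow_le_exp_mul_rpow (y := y) (c := 1) hT1 ?_).trans ?_
    · have : 0 < 1 / Real.log T := by positivity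
      linarith
    · gcongr
      linarith [Real.exp_one_lt_d9]
  have hexp : T ^ y = Real.exp (1 / 12) * (T ^ (3 / 2 - α) *
      Real.exp (-(Real.log T / 12 * (σ - (α - 1 / Real.log T))))) := by
    rw [Real.rpow_def_of_pos (by linarith), Real.rpow_def_of_pos (by linarith), ← Real.exp_add,
      ← Real.exp_add]
    congr 1
    field_simp
    ring
  calc _ ≤ C * (T ^ (3 / 2 - σ) * Real.log T ^ 2 + Real.log T * _) := hR T hT σ (by linarith) hσ4
    _ ≤ C * (3 * T ^ y * Real.log T ^ 2 + Real.log T * (700000 * Real.log T * T ^ y)) := by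
        gcongr
        exact sum_card_divisors_sq_rpow_le_decay hT (Nat.mul_pos hX (hX.trans hXK))
          (mainLength_mul_mainLength_le hT) hα1 hαT hσ hσ4
    _ = C * 700003 * T ^ y * Real.log T ^ 2 := by ring
    _ = _ := by rw [hexp]; ring

lemma integral_exp_neg_one_add_cos_le {b r : ℝ} (hb : 0 < b) (hr : 1 ≤ r) :
    ∫ θ in (0)..(2 * π), Real.exp (-(b * (r + r * Real.cos θ))) ≤ 4 / √b := by
  set c := 2 * b / π ^ 2 with hc
  have hc0 : 0 < c := by positivity
  have hquadratic : ∀ θ ∈ Set.Icc 0 (2 * π), c * (θ - π) ^ 2 ≤ b * (r + r * Real.cos θ) := by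
    intro θ hθ
    have hcos : 2 / π ^ 2 * (θ - π) ^ 2 ≤ 1 + Real.cos θ := by
      have := Real.cos_le_one_sub_mul_cos_sq
        (abs_le.2 ⟨by linarith [hθ.1], by linarith [hθ.2]⟩ : |θ - π| ≤ π)
      rw [Real.cos_sub_pi] at this
      linarith
    calc _ = b * (2 / π ^ 2 * (θ - π) ^ 2) := by rw [hc]; ring
      _ ≤ _ := by
        gcongr
        nlinarith [Real.neg_one_le_cos θ]
  calc _ ≤ ∫ θ in (0)..(2 * π), (fun x => Real.exp (-c * x ^ 2)) (θ - π) := by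
        refine intervalIntegral.integral_mono_on (by positivity)
          (Continuous.intervalIntegrable (by fun_prop) _ _)
          (Continuous.intervalIntegrable (by fun_prop) _ _) fun θ hθ => Real.exp_le_exp.2 ?_
        linarith [hquadratic θ hθ]
    _ = ∫ x in (-π)..π, Real.exp (-c * x ^ 2) := by
        rw [intervalIntegral.integral_comp_sub_right (fun x => Real.exp (-c * x ^ 2))]
        congr 1 <;> ring
    _ ≤ ∫ x : ℝ, Real.exp (-c * x ^ 2) := by
        rw [intervalIntegral.integral_of_le (by linarith [Real.pi_pos])]
        exact setIntegral_le_integral (integrable_exp_neg_mul_sq hc0)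
          (Eventually.of_forall fun x => (Real.exp_pos _).le)
    _ = √(π / c) := integral_gaussian c
    _ ≤ √(4 ^ 2 / b) := by
        apply Real.sqrt_le_sqrt
        rw [hc, div_div_eq_mul_div, div_le_div_iff₀ (by positivity) hb]
        have : π ^ 3 ≤ 3.15 ^ 3 := by gcongr; exact Real.pi_lt_d2.le
        nlinarith
    _ = 4 / √b := by rw [Real.sqrt_div (by norm_num), Real.sqrt_sq (by norm_num)]

lemma norm_sum_mul_exp_le_sum_fiber {ι κ : Type*} [DecidableEq κ] {P : Finset ι} {N : Finset κ}
    {g : ι → κ} (hg : ∀ p ∈ P, g p ∈ N) (c : ι → ℝ) (θ : κ → ℝ) :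
    ‖∑ p ∈ P, (c p : ℂ) * exp ((θ (g p) : ℂ) * I)‖ ≤ ∑ n ∈ N, |∑ p ∈ P with g p = n, c p| := by
  rw [← Finset.sum_fiberwise_of_maps_to hg]
  refine (norm_sum_le _ _).trans (Finset.sum_le_sum fun n _ => le_of_eq ?_)
  have hfactor : ∑ p ∈ P with g p = n, (c p : ℂ) * exp ((θ (g p) : ℂ) * I) =
      ((∑ p ∈ P with g p = n, c p : ℝ) : ℂ) * exp ((θ n : ℂ) * I) := by
    rw [ofReal_sum, Finset.sum_mul]
    exact Finset.sum_congr rfl fun p hp => by rw [(Finset.mem_filter.1 hp).2]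
  rw [hfactor, norm_mul, norm_exp_ofReal_mul_I, mul_one, norm_real, Real.norm_eq_abs]

lemma abs_sum_truncWeight_two_fiber_le {X L n : ℕ} (hX : 1 ≤ X) (hXL : X ≤ L) (hn : 1 ≤ n) :
    |∑ p ∈ mollifiedPairs X L with p.1 * p.2 = n, truncWeight 2 L p| ≤ (X : ℝ) ^ (-(1 / 2) : ℝ) *
      ∑ p ∈ mollifiedPairs X L with p.1 * p.2 = n, ((p.1 * p.2 : ℕ) : ℝ) ^ (-(3 / 2) : ℝ) := by
  have hX0 : (0 : ℝ) < X := by exact_mod_cast hX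
  have hn0 : (0 : ℝ) < n := by exact_mod_cast hn
  rcases hn.eq_or_lt with rfl | hn1
  · rw [filter_mollifiedPairs_eq_one, Finset.sum_empty, Finset.sum_empty, mul_zero, abs_zero]
  rcases le_or_gt n X with hnX | hnX
  · rw [sum_truncWeight_fiber le_rfl 2 hn1, mollifiedCoeff_eq_zero hXL hn1 hnX, mul_zero, abs_zero]
    positivity
  rw [Finset.mul_sum]
  refine (Finset.abs_sum_le_sum_abs _ _).trans (Finset.sum_le_sum fun p hp => ?_)
  have hpn : p.1 * p.2 = n := (Finset.mem_filter.1 hp).2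
  have hweight : |truncWeight 2 L p| ≤ ((p.1 * p.2 : ℕ) : ℝ) ^ (-2 : ℝ) := by
    unfold truncWeight
    split_ifs
    · exact abs_pairWeight_le 2 p
    · rw [abs_zero]
      positivity
  refine hweight.trans ?_
  rw [hpn, show (-2 : ℝ) = -(1 / 2) + -(3 / 2) by norm_num, Real.rpow_add hn0]
  gcongr ?_ * _
  exact Real.rpow_le_rpow_of_nonpos hX0 (by exact_mod_cast hnX.le) (by norm_num)

lemma sum_product_mul_rpow_le {a : ℝ} (ha : a < -1) (X L : ℕ) :
    ∑ p ∈ Finset.Icc 1 X ×ˢ Finset.Icc 1 L, ((p.1 * p.2 : ℕ) : ℝ) ^ a ≤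
      (∑' n : ℕ, (n : ℝ) ^ a) ^ 2 := by
  have hpartial : ∀ N : ℕ, ∑ n ∈ Finset.Icc 1 N, (n : ℝ) ^ a ≤ ∑' n : ℕ, (n : ℝ) ^ a := fun N =>
    (Real.summable_nat_rpow.2 ha).sum_le_tsum _ fun n _ => by positivity
  calc _ = (∑ d ∈ Finset.Icc 1 X, (d : ℝ) ^ a) * ∑ k ∈ Finset.Icc 1 L, (k : ℝ) ^ a := by
        rw [Finset.sum_mul_sum, Finset.sum_product]
        refine Finset.sum_congr rfl fun d _ => Finset.sum_congr rfl fun k _ => ?_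
        rw [Nat.cast_mul, Real.mul_rpow (Nat.cast_nonneg _) (Nat.cast_nonneg _)]
    _ ≤ _ := by
        rw [sq]
        gcongr
        · exact hpartial X
        · exact hpartial L

lemma norm_zetaPartial_mul_mollifier_sub_one_le {X L : ℕ} (hX : 1 ≤ X) (hXL : X ≤ L) (t : ℝ) :
    ‖zetaPartial L (2 + t * I) * mollifier X (2 + t * I) - 1‖ ≤
      (∑' n : ℕ, (n : ℝ) ^ (-(3 / 2) : ℝ)) ^ 2 * (X : ℝ) ^ (-(1 / 2) : ℝ) := by
  have hexpand := zetaPartial_mul_mollifier_sub_one hX (hX.trans hXL) (le_refl L) 2 t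
  rw [ofReal_ofNat] at hexpand
  have hmaps : ∀ p ∈ mollifiedPairs X L, p.1 * p.2 ∈ Finset.Icc 1 (X * L) := fun p hp =>
    mul_mem_Icc_of_mem_mollifiedPairs hp
  rw [hexpand]
  calc _ ≤ ∑ n ∈ Finset.Icc 1 (X * L),
          |∑ p ∈ mollifiedPairs X L with p.1 * p.2 = n, truncWeight 2 L p| :=
        norm_sum_mul_exp_le_sum_fiber hmaps _ fun n => -(t * Real.log n)
    _ ≤ ∑ n ∈ Finset.Icc 1 (X * L), (X : ℝ) ^ (-(1 / 2) : ℝ) *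
          ∑ p ∈ mollifiedPairs X L with p.1 * p.2 = n, ((p.1 * p.2 : ℕ) : ℝ) ^ (-(3 / 2) : ℝ) :=
        Finset.sum_le_sum fun n hn =>
          abs_sum_truncWeight_two_fiber_le hX hXL (Finset.mem_Icc.1 hn).1
    _ = (X : ℝ) ^ (-(1 / 2) : ℝ) *
          ∑ p ∈ mollifiedPairs X L, ((p.1 * p.2 : ℕ) : ℝ) ^ (-(3 / 2) : ℝ) := by
        rw [← Finset.mul_sum, Finset.sum_fiberwise_of_maps_to hmaps]
    _ ≤ (X : ℝ) ^ (-(1 / 2) : ℝ) * (∑' n : ℕ, (n : ℝ) ^ (-(3 / 2) : ℝ)) ^ 2 := by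
        gcongr
        refine le_trans ?_ (sum_product_mul_rpow_le (by norm_num) X L)
        gcongr
        exact mollifiedPairs_subset X L
    _ = _ := mul_comm _ _

lemma exists_sq_norm_one_sub_le_on_line_two : ∃ C, 0 < C ∧ ∀ T : ℝ, 10000 ≤ T →
    ∀ t : ℝ, T - 3 ≤ t →
      ‖1 - riemannAux (2 + t * I) * mollifier (mainLength (T - 3)) (2 + t * I)‖ ^ 2 ≤ C / √T := by
  obtain ⟨C, hC, hR⟩ := exists_sq_norm_riemannAux_sub_mul_mollifier_le
  set Z := ∑' n : ℕ, (n : ℝ) ^ (-(3 / 2) : ℝ)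
  refine ⟨8 * Z ^ 4 + 2 * C, by positivity, fun T hT t ht => ?_⟩
  have hT0 : 0 < T := by linarith
  have hX := one_le_mainLength hT
  have hmain : ‖1 - zetaPartial (mainLength t) (2 + t * I) *
      mollifier (mainLength (T - 3)) (2 + t * I)‖ ^ 2 ≤ 4 * Z ^ 4 / √T := by
    rw [norm_sub_rev]
    calc _ ≤ (Z ^ 2 * (mainLength (T - 3) : ℝ) ^ (-(1 / 2) : ℝ)) ^ 2 := by
          gcongr
          exact norm_zetaPartial_mul_mollifier_sub_one_le hX (mainLength_mono ht) t
      _ = Z ^ 4 / mainLength (T - 3) := by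
          rw [mul_pow, ← Real.rpow_mul_natCast (Nat.cast_nonneg _), Nat.cast_ofNat, neg_mul,
            div_mul_cancel₀ _ two_ne_zero, Real.rpow_neg_one]
          ring
      _ ≤ Z ^ 4 / (√T / 4) := by
          gcongr
          exact sqrt_div_four_le_mainLength hT
      _ = _ := by ring
  have herror := hR T hT 2 (by norm_num) (by norm_num) t ht
  have hpow : C * T ^ (1 / 2 - 2 : ℝ) ≤ C / √T := by
    rw [Real.sqrt_eq_rpow, div_eq_mul_inv C, ← Real.rpow_neg hT0.le]
    gcongr
    · linarith
    · norm_num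
  rw [ofReal_ofNat] at herror
  calc _ ≤ 2 * (4 * Z ^ 4 / √T) + 2 * (C / √T) := by
        linarith [sq_norm_one_sub_mul_le (riemannAux (2 + t * I))
          (zetaPartial (mainLength t) (2 + t * I)) (mollifier (mainLength (T - 3)) (2 + t * I))]
    _ = _ := by ring

lemma analyticOrderNatAt_le_analyticOrderNatAt_mul {f g : ℂ → ℂ} (hf : Differentiable ℂ f)
    (hg : Differentiable ℂ g) {c : ℂ} (hc : f c * g c ≠ 0) (ρ : ℂ) :
    analyticOrderNatAt f ρ ≤ analyticOrderNatAt (f * g) ρ := by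
  refine ENat.toNat_le_toNat ?_ ?_
  · rw [analyticOrderAt_mul (hf.analyticAt ρ) (hg.analyticAt ρ)]
    exact le_self_add
  · have hfg : AnalyticOnNhd ℂ (f * g) Set.univ := fun z _ => (hf.mul hg).analyticAt z
    refine hfg.analyticOrderAt_ne_top_of_isPreconnected isPreconnected_univ (Set.mem_univ c)
      (Set.mem_univ ρ) ?_
    rw [(analyticOrderAt_eq_zero (f := f * g)).2 (Or.inr hc)]
    simp

/-! ### Counting zeros -/

lemma div_sqrt_le_half {C T : ℝ} (hT : 0 < T) (hCT : 4 * C ^ 2 ≤ T) : C / √T ≤ 1 / 2 := by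
  rw [div_le_div_iff₀ (Real.sqrt_pos.2 hT) two_pos, one_mul]
  exact Real.le_sqrt_of_sq_le (by linarith)

lemma neg_log_norm_one_sub_sq_le {z : ℂ} (hz : ‖z‖ ^ 2 ≤ 1 / 2) :
    1 - z ^ 2 ≠ 0 ∧ -Real.log ‖1 - z ^ 2‖ ≤ 2 * ‖z‖ ^ 2 := by
  have hpos : 0 < 1 - ‖z‖ ^ 2 := by linarith
  have hlower : 1 - ‖z‖ ^ 2 ≤ ‖1 - z ^ 2‖ := by
    rw [← norm_pow]
    simpa only [norm_one] using norm_sub_norm_le (1 : ℂ) (z ^ 2)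
  have hinv : (1 - ‖z‖ ^ 2)⁻¹ ≤ 1 + 2 * ‖z‖ ^ 2 := by
    rw [inv_le_iff_one_le_mul₀ hpos]
    nlinarith [sq_nonneg ‖z‖]
  exact ⟨norm_pos_iff.1 (hpos.trans_le hlower), by
    linarith [Real.log_le_log hpos hlower, Real.one_sub_inv_le_log_of_pos hpos]⟩

lemma log_norm_one_sub_sq_le (z : ℂ) : Real.log ‖1 - z ^ 2‖ ≤ ‖z‖ ^ 2 := by
  have hupper : ‖1 - z ^ 2‖ ≤ 1 + ‖z‖ ^ 2 := by
    rw [← norm_pow]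
    simpa only [norm_one] using norm_sub_le (1 : ℂ) (z ^ 2)
  rcases (norm_nonneg (1 - z ^ 2)).eq_or_lt with hzero | hpos
  · rw [← hzero, Real.log_zero]
    positivity
  · linarith [Real.log_le_sub_one_of_pos hpos]

lemma integral_exp_log_div_twelve_le {ℓ α : ℝ} (hℓ : 0 < ℓ) (hα : α ≤ 1) :
    ∫ θ in (0)..(2 * π),
      Real.exp (-(ℓ / 12 * (2 + (2 - α + 1 / ℓ) * Real.cos θ - (α - 1 / ℓ)))) ≤ 16 / √ℓ := by
  have : 0 < 1 / ℓ := by positivity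
  have hsqrt : √ℓ / 4 ≤ √(ℓ / 12) := by
    apply Real.le_sqrt_of_sq_le
    rw [div_pow, Real.sq_sqrt hℓ.le]
    linarith
  calc _ = ∫ θ in (0)..(2 * π),
        Real.exp (-(ℓ / 12 * ((2 - α + 1 / ℓ) + (2 - α + 1 / ℓ) * Real.cos θ))) := by
        refine intervalIntegral.integral_congr fun θ _ => ?_
        congr 2
        ring
    _ ≤ 4 / √(ℓ / 12) := integral_exp_neg_one_add_cos_le (by positivity) (by linarith)
    _ ≤ 4 / (√ℓ / 4) := by gcongr
    _ = 16 / √ℓ := by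
        field_simp
        norm_num

lemma add_two_mul_div_sqrt_le {C T x : ℝ} (hC : 0 ≤ C) (hT : 2 ≤ T) (hx : 1 / 2 ≤ x) :
    (T + 2) * (2 * (C / √T)) ≤ 4 * C * T ^ x := by
  have hpow : √T ≤ T ^ x := by
    rw [Real.sqrt_eq_rpow]
    exact Real.rpow_le_rpow_of_exponent_le (by linarith) hx
  calc _ ≤ (2 * T) * (2 * (C / √T)) := by
        gcongr
        linarith
    _ = 4 * C * (T / √T) := by ring
    _ ≤ 4 * C * T ^ x := by
        rw [Real.div_sqrt]
        gcongr

lemma inv_two_pi_mul_integral_exp_log_div_twelve_le {A ℓ α : ℝ} (hA : 0 ≤ A) (hℓ : 0 < ℓ)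
    (hα : α ≤ 1) :
    (2 * π)⁻¹ * (∫ θ in (0)..(2 * π),
      A * Real.exp (-(ℓ / 12 * (2 + (2 - α + 1 / ℓ) * Real.cos θ - (α - 1 / ℓ))))) ≤
      A * (16 / √ℓ) := by
  have hπ : (2 * π)⁻¹ ≤ 1 := inv_le_one_of_one_le₀ (by linarith [Real.pi_gt_three])
  rw [intervalIntegral.integral_const_mul]
  refine (mul_le_of_le_one_left (mul_nonneg hA <| intervalIntegral.integral_nonneg
    (by positivity) fun θ _ => by positivity) hπ).trans ?_
  gcongr
  exact integral_exp_log_div_twelve_le hℓ hα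

lemma exists_neg_log_norm_one_sub_sq_le_on_line_two : ∃ C, 0 < C ∧ ∀ T : ℝ, 10000 ≤ T →
    4 * C ^ 2 ≤ T → ∀ t : ℝ, T - 3 ≤ t →
      1 - (1 - riemannAux (2 + t * I) * mollifier (mainLength (T - 3)) (2 + t * I)) ^ 2 ≠ 0 ∧
      -Real.log ‖1 - (1 - riemannAux (2 + t * I) *
        mollifier (mainLength (T - 3)) (2 + t * I)) ^ 2‖ ≤ 2 * (C / √T) := by
  obtain ⟨C, hC, hline⟩ := exists_sq_norm_one_sub_le_on_line_two
  refine ⟨C, hC, fun T hT hCT t ht => ?_⟩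
  have hsmall := hline T hT t ht
  obtain ⟨hne, hle⟩ := neg_log_norm_one_sub_sq_le
    (hsmall.trans (div_sqrt_le_half (by linarith) hCT))
  exact ⟨hne, by linarith⟩

-- `1 - (1 - R M)² = R M (2 - R M)` vanishes at the zeros of `R`, and its logarithm is bounded by
-- `‖1 - R M‖²`, whose mean values are small.
lemma exists_sum_order_mul_le_of_mollified : ∃ C, 0 < C ∧ ∀ T : ℝ, 10000 ≤ T → C ≤ T →
    ∀ α : ℝ, 1 / 2 ≤ α - 1 / Real.log T → α ≤ 1 → Real.log T ^ 2 ≤ T ^ (α - 1 / 2) →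
    ∀ S : Finset ℂ, (∀ ρ ∈ S, α ≤ ρ.re ∧ ρ.re ≤ 1 ∧ T ≤ ρ.im ∧ ρ.im ≤ 2 * T) →
      (∑ ρ ∈ S, (analyticOrderNatAt riemannAux ρ : ℝ)) *
          (1 / Real.log T * √(1 / Real.log T) / 8) ≤
        C * T ^ (3 / 2 - α) * (Real.log T ^ 2 / √(Real.log T) + 1) := by
  obtain ⟨C₁, hC₁, hline⟩ := exists_neg_log_norm_one_sub_sq_le_on_line_two
  obtain ⟨C₂, hC₂, hmean⟩ := exists_integral_sq_norm_one_sub_le_exp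
  refine ⟨4 * C₁ ^ 2 + 4 * C₁ + 16 * C₂, by positivity, fun T hT hCT α hα hα1 hαT S hS => ?_⟩
  have : 0 < T := by linarith
  have hlog := two_le_log hT
  set ℓ := Real.log T
  set Q := T ^ (3 / 2 - α)
  set M := mollifier (mainLength (T - 3))
  have hRd := differentiable_riemannAux
  have hMd : Differentiable ℂ M := differentiable_mollifier _
  set g : ℂ → ℂ := fun s => M s * (2 - riemannAux s * M s) with hg
  have hgd : Differentiable ℂ g := hMd.mul ((differentiable_const _).sub (hRd.mul hMd))
  have hfg : ∀ s, (riemannAux * g) s = 1 - (1 - riemannAux s * M s) ^ 2 := fun s => by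
    simp only [hg, Pi.mul_apply]
    ring
  have hcenter : ∀ t ∈ Set.Icc (T - 1) (2 * T + 1), (riemannAux * g) (2 + t * I) ≠ 0 ∧
      -Real.log ‖(riemannAux * g) (2 + t * I)‖ ≤ 2 * (C₁ / √T) := fun t ht => by
    rw [hfg]
    exact hline T hT (by nlinarith) t (by linarith [ht.1])
  have hjensen := sum_order_mul_le_of_integral_le (hRd.mul hgd)
    (continuous_sq_norm_one_sub_riemannAux_mul _) (fun s => by positivity)
    (fun s => by rw [hfg]; exact log_norm_one_sub_sq_le _) (δ := 1 / ℓ) (by positivity)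
    (one_div_le_one_div_of_le two_pos hlog) (by linarith [one_div_pos.2 (two_pos.trans_le hlog)])
    hα1 (by linarith) hS hcenter
    (G := fun σ => C₂ * Q * ℓ ^ 2 * Real.exp (-(ℓ / 12 * (σ - (α - 1 / ℓ)))))
    (by fun_prop) (hmean T hT α hα hα1 hαT)
  have horder : ∑ ρ ∈ S, (analyticOrderNatAt riemannAux ρ : ℝ) ≤
      ∑ ρ ∈ S, (analyticOrderNatAt (riemannAux * g) ρ : ℝ) := by
    gcongr with ρ
    exact analyticOrderNatAt_le_analyticOrderNatAt_mul hRd hgd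
      (hcenter T ⟨by linarith, by linarith⟩).1 ρ
  calc _ ≤ C₂ * Q * ℓ ^ 2 * (16 / √ℓ) + (2 * T - T + 2) * (2 * (C₁ / √T)) := by
        exact (mul_le_mul_of_nonneg_right horder (by positivity)).trans <| hjensen.trans <|
          add_le_add_left (inv_two_pi_mul_integral_exp_log_div_twelve_le
            (by positivity) (by positivity) hα1) _
    _ ≤ C₂ * Q * ℓ ^ 2 * (16 / √ℓ) + 4 * C₁ * Q := by
        rw [show 2 * T - T = T by ring]
        exact add_le_add_right
          (add_two_mul_div_sqrt_le hC₁.le (by linarith) (by linarith)) _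
    _ = (16 * C₂) * Q * (ℓ ^ 2 / √ℓ) + 4 * C₁ * Q := by ring
    _ ≤ _ := by
        have : 0 ≤ (4 * C₁ ^ 2 + 4 * C₁) * (Q * (ℓ ^ 2 / √ℓ)) := by positivity
        have : 0 ≤ (4 * C₁ ^ 2 + 16 * C₂) * Q := by positivity
        linarith

lemma exists_sum_order_block_le_of_mollified : ∃ C, 0 < C ∧ ∀ T : ℝ, 10000 ≤ T → C ≤ T →
    ∀ α : ℝ, 1 / 2 ≤ α - 1 / Real.log T → α ≤ 1 → Real.log T ^ 2 ≤ T ^ (α - 1 / 2) →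
    ∀ S : Finset ℂ, (∀ ρ ∈ S, α ≤ ρ.re ∧ ρ.re ≤ 1 ∧ T ≤ ρ.im ∧ ρ.im ≤ 2 * T) →
      ∑ ρ ∈ S, (analyticOrderNatAt riemannAux ρ : ℝ) ≤ C * T ^ (3 / 2 - α) * Real.log T ^ 3 := by
  obtain ⟨C, hC, hblock⟩ := exists_sum_order_mul_le_of_mollified
  refine ⟨16 * C, by positivity, fun T hT hCT α hα hα1 hαT S hS => ?_⟩
  have hlog := two_le_log hT
  have hN := hblock T hT (by linarith) α hα hα1 hαT S hS
  set ℓ := Real.log T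
  set N := ∑ ρ ∈ S, (analyticOrderNatAt riemannAux ρ : ℝ)
  have hℓ : 0 < √ℓ := Real.sqrt_pos.2 (by linarith)
  have hsqrt : √ℓ * ℓ ≤ ℓ ^ 3 := by
    have : √ℓ ≤ ℓ := (Real.sqrt_le_left (by linarith)).2 (by nlinarith)
    calc _ ≤ ℓ * ℓ * 1 := by nlinarith
      _ ≤ ℓ * ℓ * ℓ := by gcongr; linarith
      _ = ℓ ^ 3 := by ring
  have hweight : 1 / ℓ * √(1 / ℓ) / 8 = (8 * (√ℓ * ℓ))⁻¹ := by
    rw [Real.sqrt_div zero_le_one, Real.sqrt_one]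
    field_simp
  rw [hweight, ← div_eq_mul_inv, div_le_iff₀ (by positivity)] at hN
  calc N ≤ C * T ^ (3 / 2 - α) * (ℓ ^ 2 / √ℓ + 1) * (8 * (√ℓ * ℓ)) := hN
    _ = 8 * C * T ^ (3 / 2 - α) * (ℓ ^ 3 + √ℓ * ℓ) := by
        field_simp
    _ ≤ 8 * C * T ^ (3 / 2 - α) * (ℓ ^ 3 + ℓ ^ 3) := by gcongr
    _ = _ := by ring

lemma norm_zetaPartial_le (N : ℕ) {s : ℂ} (hs : 0 ≤ s.re) : ‖zetaPartial N s‖ ≤ N := by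
  refine (norm_sum_le _ _).trans ?_
  calc _ ≤ ∑ _ ∈ Finset.Icc 1 N, (1 : ℝ) := by
        refine Finset.sum_le_sum fun n hn => ?_
        have hn1 := (Finset.mem_Icc.1 hn).1
        rw [norm_natCast_cpow_of_pos hn1, neg_re]
        exact Real.rpow_le_one_of_one_le_of_nonpos (by exact_mod_cast hn1) (by linarith)
    _ = N := by simp

lemma exists_neg_log_norm_riemannAux_le_on_line_two : ∃ C, ∀ T : ℝ, 10000 ≤ T → C ≤ T →
    ∀ t : ℝ, T - 3 ≤ t → riemannAux (2 + t * I) ≠ 0 ∧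
      -Real.log ‖riemannAux (2 + t * I)‖ ≤ Real.log T := by
  obtain ⟨C, -, hline⟩ := exists_sq_norm_one_sub_le_on_line_two
  refine ⟨4 * C ^ 2, fun T hT hCT t ht => ?_⟩
  have hT0 : 0 < T := by linarith
  have hsmall := (hline T hT t ht).trans (div_sqrt_le_half hT0 hCT)
  have hM : ‖mollifier (mainLength (T - 3)) (2 + t * I)‖ ≤ 2 * √(mainLength (T - 3)) :=
    norm_mollifier_le _ (by simp; norm_num)
  set R := riemannAux (2 + t * I)
  set M := mollifier (mainLength (T - 3)) (2 + t * I)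
  have hsub : ‖1 - R * M‖ ≤ 3 / 4 := abs_le_of_sq_le_sq' (by linarith) (by norm_num) |>.2
  have hprod : 1 / 4 ≤ ‖R‖ * ‖M‖ := by
    have : 1 - ‖1 - R * M‖ ≤ ‖R * M‖ := by simpa using norm_sub_norm_le (1 : ℂ) (1 - R * M)
    rw [norm_mul] at this
    linarith
  have hM' : ‖M‖ ≤ T / 4 := by
    have h100 : 100 ≤ √T := Real.le_sqrt_of_sq_le (by linarith)
    have : √(mainLength (T - 3)) ≤ √T := Real.sqrt_le_sqrt <|
      (mainLength_sub_three_le hT0.le).trans (by nlinarith [Real.sq_sqrt hT0.le])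
    nlinarith [Real.sq_sqrt hT0.le]
  have hlower : T⁻¹ ≤ ‖R‖ := by
    rw [inv_le_iff_one_le_mul₀ hT0]
    nlinarith [norm_nonneg R]
  have hloglower := Real.log_le_log (inv_pos.2 hT0) hlower
  rw [Real.log_inv] at hloglower
  exact ⟨norm_pos_iff.1 ((inv_pos.2 hT0).trans_le hlower), by linarith⟩

lemma exists_log_one_add_norm_riemannAux_le : ∃ C, ∀ T : ℝ, 10000 ≤ T → C ≤ T →
    ∀ σ : ℝ, 0 ≤ σ → σ ≤ 4 → ∀ t ∈ Set.Icc (T - 3) (2 * T + 3),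
      Real.log (1 + ‖riemannAux (σ + t * I)‖) ≤ 2 * Real.log T := by
  obtain ⟨C, hC, hR⟩ := exists_norm_riemannAux_sub_sum_le
  refine ⟨C, fun T hT hCT σ hσ hσ4 t ht => ?_⟩
  have happrox : ‖riemannAux (σ + t * I) - zetaPartial (mainLength t) (σ + t * I)‖ ≤
      C * t ^ (-(σ / 2)) := hR σ t hσ hσ4 (by linarith [ht.1, Real.pi_lt_d2])
  have herror : C * t ^ (-(σ / 2)) ≤ C := mul_le_of_le_one_right hC.le
    (Real.rpow_le_one_of_one_le_of_nonpos (by linarith [ht.1]) (by linarith))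
  have hmain : ‖zetaPartial (mainLength t) (σ + t * I)‖ ≤ T := by
    refine (norm_zetaPartial_le _ (by simpa using hσ)).trans ?_
    calc (mainLength t : ℝ) ≤ mainLength (2 * T + 3) := by exact_mod_cast mainLength_mono ht.2
      _ ≤ √T := mainLength_two_mul_add_three_le hT
      _ ≤ T := (Real.sqrt_le_left (by linarith)).2 (by nlinarith)
  have hnorm : ‖riemannAux (σ + t * I)‖ ≤ 2 * T := by
    linarith [norm_sub_norm_le (riemannAux (σ + t * I)) (zetaPartial (mainLength t) (σ + t * I))]
  calc _ ≤ Real.log (T ^ 2) := Real.log_le_log (by positivity) (by nlinarith)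
    _ = _ := by rw [Real.log_pow, Nat.cast_ofNat]

lemma exists_sum_order_block_le : ∃ C T₀, 0 < C ∧ 10000 ≤ T₀ ∧ ∀ T : ℝ, T₀ ≤ T →
    ∀ S : Finset ℂ, (∀ ρ ∈ S, 1 / 2 ≤ ρ.re ∧ ρ.re ≤ 1 ∧ T ≤ ρ.im ∧ ρ.im ≤ 2 * T) →
      ∑ ρ ∈ S, (analyticOrderNatAt riemannAux ρ : ℝ) ≤ C * T * Real.log T := by
  obtain ⟨C₁, hcenter⟩ := exists_neg_log_norm_riemannAux_le_on_line_two
  obtain ⟨C₂, hbound⟩ := exists_log_one_add_norm_riemannAux_le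
  refine ⟨160, max 10000 (max C₁ C₂), by positivity, le_max_left _ _, fun T hTmax S hS => ?_⟩
  obtain ⟨hT, hCT⟩ := max_le_iff.1 hTmax
  obtain ⟨hC₁, hC₂⟩ := max_le_iff.1 hCT
  set u : ℂ → ℝ := fun s => Real.log (1 + ‖riemannAux s‖)
  have hu : Continuous u := by
    have := differentiable_riemannAux.continuous
    exact Continuous.log (by fun_prop) fun s => by positivity
  have hlog_le : ∀ s, Real.log ‖riemannAux s‖ ≤ u s := fun s => by
    rcases (norm_nonneg (riemannAux s)).eq_or_lt with hzero | hpos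
    · simp [u, ← hzero]
    · exact Real.log_le_log hpos (by linarith)
  have hmean : ∀ σ : ℝ, (1 / 2 - 1 / 2 : ℝ) ≤ σ → σ ≤ 4 →
      ∫ t in (T - 3)..(2 * T + 3), u (σ + t * I) ≤ (T + 6) * (2 * Real.log T) := by
    intro σ hσ hσ4
    calc _ ≤ ∫ t in (T - 3)..(2 * T + 3), 2 * Real.log T :=
          intervalIntegral.integral_mono_on (by linarith)
            ((hu.comp (by fun_prop)).intervalIntegrable _ _) intervalIntegrable_const
            (hbound T hT hC₂ σ (by linarith) hσ4)
      _ = _ := by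
          rw [intervalIntegral.integral_const, smul_eq_mul]
          ring
  have hjensen := sum_order_mul_le_of_integral_le differentiable_riemannAux hu
    (fun s => Real.log_nonneg (by linarith [norm_nonneg (riemannAux s)])) hlog_le
    (δ := 1 / 2) (by norm_num) le_rfl le_rfl (by norm_num) (by linarith) hS
    (fun t ht => hcenter T hT hC₁ t (by linarith [ht.1])) continuous_const hmean
  rw [intervalIntegral.integral_const, smul_eq_mul, sub_zero,
    inv_mul_cancel_left₀ (by positivity)] at hjensen
  set N := ∑ ρ ∈ S, (analyticOrderNatAt riemannAux ρ : ℝ)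
  have hN : 0 ≤ N := Finset.sum_nonneg fun _ _ => Nat.cast_nonneg _
  have hsqrt : (1 / 2 : ℝ) ≤ √(1 / 2) := Real.le_sqrt_of_sq_le (by norm_num)
  have hweight : N * (1 / 32) ≤ N * (1 / 2 * √(1 / 2) / 8) :=
    mul_le_mul_of_nonneg_left (by linarith) hN
  nlinarith [two_le_log hT]

-- The mollified bound covers `log² T ≤ T^(α - 1/2)`; for smaller `α` the trivial bound suffices.
lemma exists_sum_order_block_le_rpow : ∃ C T₀, 0 < C ∧ 10000 ≤ T₀ ∧ ∀ T : ℝ, T₀ ≤ T →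
    ∀ α : ℝ, 1 / 2 ≤ α → α ≤ 1 →
    ∀ S : Finset ℂ, (∀ ρ ∈ S, α ≤ ρ.re ∧ ρ.re ≤ 1 ∧ T ≤ ρ.im ∧ ρ.im ≤ 2 * T) →
      ∑ ρ ∈ S, (analyticOrderNatAt riemannAux ρ : ℝ) ≤ C * T ^ (3 / 2 - α) * Real.log T ^ 3 := by
  obtain ⟨C₁, hC₁, hmollified⟩ := exists_sum_order_block_le_of_mollified
  obtain ⟨C₂, T₂, hC₂, hT₂, htrivial⟩ := exists_sum_order_block_le
  refine ⟨C₁ + C₂, max T₂ C₁, by positivity, hT₂.trans (le_max_left _ _),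
    fun T hTmax α hα hα1 S hS => ?_⟩
  obtain ⟨hT₂T, hC₁T⟩ := max_le_iff.1 hTmax
  have hT : 10000 ≤ T := hT₂.trans hT₂T
  have hT0 : 0 < T := by linarith
  have hlog := two_le_log hT
  rcases le_or_gt (Real.log T ^ 2) (T ^ (α - 1 / 2)) with hlarge | hsmall
  · have hα' : 1 / Real.log T ≤ α - 1 / 2 := by
      have hloglog := Real.log_le_log (by positivity) hlarge
      rw [Real.log_rpow hT0, Real.log_pow, Nat.cast_ofNat] at hloglog
      rw [div_le_iff₀ (by linarith)]
      linarith [Real.log_le_log two_pos hlog, Real.log_two_gt_d9]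
    refine (hmollified T hT hC₁T α (by linarith) hα1 hlarge S hS).trans ?_
    gcongr
    linarith
  · calc _ ≤ C₂ * T * Real.log T := htrivial T hT₂T S fun ρ hρ =>
          ⟨hα.trans (hS ρ hρ).1, (hS ρ hρ).2⟩
      _ = C₂ * (T ^ (3 / 2 - α) * T ^ (α - 1 / 2)) * Real.log T := by
          rw [← Real.rpow_add hT0]
          norm_num
      _ ≤ C₂ * (T ^ (3 / 2 - α) * Real.log T ^ 2) * Real.log T := by gcongr
      _ = C₂ * T ^ (3 / 2 - α) * Real.log T ^ 3 := by ring
      _ ≤ _ := by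
          gcongr
          linarith

lemma exists_riemannAux_ne_zero : ∃ s, riemannAux s ≠ 0 := by
  obtain ⟨C, hcenter⟩ := exists_neg_log_norm_riemannAux_le_on_line_two
  set T := max 10000 C
  exact ⟨2 + T * I, (hcenter T (le_max_left _ _) (le_max_right _ _) T (by linarith)).1⟩

lemma finite_setOf_eq_zero_inter_of_isCompact {f : ℂ → ℂ} (hf : Differentiable ℂ f) {c : ℂ}
    (hc : f c ≠ 0) {K : Set ℂ} (hK : IsCompact K) : ({z | f z = 0} ∩ K).Finite := by
  by_contra hinf
  obtain ⟨z, -, hz⟩ := Set.Infinite.exists_accPt_of_subset_isCompact hinf hK Set.inter_subset_right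
  rw [accPt_iff_frequently_nhdsNE] at hz
  have hanalytic : AnalyticOnNhd ℂ f Set.univ := fun z _ => hf.analyticAt z
  exact hc (hanalytic.eqOn_zero_of_preconnected_of_frequently_eq_zero isPreconnected_univ
    (Set.mem_univ z) (hz.mono fun w hw => hw.1) (Set.mem_univ c))

lemma finite_riemannAuxZeros (α T : ℝ) : (riemannAuxZeros α T).Finite := by
  obtain ⟨c, hc⟩ := exists_riemannAux_ne_zero
  refine (finite_setOf_eq_zero_inter_of_isCompact differentiable_riemannAux hc
    (K := Set.Icc α 1 ×ℂ Set.Icc 0 T) (isCompact_Icc.reProdIm isCompact_Icc)).subset ?_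
  rintro ρ ⟨hzero, hα, hre, him, hT⟩
  exact ⟨hzero, ⟨hα, hre⟩, ⟨him.le, hT⟩⟩

lemma riemannAuxCount_eq_sum (α T : ℝ) : (riemannAuxCount α T : ℝ) =
    ∑ ρ ∈ (finite_riemannAuxZeros α T).toFinset, (analyticOrderNatAt riemannAux ρ : ℝ) := by
  rw [riemannAuxCount, finsum_mem_eq_finite_toFinset_sum _ (finite_riemannAuxZeros α T),
    Nat.cast_sum]

lemma riemannAuxCount_mono {α β T U : ℝ} (hβ : β ≤ α) (hT : T ≤ U) :
    (riemannAuxCount α T : ℝ) ≤ riemannAuxCount β U := by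
  rw [riemannAuxCount_eq_sum, riemannAuxCount_eq_sum]
  refine Finset.sum_le_sum_of_subset_of_nonneg ?_ fun _ _ _ => Nat.cast_nonneg _
  rw [Set.Finite.toFinset_subset_toFinset]
  rintro ρ ⟨hzero, hα, hre, him, hρT⟩
  exact ⟨hzero, hβ.trans hα, hre, him, hρT.trans hT⟩

lemma exists_riemannAuxCount_two_mul_le : ∃ C T₀, 0 < C ∧ 10000 ≤ T₀ ∧ ∀ T : ℝ, T₀ ≤ T →
    ∀ α : ℝ, 1 / 2 ≤ α → α ≤ 1 → (riemannAuxCount α (2 * T) : ℝ) ≤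
      riemannAuxCount α T + C * (T ^ (3 / 2 - α) * Real.log T ^ 3) := by
  obtain ⟨C, T₀, hC, hT₀, hblock⟩ := exists_sum_order_block_le_rpow
  refine ⟨C, T₀, hC, hT₀, fun T hT α hα hα1 => ?_⟩
  classical
  rw [riemannAuxCount_eq_sum, riemannAuxCount_eq_sum, ← mul_assoc,
    ← Finset.sum_filter_add_sum_filter_not _ (fun ρ : ℂ => ρ.im ≤ T)]
  refine add_le_add ?_ (hblock T hT α hα hα1 _ fun ρ hρ => ?_)
  · refine Finset.sum_le_sum_of_subset_of_nonneg (fun ρ hρ => ?_) fun _ _ _ => Nat.cast_nonneg _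
    rw [Finset.mem_filter, Set.Finite.mem_toFinset] at hρ
    obtain ⟨⟨hzero, hre, hre1, him, -⟩, himT⟩ := hρ
    rw [Set.Finite.mem_toFinset]
    exact ⟨hzero, hre, hre1, him, himT⟩
  · rw [Finset.mem_filter, Set.Finite.mem_toFinset] at hρ
    obtain ⟨⟨-, hre, hre1, -, him2T⟩, himT⟩ := hρ
    exact ⟨hre, hre1, (not_le.1 himT).le, him2T⟩

lemma one_le_eight_mul_rpow_mul_log_pow {T x : ℝ} (hT : 2 ≤ T) (hx : 0 ≤ x) :
    1 ≤ 8 * (T ^ x * Real.log T ^ 3) := by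
  have hlog : (1 / 2 : ℝ) ≤ Real.log T := by
    linarith [Real.log_two_gt_d9, Real.log_le_log two_pos hT]
  calc (1 : ℝ) = 8 * (1 * (1 / 2) ^ 3) := by norm_num
    _ ≤ _ := by
      gcongr
      exact Real.one_le_rpow (by linarith) hx

lemma half_rpow_mul_log_pow_le {T x : ℝ} (hT : 2 ≤ T) (hx : 1 / 2 ≤ x) :
    (T / 2) ^ x * Real.log (T / 2) ^ 3 ≤ 3 / 4 * (T ^ x * Real.log T ^ 3) := by
  have hlog0 : 0 ≤ Real.log (T / 2) := Real.log_nonneg (by linarith)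
  have hlog : Real.log (T / 2) ≤ Real.log T := Real.log_le_log (by linarith) (by linarith)
  have hhalf : (1 / 2 : ℝ) ^ x ≤ 3 / 4 :=
    calc (1 / 2 : ℝ) ^ x ≤ (1 / 2) ^ (1 / 2 : ℝ) :=
          Real.rpow_le_rpow_of_exponent_ge (by norm_num) (by norm_num) hx
      _ ≤ 3 / 4 := by
          rw [← Real.sqrt_eq_rpow, Real.sqrt_le_left (by norm_num)]
          norm_num
  calc _ = T ^ x * (1 / 2) ^ x * Real.log (T / 2) ^ 3 := by
        rw [div_eq_mul_one_div, Real.mul_rpow (by linarith) (by norm_num)]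
    _ ≤ T ^ x * (3 / 4) * Real.log T ^ 3 := by gcongr
    _ = _ := by ring

lemma le_mul_of_two_mul_le_add {N F : ℝ → ℝ} {T₀ A B : ℝ} (hT₀ : 2 ≤ T₀) (hA : 0 ≤ A)
    (hAB : 4 * A ≤ B) (hF : ∀ T ≥ 2, 0 ≤ F T) (hFhalf : ∀ T ≥ 2, F (T / 2) ≤ 3 / 4 * F T)
    (hinit : ∀ T ≥ 2, T ≤ 2 * T₀ → N T ≤ B * F T)
    (hdouble : ∀ T ≥ T₀, N (2 * T) ≤ N T + A * F T) {T : ℝ} (hT : 2 ≤ T) : N T ≤ B * F T := by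
  obtain ⟨k, hk⟩ := pow_unbounded_of_one_lt T one_lt_two
  replace hk : T ≤ 2 ^ k * (2 * T₀) :=
    hk.le.trans (le_mul_of_one_le_right (by positivity) (by linarith))
  induction k generalizing T with
  | zero => exact hinit T hT (by linarith)
  | succ k ih =>
    rcases le_or_gt T (2 * T₀) with hle | hgt
    · exact hinit T hT hle
    have hprev := ih (T := T / 2) (by linarith) (by rw [pow_succ] at hk; linarith)
    have hstep := hdouble (T / 2) (by linarith)
    rw [mul_div_cancel₀ T two_ne_zero] at hstep
    calc N T ≤ (B + A) * F (T / 2) := by linarith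
      _ ≤ (B + A) * (3 / 4 * F T) := by
          gcongr
          · linarith
          · exact hFhalf T hT
      _ ≤ B * F T := by nlinarith [hF T hT]

theorem theorem3p2 :
    Differentiable ℂ riemannAux ∧
    ∃ C : ℝ, ∀ α : ℝ, 1 / 2 < α → α ≤ 1 → ∀ T : ℝ, 2 ≤ T →
      (riemannAuxZeros α T).Finite ∧
      (riemannAuxCount α T : ℝ) ≤ C * T ^ (3 / 2 - α) * Real.log T ^ 3 := by
  obtain ⟨C, T₀, hC, hT₀, hdouble⟩ := exists_riemannAuxCount_two_mul_le
  set N₀ : ℝ := (riemannAuxCount (1 / 2) (2 * T₀) : ℝ)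
  have hN₀ : 0 ≤ N₀ := Nat.cast_nonneg _
  refine ⟨differentiable_riemannAux, 4 * C + 8 * N₀, fun α hα hα1 T hT =>
    ⟨finite_riemannAuxZeros α T, ?_⟩⟩
  have hF : ∀ U ≥ 2, 0 ≤ U ^ (3 / 2 - α) * Real.log U ^ 3 := fun U hU => by
    linarith [one_le_eight_mul_rpow_mul_log_pow hU (by linarith : 0 ≤ 3 / 2 - α)]
  have hinit : ∀ U ≥ 2, U ≤ 2 * T₀ → (riemannAuxCount α U : ℝ) ≤
      (4 * C + 8 * N₀) * (U ^ (3 / 2 - α) * Real.log U ^ 3) := by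
    intro U hU hUT
    have hscale := one_le_eight_mul_rpow_mul_log_pow hU (by linarith : 0 ≤ 3 / 2 - α)
    calc (riemannAuxCount α U : ℝ) ≤ N₀ := riemannAuxCount_mono hα.le hUT
      _ ≤ N₀ * (8 * (U ^ (3 / 2 - α) * Real.log U ^ 3)) := le_mul_of_one_le_right hN₀ hscale
      _ ≤ _ := by nlinarith [hF U hU]
  rw [mul_assoc]
  exact le_mul_of_two_mul_le_add (N := fun U => riemannAuxCount α U) (by linarith) hC.le
    (by linarith) hF (fun U hU => half_rpow_mul_log_pow_le hU (by linarith)) hinit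
    (fun U hU => hdouble U hU α hα.le hα1) hT
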